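/- Let $k$ be an algebraically closed field of characteristic $0$, let $\alpha,\beta\in k$ with $\beta\neq 0$, and let $n,m$ be integers with $m\ge n>1$ and $\gcd(n,m)=1$. Let $$A=A(\alpha,\beta)=k\langle x,y\rangle/(x^2y-\beta yx^2-\alpha xyx,\ xy^2-\beta y^2x-\alpha yxy)$$ be the graded down-up algebra with $\deg x=n$ and $\deg y=m$, and write $A=\bigoplus_{d\ge 0}A_d$. Put $\ell=2(n+m)$ (the Gorenstein parameter of the AS-regular algebra $A$), and let $\nabla A$ be the Beilinson algebra of $A$, that is, the $k$-algebra of upper triangular $\ell\times\ell$ matrices $(a_{ij})$ with $a_{ij}\in A_{j-i}$ for $i\le j$ and $a_{ij}=0$ for $i>j$, with multiplication $(a_{ij})(b_{ij})=\left(\sum_{r}a_{rj}b_{ir}\right)$. For a $k$-algebra $B$ let $\operatorname{HH}^r(B)=\operatorname{Ext}^r_{B^{\mathrm e}}(B,B)$ be the $r$-th Hochschild cohomology group, where $B^{\mathrm e}=B^{\mathrm{op}}\otimes_k B$. Say that Case I holds if $n+m$ is even and $\alpha=0$, and that Case II holds otherwise. Then - $\dim_k\operatorname{HH}^0(\nabla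 A)=1$; - $\dim_k\operatorname{HH}^1(\nabla A)=\begin{cases}2&\text{in Case I},\\ 1&\text{in Case II};\end{cases}$ - $\dim_k\operatorname{HH}^2(\nabla A)=\begin{cases}m+5&\text{if } n=2 \text{ in Case I},\\ m+4&\text{if } n=2 \text{ in Case II},\\ n+m+1&\text{if } n\ge 3 \text{ in Case I},\\ n+m&\text{if } n\ge 3 \text{ in Case II};\end{cases}$ - $\dim_k\operatorname{HH}^r(\nabla A)=0$ for all $r\ge 3$. -/

import Mathlib

open scoped TensorProduct

universe u

noncomputable section

/-! ### Graded down-up algebras -/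

/-- The defining relations of the down-up algebra `A(α, β)` on the free algebra on
`x = ι 0` and `y = ι 1`:
`x²y = β yx² + α xyx` and `xy² = β y²x + α yxy`. -/
inductive DownUp.Rel {k : Type u} [CommRing k] (α β : k) :
    FreeAlgebra k (Fin 2) → FreeAlgebra k (Fin 2) → Prop
  | xxy : DownUp.Rel α β
      (FreeAlgebra.ι k 0 * FreeAlgebra.ι k 0 * FreeAlgebra.ι k 1)
      (β • (FreeAlgebra.ι k 1 * FreeAlgebra.ι k 0 * FreeAlgebra.ι k 0)
        + α • (FreeAlgebra.ι k 0 * FreeAlgebra.ι k 1 * FreeAlgebra.ι k 0))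
  | xyy : DownUp.Rel α β
      (FreeAlgebra.ι k 0 * FreeAlgebra.ι k 1 * FreeAlgebra.ι k 1)
      (β • (FreeAlgebra.ι k 1 * FreeAlgebra.ι k 1 * FreeAlgebra.ι k 0)
        + α • (FreeAlgebra.ι k 1 * FreeAlgebra.ι k 0 * FreeAlgebra.ι k 1))

/-- The down-up algebra
`A(α, β) = k⟨x, y⟩ / (x²y - β yx² - α xyx, xy² - β y²x - α yxy)`. -/
abbrev DownUp {k : Type u} [CommRing k] (α β : k) : Type u :=
  RingQuot (DownUp.Rel α β)

namespace DownUp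

variable {k : Type u} [CommRing k] (α β : k)

/-- The generators of the down-up algebra: `gen 0` is `x` and `gen 1` is `y`. -/
def gen (i : Fin 2) : DownUp α β :=
  RingQuot.mkAlgHom k (DownUp.Rel α β) (FreeAlgebra.ι k i)

/-- The monomial of `A(α, β)` given by a word in the letters `0` (for `x`) and `1` (for `y`). -/
def monomial (w : List (Fin 2)) : DownUp α β :=
  (w.map (gen α β)).prod

/-- The weight of a word, for `deg x = n` and `deg y = m`. -/
def weight (n m : ℕ) (w : List (Fin 2)) : ℕ :=
  (w.map ![n, m]).sum

/-- The homogeneous component `A_d` of `A(α, β)` for the weights `deg x = n`, `deg y = m`: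
the span of the monomials of weight `d`. -/
def component (n m : ℕ) (d : ℕ) : Submodule k (DownUp α β) :=
  Submodule.span k (monomial α β '' {w | weight n m w = d})

instance component_gradedMonoid (n m : ℕ) : SetLike.GradedMonoid (component α β n m) where
  one_mem := Submodule.subset_span ⟨[], by simp [weight], by simp [monomial]⟩
  mul_mem := by
    intro i j a b ha hb
    have h := Submodule.mul_mem_mul ha hb
    rw [component, component, Submodule.span_mul_span] at h
    refine Submodule.span_mono ?_ h
    rintro _ ⟨_, ⟨v, hv, rfl⟩, _, ⟨w, hw, rfl⟩, rfl⟩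
    refine ⟨v ++ w, ?_, by simp [monomial]⟩
    simp only [weight, Set.mem_ofPred_eq] at hv hw ⊢
    simp [hv, hw]

end DownUp

/-! ### Beilinson algebras -/

/-- The Beilinson algebra of a graded algebra `A = ⨁ 𝒜 d` with respect to `ℓ`
(for an AS-regular algebra, `ℓ` is its Gorenstein parameter).
Its elements are usually written as upper triangular `ℓ × ℓ` matrices `(a i j)` with
`a i j ∈ 𝒜 (j - i)` for `i ≤ j` and with the multiplication
`(a * b) i j = ∑ r, a r j * b i r`. This is the ordinary matrix multiplication of the
transposed matrices, and here we store the transposed matrices `N i j = a j i`. -/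
def beilinsonAlgebra {k A : Type u} [CommRing k] [Ring A] [Algebra k A]
    (𝒜 : ℕ → Submodule k A) [SetLike.GradedMonoid 𝒜] (ℓ : ℕ) :
    Subalgebra k (Matrix (Fin ℓ) (Fin ℓ) A) where
  carrier := {N | ∀ i j : Fin ℓ,
    (j ≤ i → N i j ∈ 𝒜 ((i : ℕ) - (j : ℕ))) ∧ (i < j → N i j = 0)}
  mul_mem' := by
    intro M N hM hN i j
    refine ⟨fun hij => ?_, fun hij => ?_⟩
    · rw [Matrix.mul_apply]
      refine Submodule.sum_mem _ fun r _ => ?_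
      rcases lt_or_ge i r with h | h
      · rw [(hM i r).2 h, zero_mul]
        exact Submodule.zero_mem _
      · rcases lt_or_ge r j with h' | h'
        · rw [(hN r j).2 h', mul_zero]
          exact Submodule.zero_mem _
        · have hmem := SetLike.mul_mem_graded ((hM i r).1 h) ((hN r j).1 h')
          have e : ((i : ℕ) - (r : ℕ)) + ((r : ℕ) - (j : ℕ)) = (i : ℕ) - (j : ℕ) := by
            have h1 : (r : ℕ) ≤ i := h
            have h2 : (j : ℕ) ≤ r := h'
            omega
          rwa [e] at hmem
    · rw [Matrix.mul_apply]
      refine Finset.sum_eq_zero fun r _ => ?_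
      rcases lt_or_ge i r with h | h
      · rw [(hM i r).2 h, zero_mul]
      · rw [(hN r j).2 (lt_of_le_of_lt h hij), mul_zero]
  add_mem' := by
    intro M N hM hN i j
    refine ⟨fun hij => Submodule.add_mem _ ((hM i j).1 hij) ((hN i j).1 hij), fun hij => ?_⟩
    rw [Matrix.add_apply, (hM i j).2 hij, (hN i j).2 hij, add_zero]
  algebraMap_mem' := by
    intro c i j
    rw [Matrix.algebraMap_matrix_apply]
    refine ⟨fun _ => ?_, fun hij => if_neg hij.ne⟩
    split_ifs with h
    · subst h
      rw [Nat.sub_self, Algebra.algebraMap_eq_smul_one]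
      exact Submodule.smul_mem _ _ SetLike.GradedOne.one_mem
    · exact Submodule.zero_mem _

/-- The Beilinson algebra `∇A` of the graded down-up algebra `A = A(α, β)` with weights
`deg x = n`, `deg y = m`, whose Gorenstein parameter is `2 (n + m)`. -/
abbrev DownUp.Beilinson {k : Type u} [CommRing k] (α β : k) (n m : ℕ) : Type u :=
  beilinsonAlgebra (DownUp.component α β n m) (2 * (n + m))

/-! ### Hochschild cohomology -/

/-- An algebra `B` as a module over its enveloping algebra, `(a ⊗ c) • b = a * b * c`.
Left modules over `B ⊗ Bᵐᵒᵖ` are the same as right modules over `Bᵐᵒᵖ ⊗ B`,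
i.e. as `B`-bimodules on which `k` acts centrally. -/
def hochschildBimodule (k B : Type u) [Field k] [Ring B] [Algebra k B] :
    ModuleCat.{u} (B ⊗[k] Bᵐᵒᵖ) :=
  letI : Module (B ⊗[k] Bᵐᵒᵖ) B := instModuleTensorProductMop k B
  ModuleCat.of (B ⊗[k] Bᵐᵒᵖ) B

/-- The Hochschild cohomology `HH^r(B) = Ext^r_{B^e}(B, B)` of a `k`-algebra `B`,
where `B^e` is the enveloping algebra; it is a `k`-vector space through the `k`-linear
structure of the category of `B^e`-modules. -/
abbrev HochschildCohomology (k B : Type u) [Field k] [Ring B] [Algebra k B] (r : ℕ) : Type u :=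
  CategoryTheory.Abelian.Ext.{u} (hochschildBimodule k B) (hochschildBimodule k B) r

end

/-! Write B = ∇A, E for its enveloping algebra, e_v for the diagonal idempotents (with e_v = 0 for v
≥ ℓ), and f_s = ∑_v e_{v+s} ⊗ e_v in E, so that E f_s = ⊕_v B e_{v+s} ⊗ e_v B is projective. As a
quiver algebra, B has arrows x of length n, arrows y of length m, and relations of lengths 2n+m and
n+2m. The complex of B-bimodules attached to this presentation, 0 → E f_{2n+m} ⊕ E f_{n+2m} → E f_n
⊕ E f_m → E f_0 → B → 0, has the Fox derivatives of the relations as its left map, and it is exact.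
The last term of the resolution of A would sit in degree ℓ, where f_ℓ = 0; hence the length is two
and HH^r = 0 for r ≥ 3.

Exactness at E f_0 holds because arrows and idempotents generate B (`env_exact_zero`). Exactness at
the next term is the statement that derivations of B exist with any prescribed values on arrows that
satisfy the derived relations (`env_exact_one`, `exists_model_derivation`); they come from A through
square-zero extensions. Injectivity on the left is a triangularity argument: in the few degrees that
occur, A is at most one-dimensional and detected by a character (`env_injective`).

Then one counts. Hom(E f_s, B) = f_s B is a product of ℓ - s copies of A_s (`fixedSubspaceEquiv`).
Here A_0, A_n, A_m are lines, A_{2n+m} is a plane, and A_{n+2m} is a plane unless n = 2, when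
x^{m+1} adds a dimension. The kernel in degree 0 is the centre, namely the scalars
(`finrank_fixedKernel`). An element of Hom(E f_n ⊕ E f_m, B) is a pair of scalar sequences a, b on
the arrows, and the derived relations only involve c_v = a_v - a_{v+m} + b_{v+n} - b_v for v < n+m.
They say that c, viewed on ℤ/(n+m), changes sign under translation by n and is killed by α
(`finrank_fixedPairKernel`). Such c form a line in Case I and vanish in Case II, and this accounts
for the difference of one between the cases. -/

noncomputable section

/-! ### Dimension shifting for `Ext` over a field -/

namespace CategoryTheory.ShortComplex.ShortExact

open CategoryTheory CategoryTheory.Abelian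

universe v w t

variable (k : Type t) [Field k] {C : Type v} [Category.{w} C] [Abelian C] [Linear k C]
  {S : ShortComplex C}

theorem ker_leftComp_f (hS : S.ShortExact) (N : C) :
    LinearMap.ker (Linear.leftComp k N S.f) = LinearMap.range (Linear.leftComp k N S.g) := by
  have := hS.epi_g
  ext h
  constructor
  · intro hh
    exact ⟨hS.exact.desc h hh, hS.exact.g_desc h hh⟩
  · rintro ⟨h, rfl⟩
    simp

theorem leftComp_g_injective (hS : S.ShortExact) (N : C) :
    Function.Injective (Linear.leftComp k N S.g) := by
  have := hS.epi_g
  intro a b hab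
  exact (cancel_epi S.g).1 hab

theorem finite_hom_X₃ (hS : S.ShortExact) (N : C) [Module.Finite k (S.X₂ ⟶ N)] :
    Module.Finite k (S.X₃ ⟶ N) :=
  Module.Finite.of_injective _ (hS.leftComp_g_injective k N)

variable [HasExt.{u} C]

/-- The connecting map `Hom(S.X₁, N) → Ext¹(S.X₃, N)`. -/
def homConnecting (hS : S.ShortExact) (N : C) : (S.X₁ ⟶ N) →ₗ[k] Ext.{u} S.X₃ N 1 :=
  (hS.extClass.precompOfLinear k N (add_zero 1)) ∘ₗ (Ext.linearEquiv₀ (R := k)).symm.toLinearMap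

theorem homConnecting_surjective (hS : S.ShortExact) (N : C) [Projective S.X₂] :
    Function.Surjective (hS.homConnecting k N) := by
  intro x
  obtain ⟨y, hy⟩ := Ext.contravariant_sequence_exact₃ hS N x (Ext.eq_zero_of_projective _)
    (add_zero 1)
  obtain ⟨z, rfl⟩ := (Ext.linearEquiv₀ (R := k)).symm.surjective y
  exact ⟨z, hy⟩

theorem ker_homConnecting (hS : S.ShortExact) (N : C) :
    LinearMap.ker (hS.homConnecting k N) = LinearMap.range (Linear.leftComp k N S.f) := by
  ext h
  constructor
  · intro hh
    obtain ⟨y, hy⟩ := Ext.contravariant_sequence_exact₁ hS N (Ext.mk₀ h) (add_zero 1) hh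
    obtain ⟨z, rfl⟩ := (Ext.linearEquiv₀ (R := k)).symm.surjective y
    refine ⟨z, ?_⟩
    apply (Ext.linearEquiv₀ (R := k)).symm.injective
    simpa using hy
  · rintro ⟨h, rfl⟩
    change hS.extClass.comp (Ext.mk₀ (S.f ≫ h)) (add_zero 1) = 0
    rw [← Ext.mk₀_comp_mk₀]
    exact hS.extClass_comp_assoc _

theorem finite_ext_one (hS : S.ShortExact) (N : C) [Projective S.X₂]
    [Module.Finite k (S.X₁ ⟶ N)] : Module.Finite k (Ext.{u} S.X₃ N 1) :=
  Module.Finite.of_surjective _ (hS.homConnecting_surjective k N)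

/-- Alternating sum of dimensions in 0 → Hom(S.X₃, N) → Hom(S.X₂, N) → Hom(S.X₁, N) → Ext¹(S.X₃, N)
→ 0, which stops there because `S.X₂` is projective. -/
theorem finrank_ext_one (hS : S.ShortExact) (N : C) [Projective S.X₂]
    [Module.Finite k (S.X₂ ⟶ N)] [Module.Finite k (S.X₁ ⟶ N)] :
    Module.finrank k (Ext.{u} S.X₃ N 1) + Module.finrank k (S.X₂ ⟶ N) =
      Module.finrank k (S.X₁ ⟶ N) + Module.finrank k (S.X₃ ⟶ N) := by
  have h1 := LinearMap.finrank_range_add_finrank_ker (hS.homConnecting k N)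
  have h2 := LinearMap.finrank_range_add_finrank_ker (Linear.leftComp k N S.f)
  have h3 := LinearMap.finrank_range_of_inj (hS.leftComp_g_injective k N)
  rw [LinearMap.range_eq_top.2 (hS.homConnecting_surjective k N), finrank_top,
    hS.ker_homConnecting k] at h1
  rw [hS.ker_leftComp_f k] at h2
  omega

/-- Dimension shifting: `Ext^{r+1}(S.X₁, N) ≃ Ext^{r+2}(S.X₃, N)` when `S.X₂` is projective. -/
def extShift (hS : S.ShortExact) (N : C) [Projective S.X₂] (r : ℕ) :
    Ext.{u} S.X₁ N (r + 1) ≃ₗ[k] Ext.{u} S.X₃ N (r + 2) :=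
  LinearEquiv.ofBijective (hS.extClass.precompOfLinear k N (by omega)) (by
    constructor
    · rw [injective_iff_map_eq_zero]
      intro x hx
      obtain ⟨y, rfl⟩ := Ext.contravariant_sequence_exact₁ hS N x (by omega) hx
      rw [Ext.eq_zero_of_projective y, Ext.comp_zero]
    · intro x
      exact Ext.contravariant_sequence_exact₃ hS N x (Ext.eq_zero_of_projective _) (by omega))

end CategoryTheory.ShortComplex.ShortExact

section ProjectiveResolutionLengthTwo

open CategoryTheory CategoryTheory.Abelian

variable (k : Type u) [Field k] {E : Type u} [Ring E] [Algebra k E]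

/-- The dimensions of the `Ext` groups out of a module with a projective resolution of
length two. -/
theorem ModuleCat.finrank_ext_of_resolution {P₂ P₁ P₀ M : ModuleCat.{u} E} (d₂ : P₂ ⟶ P₁)
    (d₁ : P₁ ⟶ P₀) (ε : P₀ ⟶ M) [Projective P₂] [Projective P₁] [Projective P₀]
    (hd₂ : Function.Injective d₂) (h₁ : Function.Exact d₂ d₁) (h₀ : Function.Exact d₁ ε)
    (hε : Function.Surjective ε) (N : ModuleCat.{u} E)
    [Module.Finite k (P₀ ⟶ N)] [Module.Finite k (P₁ ⟶ N)] [Module.Finite k (P₂ ⟶ N)] :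
    (∀ r, Module.Finite k (Ext.{u} M N r)) ∧
    Module.finrank k (Ext.{u} M N 0) =
      Module.finrank k (LinearMap.ker (Linear.leftComp k N d₁)) ∧
    Module.finrank k (Ext.{u} M N 1) + Module.finrank k (P₀ ⟶ N) =
      Module.finrank k (LinearMap.ker (Linear.leftComp k N d₂)) +
        Module.finrank k (LinearMap.ker (Linear.leftComp k N d₁)) ∧
    Module.finrank k (Ext.{u} M N 2) + Module.finrank k (P₁ ⟶ N) =
      Module.finrank k (P₂ ⟶ N) + Module.finrank k (LinearMap.ker (Linear.leftComp k N d₂)) ∧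
    ∀ r, Module.finrank k (Ext.{u} M N (r + 3)) = 0 := by
  -- The resolution is cut at the first syzygy K into two short exact sequences, 0 → K → P₀ → M → 0
  -- and 0 → P₂ → P₁ → K → 0, and Ext is shifted along both.
  let K : ModuleCat.{u} E := ModuleCat.of E (LinearMap.ker ε.hom)
  let i : K ⟶ P₀ := ModuleCat.ofHom (LinearMap.ker ε.hom).subtype
  let q : P₁ ⟶ K := ModuleCat.ofHom (d₁.hom.codRestrict _ fun x => (h₀ _).2 ⟨x, rfl⟩)
  have hqi : q ≫ i = d₁ := rfl
  have hq : Epi q := (ModuleCat.epi_iff_surjective _).2 fun x => by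
    obtain ⟨y, hy⟩ := (h₀ x.1).1 x.2
    exact ⟨y, Subtype.ext hy⟩
  have wS : i ≫ ε = 0 := by
    ext x
    exact x.2
  have hdq : d₂ ≫ q = 0 := by
    ext x
    exact congrArg Subtype.val (Subtype.ext (h₁.apply_apply_eq_zero x) : q (d₂ x) = 0)
  let S := ShortComplex.mk i ε wS
  let T := ShortComplex.mk d₂ q hdq
  have hS : S.ShortExact := ModuleCat.shortComplex_shortExact S
    (fun x => ⟨fun h => ⟨⟨x, h⟩, rfl⟩, by rintro ⟨y, rfl⟩; exact y.2⟩) Subtype.val_injective hε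
  have hT : T.ShortExact := ModuleCat.shortComplex_shortExact T
    (fun x => ⟨fun h => (h₁ x).1 (congrArg Subtype.val h), by
      rintro ⟨y, rfl⟩; exact Subtype.ext (h₁.apply_apply_eq_zero y)⟩) hd₂
    ((ModuleCat.epi_iff_surjective _).1 hq)
  have : Projective S.X₂ := ‹Projective P₀›
  have : Projective T.X₂ := ‹Projective P₁›
  have : Projective T.X₁ := ‹Projective P₂›
  have : Module.Finite k (S.X₂ ⟶ N) := ‹Module.Finite k (P₀ ⟶ N)›
  have : Module.Finite k (T.X₂ ⟶ N) := ‹Module.Finite k (P₁ ⟶ N)›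
  have : Module.Finite k (T.X₁ ⟶ N) := ‹Module.Finite k (P₂ ⟶ N)›
  have : Module.Finite k (T.X₃ ⟶ N) := hT.finite_hom_X₃ k N
  have : Module.Finite k (S.X₁ ⟶ N) := this
  have : Module.Finite k (S.X₃ ⟶ N) := hS.finite_hom_X₃ k N
  -- Since d₁ factors as the epimorphism q followed by i, a map kills d₁ exactly when it kills i.
  have hker : LinearMap.ker (Linear.leftComp k N d₁) = LinearMap.ker (Linear.leftComp k N i) := by
    ext f
    change (q ≫ i) ≫ f = 0 ↔ i ≫ f = 0
    rw [Category.assoc, ← cancel_epi q, Limits.comp_zero]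
  have e0 : Module.finrank k (M ⟶ N) =
      Module.finrank k (LinearMap.ker (Linear.leftComp k N d₁)) := by
    rw [hker, hS.ker_leftComp_f k]
    exact (LinearMap.finrank_range_of_inj (hS.leftComp_g_injective k N)).symm
  have e1 : Module.finrank k (K ⟶ N) =
      Module.finrank k (LinearMap.ker (Linear.leftComp k N d₂)) := by
    rw [hT.ker_leftComp_f k]
    exact (LinearMap.finrank_range_of_inj (hT.leftComp_g_injective k N)).symm
  have hvanish : ∀ r, Subsingleton (Ext.{u} P₂ N (r + 1)) := fun r =>
    subsingleton_of_forall_eq 0 Ext.eq_zero_of_projective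
  have s0 : Module.Finite k (Ext.{u} M N 0) :=
    Module.Finite.equiv (Ext.linearEquiv₀ (R := k) (X := S.X₃) (Y := N)).symm
  have s1 : Module.Finite k (Ext.{u} M N 1) := hS.finite_ext_one k N
  have s1' : Module.Finite k (Ext.{u} K N 1) := hT.finite_ext_one k N
  have shift : ∀ r, Nonempty (Ext.{u} K N (r + 1) ≃ₗ[k] Ext.{u} M N (r + 2)) :=
    fun r => ⟨hS.extShift k N r⟩
  have shift' : ∀ r, Nonempty (Ext.{u} P₂ N (r + 1) ≃ₗ[k] Ext.{u} K N (r + 2)) :=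
    fun r => ⟨hT.extShift k N r⟩
  have hzero : ∀ r, Subsingleton (Ext.{u} M N (r + 3)) := fun r => by
    obtain ⟨e⟩ := shift (r + 1)
    obtain ⟨e'⟩ := shift' r
    exact (e'.trans e).symm.toEquiv.subsingleton
  refine ⟨fun r => ?_, ?_, ?_, ?_, fun r => ?_⟩
  · match r with
    | 0 => exact s0
    | 1 => exact s1
    | 2 => exact Module.Finite.equiv (shift 0).some
    | r + 3 => infer_instance
  · rw [← e0]
    exact LinearEquiv.finrank_eq Ext.linearEquiv₀
  · rw [← e1, ← e0]
    exact hS.finrank_ext_one k N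
  · rw [← e1, ← LinearEquiv.finrank_eq (shift 0).some]
    exact hT.finrank_ext_one k N
  · exact Module.finrank_zero_of_subsingleton

end ProjectiveResolutionLengthTwo

/-! ### Projective left ideals generated by idempotents -/

section IdempotentLeftIdeals

open CategoryTheory CategoryTheory.Abelian

variable {k : Type u} [Field k] {E : Type u} [Ring E] [Algebra k E]

/-- The left ideal `E f`. -/
abbrev leftIdeal (f : E) : Submodule E E := Submodule.span E {f}

theorem mul_mem_leftIdeal {f : E} (t : E) : t * f ∈ leftIdeal f :=
  Submodule.mem_span_singleton.2 ⟨t, rfl⟩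

theorem mul_eq_of_mem_leftIdeal {f t : E} (hf : f * f = f) (ht : t ∈ leftIdeal f) : t * f = t := by
  obtain ⟨a, rfl⟩ := Submodule.mem_span_singleton.1 ht
  rw [smul_eq_mul, mul_assoc, hf]

theorem leftIdeal_projective {f : E} (hf : f * f = f) : Module.Projective E (leftIdeal f) :=
  Module.Projective.of_split (leftIdeal f).subtype
    ((LinearMap.toSpanSingleton E E f).codRestrict (leftIdeal f) fun t => mul_mem_leftIdeal t)
    (by
      ext x
      exact mul_eq_of_mem_leftIdeal hf x.2)

/-- Right multiplication by `w` as a map `E f → E g`, when `f w = w g`. -/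
def leftIdealMulRight {f g : E} (w : E) (h : f * w = w * g) : leftIdeal f →ₗ[E] leftIdeal g :=
  ((LinearMap.toSpanSingleton E E w).comp (leftIdeal f).subtype).codRestrict (leftIdeal g)
    (by
      rintro ⟨x, hx⟩
      obtain ⟨a, rfl⟩ := Submodule.mem_span_singleton.1 hx
      change a * f * w ∈ _
      rw [mul_assoc, h, ← mul_assoc]
      exact mul_mem_leftIdeal _)

open scoped ModuleCat

/-- The elements of `N` fixed by `f`. -/
def fixedSubspace (k : Type u) [Field k] [Algebra k E] (N : ModuleCat.{u} E) (f : E) :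
    Submodule k N where
  carrier := {m | f • m = m}
  add_mem' := fun {a b} ha hb => by
    rw [Set.mem_ofPred_eq] at *
    rw [smul_add, ha, hb]
  zero_mem' := smul_zero f
  smul_mem' := fun c m hm => by
    rw [Set.mem_ofPred_eq] at *
    rw [← algebraMap_smul E c m, smul_smul, ← Algebra.commutes, mul_smul, hm]

variable {N : ModuleCat.{u} E}

/-- `Hom(E f, N) ≃ f N`. -/
def leftIdealHomEquiv {f : E} (hf : f * f = f) :
    (ModuleCat.of E (leftIdeal f) ⟶ N) ≃ₗ[k] fixedSubspace k N f where
  toFun φ := ⟨φ ⟨f, Submodule.mem_span_singleton_self f⟩, by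
    change f • φ.hom _ = φ.hom _
    rw [← map_smul]
    congr 1
    exact Subtype.ext hf⟩
  map_add' _ _ := rfl
  map_smul' c φ := rfl
  invFun m := ModuleCat.ofHom ((LinearMap.toSpanSingleton E N m.1).comp (leftIdeal f).subtype)
  left_inv φ := by
    ext x
    change x.1 • φ.hom _ = φ.hom x
    rw [← map_smul]
    congr 1
    exact Subtype.ext (mul_eq_of_mem_leftIdeal hf x.2)
  right_inv m := Subtype.ext m.2

/-- `Hom(E f × E g, N) ≃ f N × g N`. -/
def leftIdealProdHomEquiv {f g : E} (hf : f * f = f) (hg : g * g = g) :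
    (ModuleCat.of E (leftIdeal f × leftIdeal g) ⟶ N) ≃ₗ[k]
      fixedSubspace k N f × fixedSubspace k N g where
  toFun φ := (leftIdealHomEquiv hf (ModuleCat.ofHom (φ.hom.comp (LinearMap.inl E _ _))),
    leftIdealHomEquiv hg (ModuleCat.ofHom (φ.hom.comp (LinearMap.inr E _ _))))
  map_add' φ ψ := rfl
  map_smul' c φ := rfl
  invFun m := ModuleCat.ofHom (LinearMap.coprod
    ((leftIdealHomEquiv (k := k) hf).symm m.1).hom ((leftIdealHomEquiv (k := k) hg).symm m.2).hom)
  left_inv φ := by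
    apply ModuleCat.hom_ext
    change LinearMap.coprod ((leftIdealHomEquiv (k := k) hf).symm (leftIdealHomEquiv hf _)).hom
      ((leftIdealHomEquiv (k := k) hg).symm (leftIdealHomEquiv hg _)).hom = _
    rw [LinearEquiv.symm_apply_apply, LinearEquiv.symm_apply_apply]
    ext x <;> simp
  right_inv m := by
    refine Prod.ext ?_ ?_
    · refine Eq.trans ?_ ((leftIdealHomEquiv (k := k) hf).apply_symm_apply m.1)
      change leftIdealHomEquiv hf _ = _
      congr 1
      apply ModuleCat.hom_ext
      ext x
      simp
    · refine Eq.trans ?_ ((leftIdealHomEquiv (k := k) hg).apply_symm_apply m.2)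
      change leftIdealHomEquiv hg _ = _
      congr 1
      apply ModuleCat.hom_ext
      ext x
      simp

end IdempotentLeftIdeals

/-! ### Ext groups from a resolution by left ideals of idempotents -/

section IdempotentResolution

open CategoryTheory CategoryTheory.Abelian
open scoped ModuleCat

variable (k : Type u) [Field k] {E : Type u} [Ring E] [Algebra k E]

/-- The common kernel on `f N × g N` of two maps given by pairs of elements of the ring. -/
def fixedPairKernel (N : ModuleCat.{u} E) (f g z₁₁ z₁₂ z₂₁ z₂₂ : E) :
    Submodule k (fixedSubspace k N f × fixedSubspace k N g) where
  carrier := {m | z₁₁ • m.1.1 + z₁₂ • m.2.1 = 0 ∧ z₂₁ • m.1.1 + z₂₂ • m.2.1 = 0}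
  add_mem' := fun {a b} ha hb => by
    refine ⟨?_, ?_⟩
    · have := congrArg₂ (· + ·) ha.1 hb.1
      simp only [add_zero] at this
      rw [← this]
      simp only [Prod.fst_add, Prod.snd_add, Submodule.coe_add, smul_add]
      abel
    · have := congrArg₂ (· + ·) ha.2 hb.2
      simp only [add_zero] at this
      rw [← this]
      simp only [Prod.fst_add, Prod.snd_add, Submodule.coe_add, smul_add]
      abel
  zero_mem' := by simp
  smul_mem' := fun c m hm => by
    have key : ∀ z : E, ∀ n : N, z • c • n = c • z • n := fun z n => by
      rw [← algebraMap_smul E c n, smul_smul, ← Algebra.commutes, mul_smul, algebraMap_smul]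
    refine ⟨?_, ?_⟩
    · have := congrArg (c • ·) hm.1
      simpa [key] using this
    · have := congrArg (c • ·) hm.2
      simpa [key] using this

/-- The kernel on `f N` of a pair of elements of the ring. -/
def fixedKernel (N : ModuleCat.{u} E) (f w₁ w₂ : E) : Submodule k (fixedSubspace k N f) where
  carrier := {m | w₁ • m.1 = 0 ∧ w₂ • m.1 = 0}
  add_mem' := fun {a b} ha hb => by
    refine ⟨?_, ?_⟩
    · simp [ha.1, hb.1]
    · simp [ha.2, hb.2]
  zero_mem' := by simp
  smul_mem' := fun c m hm => by
    have key : ∀ z : E, ∀ n : N, z • c • n = c • z • n := fun z n => by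
      rw [← algebraMap_smul E c n, smul_smul, ← Algebra.commutes, mul_smul, algebraMap_smul]
    exact ⟨by simp [key, hm.1], by simp [key, hm.2]⟩

/-- The dimensions of `Ext` groups out of a module `M` with a generator `m₀` and a resolution
`0 → E g₁ × E g₂ → E f₁ × E f₂ → E f₀ → M → 0`, for idempotents `f₀, f₁, f₂, g₁, g₂`. -/
theorem finrank_ext_of_idempotents {f₀ f₁ f₂ g₁ g₂ w₁ w₂ z₁₁ z₁₂ z₂₁ z₂₂ : E}
    (hf₀ : f₀ * f₀ = f₀) (hf₁ : f₁ * f₁ = f₁) (hf₂ : f₂ * f₂ = f₂)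
    (hg₁ : g₁ * g₁ = g₁) (hg₂ : g₂ * g₂ = g₂)
    (hw₁ : f₁ * w₁ = w₁ * f₀) (hw₂ : f₂ * w₂ = w₂ * f₀)
    (h₁₁ : g₁ * z₁₁ = z₁₁ * f₁) (h₁₂ : g₁ * z₁₂ = z₁₂ * f₂)
    (h₂₁ : g₂ * z₂₁ = z₂₁ * f₁) (h₂₂ : g₂ * z₂₂ = z₂₂ * f₂)
    (hzw₁ : z₁₁ * w₁ + z₁₂ * w₂ = 0) (hzw₂ : z₂₁ * w₁ + z₂₂ * w₂ = 0)
    {M N : ModuleCat.{u} E} (m₀ : M) (hm₀ : f₀ • m₀ = m₀)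
    (hm₁ : w₁ • m₀ = 0) (hm₂ : w₂ • m₀ = 0)
    (hsurj : ∀ m : M, ∃ t : E, t • m₀ = m)
    (hex₀ : ∀ t : E, t * f₀ = t → t • m₀ = 0 → ∃ a b : E, t = a * f₁ * w₁ + b * f₂ * w₂)
    (hex₁ : ∀ s t : E, s * f₁ = s → t * f₂ = t → s * w₁ + t * w₂ = 0 →
      ∃ a b : E, s = a * g₁ * z₁₁ + b * g₂ * z₂₁ ∧ t = a * g₁ * z₁₂ + b * g₂ * z₂₂)
    (hinj : ∀ s t : E, s * g₁ = s → t * g₂ = t → s * z₁₁ + t * z₂₁ = 0 →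
      s * z₁₂ + t * z₂₂ = 0 → s = 0 ∧ t = 0)
    [Module.Finite k (fixedSubspace k N f₀)] [Module.Finite k (fixedSubspace k N f₁)]
    [Module.Finite k (fixedSubspace k N f₂)] [Module.Finite k (fixedSubspace k N g₁)]
    [Module.Finite k (fixedSubspace k N g₂)] :
    (∀ r, Module.Finite k (Ext.{u} M N r)) ∧
    Module.finrank k (Ext.{u} M N 0) = Module.finrank k (fixedKernel k N f₀ w₁ w₂) ∧
    Module.finrank k (Ext.{u} M N 1) + Module.finrank k (fixedSubspace k N f₀) =
      Module.finrank k (fixedPairKernel k N f₁ f₂ z₁₁ z₁₂ z₂₁ z₂₂) +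
        Module.finrank k (fixedKernel k N f₀ w₁ w₂) ∧
    Module.finrank k (Ext.{u} M N 2) +
        (Module.finrank k (fixedSubspace k N f₁) + Module.finrank k (fixedSubspace k N f₂)) =
      (Module.finrank k (fixedSubspace k N g₁) + Module.finrank k (fixedSubspace k N g₂)) +
        Module.finrank k (fixedPairKernel k N f₁ f₂ z₁₁ z₁₂ z₂₁ z₂₂) ∧
    ∀ r, Module.finrank k (Ext.{u} M N (r + 3)) = 0 := by
  let P₂ := ModuleCat.of E (leftIdeal g₁ × leftIdeal g₂)
  let P₁ := ModuleCat.of E (leftIdeal f₁ × leftIdeal f₂)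
  let P₀ := ModuleCat.of E (leftIdeal f₀)
  let d₂ : P₂ ⟶ P₁ := ModuleCat.ofHom (LinearMap.prod
    (LinearMap.coprod (leftIdealMulRight z₁₁ h₁₁) (leftIdealMulRight z₂₁ h₂₁))
    (LinearMap.coprod (leftIdealMulRight z₁₂ h₁₂) (leftIdealMulRight z₂₂ h₂₂)))
  let d₁ : P₁ ⟶ P₀ := ModuleCat.ofHom
    (LinearMap.coprod (leftIdealMulRight w₁ hw₁) (leftIdealMulRight w₂ hw₂))
  let ε : P₀ ⟶ M := ModuleCat.ofHom ((LinearMap.toSpanSingleton E M m₀).comp (leftIdeal f₀).subtype)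
  have := leftIdeal_projective hf₀
  have := leftIdeal_projective hf₁
  have := leftIdeal_projective hf₂
  have := leftIdeal_projective hg₁
  have := leftIdeal_projective hg₂
  have : Projective P₀ := (IsProjective.iff_projective _).1 inferInstance
  have : Projective P₁ := (IsProjective.iff_projective _).1 inferInstance
  have : Projective P₂ := (IsProjective.iff_projective _).1 inferInstance
  let e₀ : (P₀ ⟶ N) ≃ₗ[k] fixedSubspace k N f₀ := leftIdealHomEquiv hf₀
  let e₁ : (P₁ ⟶ N) ≃ₗ[k] fixedSubspace k N f₁ × fixedSubspace k N f₂ :=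
    leftIdealProdHomEquiv hf₁ hf₂
  let e₂ : (P₂ ⟶ N) ≃ₗ[k] fixedSubspace k N g₁ × fixedSubspace k N g₂ :=
    leftIdealProdHomEquiv hg₁ hg₂
  have : Module.Finite k (P₀ ⟶ N) := Module.Finite.equiv e₀.symm
  have : Module.Finite k (P₁ ⟶ N) := Module.Finite.equiv e₁.symm
  have : Module.Finite k (P₂ ⟶ N) := Module.Finite.equiv e₂.symm
  have val₁ : ∀ x : P₁, (d₁ x).1 = x.1.1 * w₁ + x.2.1 * w₂ := fun x => rfl
  have val₂ : ∀ x : P₂, (d₂ x).1.1 = x.1.1 * z₁₁ + x.2.1 * z₂₁ := fun x => rfl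
  have val₂' : ∀ x : P₂, (d₂ x).2.1 = x.1.1 * z₁₂ + x.2.1 * z₂₂ := fun x => rfl
  have main := ModuleCat.finrank_ext_of_resolution k d₂ d₁ ε ?_ ?_ ?_ ?_ N
  · have k₁ : Module.finrank k (LinearMap.ker (Linear.leftComp k N d₁)) =
        Module.finrank k (fixedKernel k N f₀ w₁ w₂) := by
      refine LinearEquiv.finrank_eq (e₀.ofSubmodules (LinearMap.ker (Linear.leftComp k N d₁))
        (fixedKernel k N f₀ w₁ w₂) ?_)
      ext m
      rw [Submodule.mem_map_equiv]
      have vm : ∀ x : P₀, (e₀.symm m) x = x.1 • m.1 := fun x => rfl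
      constructor
      · intro h
        refine ⟨?_, ?_⟩
        -- A map out of E f₁ × E f₂ vanishes as soon as it vanishes on the generators (f₁, 0) and
        -- (0, f₂), and these give the two equations of the kernel.
        · have := congrArg (fun φ : P₁ ⟶ N => φ (⟨f₁, Submodule.mem_span_singleton_self f₁⟩, 0)) h
          change (e₀.symm m) (d₁ _) = 0 at this
          rw [vm, val₁] at this
          change (f₁ * w₁ + 0 * w₂) • m.1 = 0 at this
          rwa [zero_mul, add_zero, hw₁, mul_smul, m.2] at this
        · have := congrArg (fun φ : P₁ ⟶ N => φ (0, ⟨f₂, Submodule.mem_span_singleton_self f₂⟩)) h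
          change (e₀.symm m) (d₁ _) = 0 at this
          rw [vm, val₁] at this
          change (0 * w₁ + f₂ * w₂) • m.1 = 0 at this
          rwa [zero_mul, zero_add, hw₂, mul_smul, m.2] at this
      · rintro ⟨h1, h2⟩
        apply ModuleCat.hom_ext
        apply LinearMap.ext
        intro x
        change (e₀.symm m) (d₁ x) = 0
        rw [vm, val₁, add_smul, mul_smul, mul_smul, h1, h2, smul_zero, smul_zero, add_zero]
    have k₂ : Module.finrank k (LinearMap.ker (Linear.leftComp k N d₂)) =
        Module.finrank k (fixedPairKernel k N f₁ f₂ z₁₁ z₁₂ z₂₁ z₂₂) := by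
      refine LinearEquiv.finrank_eq (e₁.ofSubmodules (LinearMap.ker (Linear.leftComp k N d₂))
        (fixedPairKernel k N f₁ f₂ z₁₁ z₁₂ z₂₁ z₂₂) ?_)
      ext m
      rw [Submodule.mem_map_equiv]
      have vm : ∀ x : P₁, (e₁.symm m) x = x.1.1 • m.1.1 + x.2.1 • m.2.1 := fun x => rfl
      constructor
      · intro h
        refine ⟨?_, ?_⟩
        · have := congrArg (fun φ : P₂ ⟶ N => φ (⟨g₁, Submodule.mem_span_singleton_self g₁⟩, 0)) h
          change (e₁.symm m) (d₂ _) = 0 at this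
          rw [vm, val₂, val₂'] at this
          change (g₁ * z₁₁ + 0 * z₂₁) • m.1.1 + (g₁ * z₁₂ + 0 * z₂₂) • m.2.1 = 0 at this
          rwa [zero_mul, add_zero, zero_mul, add_zero, h₁₁, h₁₂, mul_smul, mul_smul, m.1.2,
            m.2.2] at this
        · have := congrArg (fun φ : P₂ ⟶ N => φ (0, ⟨g₂, Submodule.mem_span_singleton_self g₂⟩)) h
          change (e₁.symm m) (d₂ _) = 0 at this
          rw [vm, val₂, val₂'] at this
          change (0 * z₁₁ + g₂ * z₂₁) • m.1.1 + (0 * z₁₂ + g₂ * z₂₂) • m.2.1 = 0 at this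
          rwa [zero_mul, zero_add, zero_mul, zero_add, h₂₁, h₂₂, mul_smul, mul_smul, m.1.2,
            m.2.2] at this
      · rintro ⟨h1, h2⟩
        apply ModuleCat.hom_ext
        apply LinearMap.ext
        intro x
        change (e₁.symm m) (d₂ x) = 0
        rw [vm, val₂, val₂', add_smul, add_smul, mul_smul, mul_smul, mul_smul, mul_smul,
          add_add_add_comm, ← smul_add, ← smul_add, h1, h2, smul_zero, smul_zero, add_zero]
    rw [k₁, k₂, e₀.finrank_eq, e₁.finrank_eq, e₂.finrank_eq, Module.finrank_prod,
      Module.finrank_prod] at main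
    exact main
  · rw [injective_iff_map_eq_zero d₂.hom]
    intro x hx
    have h1 := congrArg (fun y : P₁ => y.1.1) hx
    have h2 := congrArg (fun y : P₁ => y.2.1) hx
    obtain ⟨h3, h4⟩ := hinj _ _ (mul_eq_of_mem_leftIdeal hg₁ x.1.2)
      (mul_eq_of_mem_leftIdeal hg₂ x.2.2) h1 h2
    exact Prod.ext (Subtype.ext h3) (Subtype.ext h4)
  · intro x
    constructor
    · intro hx
      obtain ⟨a, b, h1, h2⟩ := hex₁ _ _ (mul_eq_of_mem_leftIdeal hf₁ x.1.2)
        (mul_eq_of_mem_leftIdeal hf₂ x.2.2) (congrArg Subtype.val hx)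
      exact ⟨(⟨a * g₁, mul_mem_leftIdeal a⟩, ⟨b * g₂, mul_mem_leftIdeal b⟩),
        Prod.ext (Subtype.ext h1.symm) (Subtype.ext h2.symm)⟩
    · rintro ⟨y, rfl⟩
      apply Subtype.ext
      rw [val₁, val₂, val₂', add_mul, add_mul, mul_assoc, mul_assoc, mul_assoc, mul_assoc,
        add_add_add_comm, ← mul_add, ← mul_add, hzw₁, hzw₂, mul_zero, mul_zero, add_zero]
      rfl
  · intro x
    constructor
    · intro hx
      obtain ⟨a, b, h⟩ := hex₀ _ (mul_eq_of_mem_leftIdeal hf₀ x.2) hx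
      exact ⟨(⟨a * f₁, mul_mem_leftIdeal a⟩, ⟨b * f₂, mul_mem_leftIdeal b⟩), Subtype.ext h.symm⟩
    · rintro ⟨y, rfl⟩
      change (d₁ y).1 • m₀ = 0
      rw [val₁, add_smul, mul_smul, mul_smul, hm₁, hm₂, smul_zero, smul_zero, add_zero]
  · intro m
    obtain ⟨t, rfl⟩ := hsurj m
    refine ⟨⟨t * f₀, mul_mem_leftIdeal t⟩, ?_⟩
    change (t * f₀) • m₀ = _
    rw [mul_smul, hm₀]

end IdempotentResolution

/-! ### Homogeneous components of the down-up algebra -/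

namespace DownUp

/-! ### Universal property, characters and Verma representations -/

section Presentation

variable {k : Type u} [CommRing k] (α β : k)

theorem gen_xxy : gen α β 0 * gen α β 0 * gen α β 1 =
    β • (gen α β 1 * gen α β 0 * gen α β 0) + α • (gen α β 0 * gen α β 1 * gen α β 0) := by
  simpa [gen] using RingQuot.mkAlgHom_rel k (Rel.xxy (α := α) (β := β))

theorem gen_xyy : gen α β 0 * gen α β 1 * gen α β 1 =
    β • (gen α β 1 * gen α β 1 * gen α β 0) + α • (gen α β 1 * gen α β 0 * gen α β 1) := by
  simpa [gen] using RingQuot.mkAlgHom_rel k (Rel.xyy (α := α) (β := β))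

/-- The algebra homomorphism out of the down-up algebra given by two elements satisfying the
relations. -/
def lift {S : Type*} [Ring S] [Algebra k S] (X Y : S)
    (h₁ : X * X * Y = β • (Y * X * X) + α • (X * Y * X))
    (h₂ : X * Y * Y = β • (Y * Y * X) + α • (Y * X * Y)) : DownUp α β →ₐ[k] S :=
  RingQuot.liftAlgHom k ⟨FreeAlgebra.lift k ![X, Y], by
    rintro a b (_ | _)
    · simpa using h₁
    · simpa using h₂⟩

section

variable {α β} {S : Type*} [Ring S] [Algebra k S] {X Y : S}
    (h₁ : X * X * Y = β • (Y * X * X) + α • (X * Y * X))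
    (h₂ : X * Y * Y = β • (Y * Y * X) + α • (Y * X * Y))

@[simp]
theorem lift_gen_zero : lift α β X Y h₁ h₂ (gen α β 0) = X := by
  simp [lift, gen]

@[simp]
theorem lift_gen_one : lift α β X Y h₁ h₂ (gen α β 1) = Y := by
  simp [lift, gen]

end

/-- Induction on elements of the down-up algebra. -/
theorem induction {p : DownUp α β → Prop} (hs : ∀ c : k, p (algebraMap k _ c))
    (hx : p (gen α β 0)) (hy : p (gen α β 1)) (hadd : ∀ a b, p a → p b → p (a + b))
    (hmul : ∀ a b, p a → p b → p (a * b)) (a : DownUp α β) : p a := by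
  obtain ⟨a, rfl⟩ := RingQuot.mkAlgHom_surjective k (Rel α β) a
  induction a using FreeAlgebra.induction with
  | grade0 r => simpa using hs r
  | grade1 i => fin_cases i; exacts [hx, hy]
  | mul a b ha hb => simpa using hmul _ _ ha hb
  | add a b ha hb => simpa using hadd _ _ ha hb

/-- The character with `x ↦ 1` and `y ↦ 0`. -/
def charX : DownUp α β →ₐ[k] k := lift α β 1 0 (by simp) (by simp)

/-- The character with `x ↦ 0` and `y ↦ 1`. -/
def charY : DownUp α β →ₐ[k] k := lift α β 0 1 (by simp) (by simp)

@[simp] theorem charX_zero : charX α β (gen α β 0) = 1 := lift_gen_zero _ _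
@[simp] theorem charX_one : charX α β (gen α β 1) = 0 := lift_gen_one _ _
@[simp] theorem charY_one : charY α β (gen α β 1) = 1 := lift_gen_one _ _

/-- The weights of the Verma module of the down-up algebra. -/
def vermaWeight : ℕ → k
  | 0 => 1
  | 1 => α
  | j + 2 => β * vermaWeight j + α * vermaWeight (j + 1)

/-- The operator `g ↦ (j ↦ a j * g (j + 1))`. -/
def weightedLower (a : ℕ → k) : Module.End k (ℕ → k) where
  toFun g j := a j * g (j + 1)
  map_add' _ _ := by ext; simp [mul_add]
  map_smul' _ _ := by ext; simp; ring

/-- The operator sending `g` to `0` at `0` and to `b j * g j` at `j + 1`. -/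
def weightedRaise (b : ℕ → k) : Module.End k (ℕ → k) where
  toFun g j := Nat.casesOn j 0 fun i => b i * g i
  map_add' _ _ := by ext j; cases j <;> simp [mul_add]
  map_smul' _ _ := by ext j; cases j <;> simp; ring

@[simp] theorem weightedLower_apply (a g : ℕ → k) (j : ℕ) :
    weightedLower a g j = a j * g (j + 1) := rfl
@[simp] theorem weightedRaise_zero (b g : ℕ → k) : weightedRaise b g 0 = 0 := rfl
@[simp] theorem weightedRaise_succ (b g : ℕ → k) (j : ℕ) :
    weightedRaise b g (j + 1) = b j * g j := rfl

/-- The Verma representation, with weights distributed among the two generators. -/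
def verma (a b : ℕ → k) (h : ∀ j, a j * b j = vermaWeight α β j) :
    DownUp α β →ₐ[k] Module.End k (ℕ → k) :=
  lift α β (weightedLower a) (weightedRaise b)
    (by
      ext g j
      rcases j with _ | j
      -- In coordinate 0 the term yx² vanishes, so the recursion is replaced by its initial
      -- condition λ₁ = α λ₀ for the Verma weights λ.
      · have h1 := h 1
        have h0 := h 0
        simp only [vermaWeight] at h1 h0
        simp [← mul_assoc]
        linear_combination (a 0 * g 1) * h1 - (α * a 0 * g 1) * h0
      · have h2 := h (j + 2)
        have h1 := h (j + 1)
        have h0 := h j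
        simp only [vermaWeight] at h2
        simp
        rw [← h0, ← h1] at h2
        linear_combination (a (j + 1) * g (j + 2)) * h2)
    (by
      ext g j
      rcases j with _ | _ | j
      · simp
      · have h1 := h 1
        have h0 := h 0
        simp only [vermaWeight] at h1 h0
        simp
        linear_combination (b 0 * g 0) * h1 - (α * b 0 * g 0) * h0
      · have h2 := h (j + 2)
        have h1 := h (j + 1)
        have h0 := h j
        simp only [vermaWeight] at h2
        simp
        rw [← h0, ← h1] at h2
        linear_combination (b (j + 1) * g (j + 1)) * h2)

/-- Let the Verma representation act on the constant sequence 1. Coordinate 0 sees only xyx and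
gives q = 0; coordinate 1 then gives p = 0. All weights are placed on y, so that the factors
contributed by x are 1 and never vanish, even for α = 0. -/
theorem eq_zero_of_smul_yxx_add_smul_xyx {p q : k}
    (h : p • (gen α β 1 * gen α β 0 * gen α β 0) + q • (gen α β 0 * gen α β 1 * gen α β 0) = 0) :
    p = 0 ∧ q = 0 := by
  have h' := congrArg (verma α β 1 (vermaWeight α β) fun j => one_mul _) h
  have e0 := congrFun (LinearMap.congr_fun h' 1) 0
  have e1 := congrFun (LinearMap.congr_fun h' 1) 1
  simp [verma, vermaWeight] at e0 e1
  rw [e0] at e1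
  simpa [e0] using e1

/-- The same argument read in coordinates 1 and 2, now with the weights on x: here the word begins
with y, whose factors must not vanish. -/
theorem eq_zero_of_smul_yyx_add_smul_yxy {p q : k}
    (h : p • (gen α β 1 * gen α β 1 * gen α β 0) + q • (gen α β 1 * gen α β 0 * gen α β 1) = 0) :
    p = 0 ∧ q = 0 := by
  have h' := congrArg (verma α β (vermaWeight α β) 1 fun j => mul_one _) h
  have e0 := congrFun (LinearMap.congr_fun h' 1) 1
  have e1 := congrFun (LinearMap.congr_fun h' 1) 2
  simp [verma, vermaWeight] at e0 e1
  rw [e0] at e1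
  simpa [e0] using e1

end Presentation

end DownUp

namespace DownUp

/-! ### Words and their weights -/

section Words

theorem weight_eq_count (n m : ℕ) (w : List (Fin 2)) :
    weight n m w = n * w.count 0 + m * w.count 1 := by
  induction w with
  | nil => simp [weight]
  | cons a w ih =>
    rw [weight] at ih ⊢
    fin_cases a <;> simp [ih] <;> ring

theorem length_eq_count (w : List (Fin 2)) : w.length = w.count 0 + w.count 1 := by
  induction w with
  | nil => rfl
  | cons a w ih => fin_cases a <;> simp [ih] <;> omega

end Words

section Components

variable {k : Type u} [CommRing k] (α β : k)

theorem monomial_eq_pow {w : List (Fin 2)} (h : w.count 1 = 0) :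
    monomial α β w = gen α β 0 ^ w.count 0 := by
  induction w with
  | nil => simp [monomial]
  | cons a w ih =>
    rw [monomial] at ih ⊢
    fin_cases a
    · simp at h ih ⊢
      rw [ih h, pow_succ']
    · simp at h

theorem gen_zero_mem (n m : ℕ) : gen α β 0 ∈ component α β n m n :=
  Submodule.subset_span ⟨[0], by simp [weight], by simp [monomial]⟩

theorem gen_one_mem (n m : ℕ) : gen α β 1 ∈ component α β n m m :=
  Submodule.subset_span ⟨[1], by simp [weight], by simp [monomial]⟩

theorem charX_monomial_eq {w : List (Fin 2)} (h : w.count 1 = 0) :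
    charX α β (monomial α β w) = 1 := by
  rw [monomial_eq_pow α β h, map_pow, charX_zero, one_pow]

variable {n m : ℕ}

/-- Below the weight of `y`, components are spanned by powers of `x`, and are detected by the
character `charX`. -/
theorem exists_charX_smul (hn : 0 < n) {d : ℕ} (hd : d < m) :
    ∃ u ∈ component α β n m d, ∀ a ∈ component α β n m d, a = charX α β a • u := by
  have hc : ∀ w : List (Fin 2), weight n m w = d → w.count 1 = 0 ∧ n * w.count 0 = d := by
    intro w hw
    rw [weight_eq_count] at hw
    have : w.count 1 = 0 := by
      by_contra h
      have := Nat.le_mul_of_pos_right m (Nat.pos_of_ne_zero h)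
      omega
    rw [this] at hw
    exact ⟨this, by omega⟩
  by_cases h : ∃ w, weight n m w = d
  · obtain ⟨w, hw⟩ := h
    refine ⟨monomial α β w, Submodule.subset_span ⟨w, hw, rfl⟩, fun a ha => ?_⟩
    refine Submodule.span_induction ?_ (by simp) ?_ ?_ ha
    · rintro _ ⟨v, hv, rfl⟩
      have h1 := hc v hv
      have h2 := hc w hw
      rw [charX_monomial_eq α β h1.1, one_smul, monomial_eq_pow α β h1.1,
        monomial_eq_pow α β h2.1, Nat.eq_of_mul_eq_mul_left hn (h1.2.trans h2.2.symm)]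
    · intro a b _ _ h1 h2
      rw [map_add, add_smul, ← h1, ← h2]
    · intro c a _ h1
      rw [map_smul, smul_assoc, ← h1]
  · refine ⟨0, Submodule.zero_mem _, fun a ha => ?_⟩
    rw [smul_zero]
    have : component α β n m d = ⊥ := by
      rw [component, Submodule.span_eq_bot]
      rintro _ ⟨v, hv, _⟩
      exact absurd ⟨v, hv⟩ h
    rwa [this, Submodule.mem_bot] at ha

/-- A homogeneous component all of whose words equal a given one. -/
theorem eq_smul_monomial {d : ℕ} {w : List (Fin 2)} (hw : ∀ v, weight n m v = d → v = w)
    (ε : DownUp α β →ₐ[k] k) (hε : ε (monomial α β w) = 1) :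
    ∀ a ∈ component α β n m d, a = ε a • monomial α β w := by
  intro a ha
  refine Submodule.span_induction ?_ (by simp) ?_ ?_ ha
  · rintro _ ⟨v, hv, rfl⟩
    rw [hw v hv, hε, one_smul]
  · intro a b _ _ h1 h2
    rw [map_add, add_smul, ← h1, ← h2]
  · intro c a _ h1
    rw [map_smul, smul_assoc, ← h1]

theorem eq_nil_of_weight (hn : 0 < n) (hm : 0 < m) {v : List (Fin 2)} (h : weight n m v = 0) :
    v = [] := by
  rw [weight_eq_count] at h
  have h0 : v.count 0 = 0 := by
    have : n * v.count 0 = 0 := by omega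
    simpa [hn.ne'] using this
  have h1 : v.count 1 = 0 := by
    have : m * v.count 1 = 0 := by omega
    simpa [hm.ne'] using this
  rw [← List.length_eq_zero_iff, length_eq_count, h0, h1]

theorem eq_singleton_of_count_zero {v : List (Fin 2)} (h0 : v.count 0 = 1)
    (h1 : v.count 1 = 0) : v = [0] := by
  have hl : v.length = 1 := by rw [length_eq_count]; omega
  obtain ⟨c, rfl⟩ := List.length_eq_one_iff.1 hl
  fin_cases c <;> simp_all

theorem eq_singleton_of_count_one {v : List (Fin 2)} (h0 : v.count 0 = 0)
    (h1 : v.count 1 = 1) : v = [1] := by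
  have hl : v.length = 1 := by rw [length_eq_count]; omega
  obtain ⟨c, rfl⟩ := List.length_eq_one_iff.1 hl
  fin_cases c <;> simp_all

theorem eq_smul_one (hn : 0 < n) (hm : 0 < m) (ε : DownUp α β →ₐ[k] k) :
    ∀ a ∈ component α β n m 0, a = ε a • (1 : DownUp α β) :=
  eq_smul_monomial α β (w := []) (fun _ h => eq_nil_of_weight hn hm h) ε
    (by simp [monomial])

theorem eq_smul_gen_zero (hn : 0 < n) (hnm : n < m) :
    ∀ a ∈ component α β n m n, a = charX α β a • gen α β 0 := by
  have := eq_smul_monomial α β (n := n) (m := m) (d := n) (w := [0]) (fun v h => ?_) (charX α β)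
    (by simp [monomial])
  · simpa [monomial] using this
  · rw [weight_eq_count] at h
    have h1 : v.count 1 = 0 := by
      by_contra h1
      have := Nat.le_mul_of_pos_right m (Nat.pos_of_ne_zero h1)
      omega
    have h0 : v.count 0 = 1 := by
      rw [h1] at h
      exact Nat.eq_of_mul_eq_mul_left hn (by omega)
    exact eq_singleton_of_count_zero h0 h1

/-- A word of weight m other than y would be a power of x, which would force n ∣ m; this is
impossible for coprime n and m with n > 1. -/
theorem eq_smul_gen_one (hn : 1 < n) (hnm : n < m) (hg : n.Coprime m) :
    ∀ a ∈ component α β n m m, a = charY α β a • gen α β 1 := by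
  have := eq_smul_monomial α β (n := n) (m := m) (d := m) (w := [1]) (fun v h => ?_) (charY α β)
    (by simp [monomial])
  · simpa [monomial] using this
  · rw [weight_eq_count] at h
    have hnd : ¬ n ∣ m := fun hd => by
      have := Nat.dvd_gcd dvd_rfl hd
      rw [Nat.Coprime] at hg
      rw [hg, Nat.dvd_one] at this
      omega
    have h1 : v.count 1 = 1 := by
      rcases Nat.lt_trichotomy (v.count 1) 1 with h1 | h1 | h1
      · rw [Nat.lt_one_iff.1 h1] at h
        exact absurd ⟨_, by simpa using h.symm⟩ hnd
      · exact h1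
      · have := Nat.mul_le_mul_left m h1
        omega
    have h0 : v.count 0 = 0 := by
      rw [h1] at h
      have : n * v.count 0 = 0 := by omega
      have hn' : n ≠ 0 := by omega
      simpa [hn'] using this
    exact eq_singleton_of_count_one h0 h1

/-- Below the weight of `x`, only the component of weight `0` is nonzero. -/
theorem exists_char_smul (ε : DownUp α β →ₐ[k] k) (hnm : n < m) {d : ℕ} (hd : d < n) :
    ∃ u ∈ component α β n m d, ∀ a ∈ component α β n m d, a = ε a • u := by
  rcases Nat.eq_zero_or_pos d with rfl | h0
  · exact ⟨1, SetLike.GradedOne.one_mem, eq_smul_one α β hd (hd.trans hnm) ε⟩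
  · refine ⟨0, Submodule.zero_mem _, fun a ha => ?_⟩
    have : component α β n m d = ⊥ := by
      rw [component, Submodule.span_eq_bot]
      rintro _ ⟨v, hv, _⟩
      exfalso
      change weight n m v = d at hv
      rw [weight_eq_count] at hv
      have a0 : v.count 0 = 0 := by
        by_contra h1
        have := Nat.le_mul_of_pos_right n (Nat.pos_of_ne_zero h1)
        omega
      have a1 : v.count 1 = 0 := by
        by_contra h1
        have := Nat.le_mul_of_pos_right m (Nat.pos_of_ne_zero h1)
        omega
      rw [a0, a1] at hv
      omega
    rw [this, Submodule.mem_bot] at ha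
    rw [ha, smul_zero]

/-- Modulo n the number of letters y is 1 by coprimality. If it were not 1, it would be at least n +
1, and the excess weight nm would be larger than the available 2n. -/
theorem count_of_weight_xxy (hn : 1 < n) (hnm : n < m) (hg : n.Coprime m) {v : List (Fin 2)}
    (h : weight n m v = 2 * n + m) : v.count 0 = 2 ∧ v.count 1 = 1 := by
  rw [weight_eq_count] at h
  have h1 : v.count 1 = 1 := by
    obtain ⟨q, hq⟩ : ∃ q, v.count 1 = q := ⟨_, rfl⟩
    rw [hq] at h ⊢
    rcases q with _ | q
    · have : n ∣ 2 * n + m := ⟨v.count 0, by rw [← h, mul_zero, add_zero]⟩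
      have := (Nat.dvd_add_right (Dvd.intro_left 2 rfl)).1 this
      have := Nat.eq_one_of_dvd_coprimes hg dvd_rfl this
      omega
    · have e : n * v.count 0 + m * q = 2 * n := by
        rw [mul_add] at h
        omega
      have : n ∣ m * q := (Nat.dvd_add_right (dvd_mul_right n (v.count 0))).1
        (e ▸ Dvd.intro_left 2 rfl)
      obtain ⟨c, rfl⟩ := hg.dvd_of_dvd_mul_left this
      rcases c with _ | c
      · simp
      · exfalso
        have : m * 2 ≤ m * (n * (c + 1)) :=
          Nat.mul_le_mul_left _ (by nlinarith)
        omega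
  refine ⟨?_, h1⟩
  rw [h1] at h
  exact Nat.eq_of_mul_eq_mul_left (by omega : 0 < n) (by omega)

/-- Modulo n the number of letters y is 2. It can be 0 only if n ∣ 2, which produces the word
x^{m+1} for n = 2. It cannot be 1, and since n < m it cannot exceed 2. -/
theorem count_of_weight_xyy (hn : 1 < n) (hnm : n < m) (hg : n.Coprime m) {v : List (Fin 2)}
    (h : weight n m v = n + 2 * m) : (v.count 0 = 1 ∧ v.count 1 = 2) ∨
      (n = 2 ∧ v.count 0 = m + 1 ∧ v.count 1 = 0) := by
  rw [weight_eq_count] at h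
  obtain ⟨q, hq⟩ : ∃ q, v.count 1 = q := ⟨_, rfl⟩
  rw [hq] at h ⊢
  rcases q with _ | _ | q
  · right
    have : n ∣ n + 2 * m := ⟨v.count 0, by rw [← h, mul_zero, add_zero]⟩
    have := (Nat.dvd_add_right dvd_rfl).1 this
    have := hg.dvd_of_dvd_mul_right this
    have h2 : n = 2 := by
      have := Nat.le_of_dvd (by omega) this
      omega
    subst h2
    exact ⟨rfl, by omega, rfl⟩
  · exfalso
    have e : n * v.count 0 = n + m := by omega
    have : n ∣ n + m := ⟨_, e.symm⟩
    have := (Nat.dvd_add_right dvd_rfl).1 this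
    have := Nat.eq_one_of_dvd_coprimes hg dvd_rfl this
    omega
  · left
    have e : n * v.count 0 + m * q = n := by
      rw [add_assoc, mul_add] at h
      omega
    have hq0 : q = 0 := by
      by_contra h1
      have := Nat.le_mul_of_pos_right m (Nat.pos_of_ne_zero h1)
      omega
    subst hq0
    exact ⟨Nat.eq_of_mul_eq_mul_left (by omega : 0 < n) (by omega), rfl⟩

theorem component_xxy (hn : 1 < n) (hnm : n < m) (hg : n.Coprime m) :
    component α β n m (2 * n + m) = Submodule.span k (Set.range
      ![gen α β 1 * gen α β 0 * gen α β 0, gen α β 0 * gen α β 1 * gen α β 0]) := by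
  apply le_antisymm
  · rw [component, Submodule.span_le]
    rintro _ ⟨v, hv, rfl⟩
    obtain ⟨h0, h1⟩ := count_of_weight_xxy hn hnm hg hv
    have hl : v.length = 3 := by rw [length_eq_count, h0, h1]
    have s0 : gen α β 1 * gen α β 0 * gen α β 0 ∈ Submodule.span k (Set.range
      ![gen α β 1 * gen α β 0 * gen α β 0, gen α β 0 * gen α β 1 * gen α β 0]) :=
      Submodule.subset_span ⟨0, rfl⟩
    have s1 : gen α β 0 * gen α β 1 * gen α β 0 ∈ Submodule.span k (Set.range
      ![gen α β 1 * gen α β 0 * gen α β 0, gen α β 0 * gen α β 1 * gen α β 0]) :=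
      Submodule.subset_span ⟨1, rfl⟩
    obtain ⟨a, b, c, rfl⟩ := List.length_eq_three.1 hl
    fin_cases a <;> fin_cases b <;> fin_cases c <;> simp at h0 h1 <;>
      simp only [monomial, List.map_cons, List.map_nil, List.prod_cons, List.prod_nil, mul_one,
        ← mul_assoc, Fin.zero_eta, Fin.mk_one, SetLike.mem_coe]
    · rw [gen_xxy]
      exact Submodule.add_mem _ (Submodule.smul_mem _ _ s0) (Submodule.smul_mem _ _ s1)
    · exact s1
    · exact s0
  · rw [Submodule.span_le]
    rintro _ ⟨i, rfl⟩
    fin_cases i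
    · exact Submodule.subset_span ⟨[1, 0, 0], by simp [weight]; ring, by simp [monomial, mul_assoc]⟩
    · exact Submodule.subset_span ⟨[0, 1, 0], by simp [weight]; ring, by simp [monomial, mul_assoc]⟩

theorem component_xyy_of_ne_two (hn : 1 < n) (hnm : n < m) (hg : n.Coprime m) (h2 : n ≠ 2) :
    component α β n m (n + 2 * m) = Submodule.span k (Set.range
      ![gen α β 1 * gen α β 1 * gen α β 0, gen α β 1 * gen α β 0 * gen α β 1]) := by
  apply le_antisymm
  · rw [component, Submodule.span_le]
    rintro _ ⟨v, hv, rfl⟩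
    obtain ⟨h0, h1⟩ | ⟨h, _⟩ := count_of_weight_xyy hn hnm hg hv
    swap
    · exact absurd h h2
    have hl : v.length = 3 := by rw [length_eq_count, h0, h1]
    have s0 : gen α β 1 * gen α β 1 * gen α β 0 ∈ Submodule.span k (Set.range
      ![gen α β 1 * gen α β 1 * gen α β 0, gen α β 1 * gen α β 0 * gen α β 1]) :=
      Submodule.subset_span ⟨0, rfl⟩
    have s1 : gen α β 1 * gen α β 0 * gen α β 1 ∈ Submodule.span k (Set.range
      ![gen α β 1 * gen α β 1 * gen α β 0, gen α β 1 * gen α β 0 * gen α β 1]) :=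
      Submodule.subset_span ⟨1, rfl⟩
    obtain ⟨a, b, c, rfl⟩ := List.length_eq_three.1 hl
    fin_cases a <;> fin_cases b <;> fin_cases c <;> simp at h0 h1 <;>
      simp only [monomial, List.map_cons, List.map_nil, List.prod_cons, List.prod_nil, mul_one,
        ← mul_assoc, Fin.zero_eta, Fin.mk_one, SetLike.mem_coe]
    · rw [gen_xyy]
      exact Submodule.add_mem _ (Submodule.smul_mem _ _ s0) (Submodule.smul_mem _ _ s1)
    · exact s1
    · exact s0
  · rw [Submodule.span_le]
    rintro _ ⟨i, rfl⟩
    fin_cases i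
    · exact Submodule.subset_span ⟨[1, 1, 0], by simp [weight]; ring, by simp [monomial, mul_assoc]⟩
    · exact Submodule.subset_span ⟨[1, 0, 1], by simp [weight]; ring, by simp [monomial, mul_assoc]⟩

/-- This is the origin of the special case n = 2: the power x^{m+1} has the same weight as the
relation xy², so this component has a third spanning element. -/
theorem component_xyy_of_eq_two (hm : 2 < m) (hg : Nat.Coprime 2 m) :
    component α β 2 m (2 + 2 * m) = Submodule.span k (Set.range
      ![gen α β 1 * gen α β 1 * gen α β 0, gen α β 1 * gen α β 0 * gen α β 1,
        gen α β 0 ^ (m + 1)]) := by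
  apply le_antisymm
  · rw [component, Submodule.span_le]
    rintro _ ⟨v, hv, rfl⟩
    have s0 : gen α β 1 * gen α β 1 * gen α β 0 ∈ Submodule.span k (Set.range
      ![gen α β 1 * gen α β 1 * gen α β 0, gen α β 1 * gen α β 0 * gen α β 1,
        gen α β 0 ^ (m + 1)]) :=
      Submodule.subset_span ⟨0, rfl⟩
    have s1 : gen α β 1 * gen α β 0 * gen α β 1 ∈ Submodule.span k (Set.range
      ![gen α β 1 * gen α β 1 * gen α β 0, gen α β 1 * gen α β 0 * gen α β 1,
        gen α β 0 ^ (m + 1)]) :=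
      Submodule.subset_span ⟨1, rfl⟩
    obtain ⟨h0, h1⟩ | ⟨_, h0, h1⟩ := count_of_weight_xyy one_lt_two hm hg hv
    swap
    · rw [monomial_eq_pow α β h1, h0]
      exact Submodule.subset_span ⟨2, rfl⟩
    have hl : v.length = 3 := by rw [length_eq_count, h0, h1]
    obtain ⟨a, b, c, rfl⟩ := List.length_eq_three.1 hl
    fin_cases a <;> fin_cases b <;> fin_cases c <;> simp at h0 h1 <;>
      simp only [monomial, List.map_cons, List.map_nil, List.prod_cons, List.prod_nil, mul_one,
        ← mul_assoc, Fin.zero_eta, Fin.mk_one, SetLike.mem_coe]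
    · rw [gen_xyy]
      exact Submodule.add_mem _ (Submodule.smul_mem _ _ s0) (Submodule.smul_mem _ _ s1)
    · exact s1
    · exact s0
  · rw [Submodule.span_le]
    rintro _ ⟨i, rfl⟩
    fin_cases i
    · exact Submodule.subset_span ⟨[1, 1, 0], by simp [weight]; ring, by simp [monomial, mul_assoc]⟩
    · exact Submodule.subset_span ⟨[1, 0, 1], by simp [weight]; ring, by simp [monomial, mul_assoc]⟩
    · exact Submodule.subset_span ⟨List.replicate (m + 1) 0, by simp [weight]; ring,
        by simp [monomial]⟩

end Components

/-! ### Dimensions of the components in the degrees of the relations -/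

section Dimensions

variable {k : Type u} [Field k] (α β : k) {n m : ℕ}

theorem finrank_component_xxy (hn : 1 < n) (hnm : n < m) (hg : n.Coprime m) :
    Module.finrank k (component α β n m (2 * n + m)) = 2 := by
  rw [component_xxy α β hn hnm hg, finrank_span_eq_card, Fintype.card_fin]
  rw [LinearIndependent.pair_iff]
  intro p q h
  exact eq_zero_of_smul_yxx_add_smul_xyx α β h

theorem finrank_component_xyy_of_ne_two (hn : 1 < n) (hnm : n < m) (hg : n.Coprime m)
    (h2 : n ≠ 2) : Module.finrank k (component α β n m (n + 2 * m)) = 2 := by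
  rw [component_xyy_of_ne_two α β hn hnm hg h2, finrank_span_eq_card, Fintype.card_fin]
  rw [LinearIndependent.pair_iff]
  intro p q h
  exact eq_zero_of_smul_yyx_add_smul_yxy α β h

theorem finrank_component_xyy_of_eq_two (hm : 2 < m) (hg : Nat.Coprime 2 m) :
    Module.finrank k (component α β 2 m (2 + 2 * m)) = 3 := by
  rw [component_xyy_of_eq_two α β hm hg, finrank_span_eq_card, Fintype.card_fin]
  rw [Fintype.linearIndependent_iff]
  intro g h
  simp only [Fin.sum_univ_three, Matrix.cons_val] at h
  -- The character with y ↦ 0 kills the two words containing y and isolates the coefficient of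
  -- x^{m+1}.
  have h2 : g 2 = 0 := by simpa using congrArg (charX α β) h
  rw [h2, zero_smul, add_zero] at h
  obtain ⟨h0, h1⟩ := eq_zero_of_smul_yyx_add_smul_yxy α β h
  intro i
  fin_cases i
  exacts [h0, h1, h2]

end Dimensions

end DownUp

/-! ### Elements of Beilinson algebras -/

namespace beilinsonAlgebra

variable {k A : Type u} [CommRing k] [Ring A] [Algebra k A]
  {𝒜 : ℕ → Submodule k A} [SetLike.GradedMonoid 𝒜] {ℓ : ℕ}

@[ext]
theorem ext {b c : beilinsonAlgebra 𝒜 ℓ} (h : ∀ i j, b.1 i j = c.1 i j) : b = c :=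
  Subtype.ext (Matrix.ext h)

theorem coe_mul_apply (b c : beilinsonAlgebra 𝒜 ℓ) (i j : Fin ℓ) :
    (b * c).1 i j = ∑ r, b.1 i r * c.1 r j := rfl

theorem coe_add_apply (b c : beilinsonAlgebra 𝒜 ℓ) (i j : Fin ℓ) :
    (b + c).1 i j = b.1 i j + c.1 i j := rfl

theorem coe_smul_apply (r : k) (b : beilinsonAlgebra 𝒜 ℓ) (i j : Fin ℓ) :
    (r • b).1 i j = r • b.1 i j := rfl

theorem coe_zero_apply (i j : Fin ℓ) : (0 : beilinsonAlgebra 𝒜 ℓ).1 i j = 0 := rfl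

theorem coe_sum_apply {ι : Type*} (s : Finset ι) (f : ι → beilinsonAlgebra 𝒜 ℓ) (i j : Fin ℓ) :
    (∑ x ∈ s, f x).1 i j = ∑ x ∈ s, (f x).1 i j := by
  induction s using Finset.cons_induction with
  | empty => rfl
  | cons a s ha ih => rw [Finset.sum_cons, Finset.sum_cons, coe_add_apply, ih]

variable (𝒜 ℓ)

/-- The element with entries `a j` at `(j + d, j)`. -/
def band (d : ℕ) (a : ℕ → 𝒜 d) : beilinsonAlgebra 𝒜 ℓ :=
  ⟨Matrix.of fun i j => if (i : ℕ) = j + d then (a j : A) else 0, fun i j => by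
    refine ⟨fun h => ?_, fun h => ?_⟩
    · rw [Matrix.of_apply]
      split_ifs with h'
      · rw [h', Nat.add_sub_cancel_left]
        exact (a j).2
      · exact Submodule.zero_mem _
    · rw [Matrix.of_apply, if_neg]
      have : (i : ℕ) < j := h
      omega⟩

/-- The unit of the component of degree `0`. -/
def unitZero : 𝒜 0 := ⟨1, SetLike.GradedOne.one_mem⟩

/-- The diagonal idempotents, with value `0` for indices out of range. -/
def idem (v : ℕ) : beilinsonAlgebra 𝒜 ℓ := band 𝒜 ℓ 0 (Pi.single v (unitZero 𝒜))

variable {𝒜 ℓ}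

theorem band_apply (d : ℕ) (a : ℕ → 𝒜 d) (i j : Fin ℓ) :
    (band 𝒜 ℓ d a).1 i j = if (i : ℕ) = j + d then (a j : A) else 0 := rfl

theorem band_mul_apply (d : ℕ) (a : ℕ → 𝒜 d) (b : beilinsonAlgebra 𝒜 ℓ) (i j : Fin ℓ) :
    (band 𝒜 ℓ d a * b).1 i j =
      if h : d ≤ i then (a (i - d) : A) * b.1 ⟨i - d, by omega⟩ j else 0 := by
  rw [coe_mul_apply]
  split_ifs with h
  · rw [Finset.sum_eq_single ⟨i - d, by omega⟩]
    · rw [band_apply, if_pos (by simp; omega)]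
    · intro r _ hr
      rw [band_apply, if_neg, zero_mul]
      intro h'
      apply hr
      ext
      simp
      omega
    · simp
  · refine Finset.sum_eq_zero fun r _ => ?_
    rw [band_apply, if_neg (by omega), zero_mul]

theorem mul_band_apply (d : ℕ) (a : ℕ → 𝒜 d) (b : beilinsonAlgebra 𝒜 ℓ) (i j : Fin ℓ) :
    (b * band 𝒜 ℓ d a).1 i j =
      if h : j + d < ℓ then b.1 i ⟨j + d, h⟩ * (a j : A) else 0 := by
  rw [coe_mul_apply]
  split_ifs with h
  · rw [Finset.sum_eq_single ⟨j + d, h⟩]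
    · rw [band_apply, if_pos rfl]
    · intro r _ hr
      rw [band_apply, if_neg, mul_zero]
      intro h'
      exact hr (Fin.ext h')
    · simp
  · refine Finset.sum_eq_zero fun r _ => ?_
    rw [band_apply, if_neg (by omega), mul_zero]

theorem idem_mul_apply (v : ℕ) (b : beilinsonAlgebra 𝒜 ℓ) (i j : Fin ℓ) :
    (idem 𝒜 ℓ v * b).1 i j = if (i : ℕ) = v then b.1 i j else 0 := by
  rw [idem, band_mul_apply, dif_pos (Nat.zero_le _)]
  split_ifs with h
  · subst h
    simp [unitZero]
  · simp [Pi.single_eq_of_ne h]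

theorem mul_idem_apply (v : ℕ) (b : beilinsonAlgebra 𝒜 ℓ) (i j : Fin ℓ) :
    (b * idem 𝒜 ℓ v).1 i j = if (j : ℕ) = v then b.1 i j else 0 := by
  rw [idem, mul_band_apply, dif_pos (by simp)]
  split_ifs with h
  · subst h
    simp [unitZero]
  · simp [Pi.single_eq_of_ne h]

theorem idem_of_le {v : ℕ} (h : ℓ ≤ v) : idem 𝒜 ℓ v = 0 := by
  ext i j
  have := mul_idem_apply v (1 : beilinsonAlgebra 𝒜 ℓ) i j
  rw [one_mul] at this
  rw [this, if_neg (by omega)]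
  rfl

theorem sum_idem : ∑ v ∈ Finset.range ℓ, idem 𝒜 ℓ v = 1 := by
  ext i j
  rw [← mul_one (∑ v ∈ Finset.range ℓ, idem 𝒜 ℓ v), Finset.sum_mul, coe_sum_apply]
  simp only [idem_mul_apply]
  rw [Finset.sum_ite_eq, if_pos (by simp)]

theorem idem_mul_idem (v w : ℕ) :
    idem 𝒜 ℓ v * idem 𝒜 ℓ w = if v = w then idem 𝒜 ℓ v else 0 := by
  ext i j
  rw [mul_idem_apply]
  have h1 := mul_idem_apply v (1 : beilinsonAlgebra 𝒜 ℓ) i j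
  rw [one_mul] at h1
  rcases eq_or_ne v w with rfl | h
  · rw [if_pos rfl, h1]
    split_ifs <;> rfl
  · rw [if_neg h, h1]
    split_ifs with h2 h3
    · exact absurd (h3.symm.trans h2) h
    · rfl
    · rfl

theorem band_mul_idem (d : ℕ) (a : ℕ → 𝒜 d) (v : ℕ) :
    band 𝒜 ℓ d a * idem 𝒜 ℓ v = idem 𝒜 ℓ (v + d) * band 𝒜 ℓ d a := by
  ext i j
  rw [mul_idem_apply, idem_mul_apply, band_apply]
  split_ifs <;> first | rfl | omega

theorem idem_mul_band_of_lt (d : ℕ) (a : ℕ → 𝒜 d) {v : ℕ} (h : v < d) :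
    idem 𝒜 ℓ v * band 𝒜 ℓ d a = 0 := by
  ext i j
  rw [idem_mul_apply, band_apply]
  split_ifs <;> first | rfl | omega

theorem band_mul_band_apply (d e : ℕ) (a : ℕ → 𝒜 d) (b : ℕ → 𝒜 e) (i j : Fin ℓ) :
    (band 𝒜 ℓ d a * band 𝒜 ℓ e b).1 i j =
      if (i : ℕ) = j + (d + e) then (a (j + e) : A) * b j else 0 := by
  rw [mul_band_apply]
  split_ifs with h1 h2 h2
  · rw [band_apply, if_pos (by simp; omega)]
  · rw [band_apply, if_neg (by simp; omega), zero_mul]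
  · omega
  · rfl

theorem band_mul_band_mul_band_apply (d e f : ℕ) (a : ℕ → 𝒜 d) (b : ℕ → 𝒜 e) (c : ℕ → 𝒜 f)
    (i j : Fin ℓ) : (band 𝒜 ℓ d a * band 𝒜 ℓ e b * band 𝒜 ℓ f c).1 i j =
      if (i : ℕ) = j + (d + e + f) then (a (j + f + e) : A) * b (j + f) * c j else 0 := by
  rw [mul_band_apply]
  split_ifs with h1 h2 h2
  · rw [band_mul_band_apply, if_pos (by simp; omega)]
  · rw [band_mul_band_apply, if_neg (by simp; omega), zero_mul]
  · omega
  · rfl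

end beilinsonAlgebra

/-! ### The enveloping algebra -/

section Enveloping

open MulOpposite

variable {k : Type u} [CommRing k] {B : Type u} [Ring B] [Algebra k B]

variable (k) in
/-- `b ⊗ 1` in the enveloping algebra. -/
def envLeft : B →ₗ[k] B ⊗[k] Bᵐᵒᵖ := (TensorProduct.mk k B Bᵐᵒᵖ).flip 1

variable (k) in
/-- `1 ⊗ b` in the enveloping algebra. -/
def envRight : B →ₗ[k] B ⊗[k] Bᵐᵒᵖ :=
  (TensorProduct.mk k B Bᵐᵒᵖ 1) ∘ₗ (opLinearEquiv k).toLinearMap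

theorem envLeft_def (b : B) : envLeft k b = b ⊗ₜ[k] (1 : Bᵐᵒᵖ) := rfl
theorem envRight_def (b : B) : envRight k b = (1 : B) ⊗ₜ[k] op b := rfl

theorem envLeft_mul (b c : B) : envLeft k (b * c) = envLeft k b * envLeft k c := by
  simp [envLeft_def]

theorem envRight_mul (b c : B) : envRight k (b * c) = envRight k c * envRight k b := by
  simp [envRight_def]

theorem envLeft_mul_envRight (b c : B) : envLeft k b * envRight k c = b ⊗ₜ[k] op c := by
  simp [envLeft_def, envRight_def]

theorem envRight_mul_envLeft (b c : B) : envRight k c * envLeft k b = b ⊗ₜ[k] op c := by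
  simp [envLeft_def, envRight_def]

theorem envLeft_one : envLeft k (1 : B) = 1 := rfl
theorem envRight_one : envRight k (1 : B) = 1 := rfl

theorem env_commute (b c : B) : envLeft k b * envRight k c = envRight k c * envLeft k b := by
  rw [envLeft_mul_envRight, envRight_mul_envLeft]

theorem tmul_mul_envLeft (b d : B) (c : Bᵐᵒᵖ) :
    (b ⊗ₜ[k] c) * envLeft k d = (b * d) ⊗ₜ[k] c := by
  simp [envLeft_def]

theorem tmul_mul_envRight (b d : B) (c : Bᵐᵒᵖ) :
    (b ⊗ₜ[k] c) * envRight k d = b ⊗ₜ[k] op (d * unop c) := by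
  simp [envRight_def]

end Enveloping

/-! ### Peirce idempotents of the enveloping algebra and elements intertwining them -/

section Peirce

variable {k : Type u} [CommRing k] {B : Type u} [Ring B] [Algebra k B]

/-- A sequence of orthogonal idempotents `e 0, …, e (ℓ - 1)` with sum `1`, extended by zero. -/
structure IsPeirce (e : ℕ → B) (ℓ : ℕ) : Prop where
  mul_eq (v w : ℕ) : e v * e w = if v = w then e v else 0
  eq_zero {v : ℕ} (h : ℓ ≤ v) : e v = 0
  sum_eq : ∑ v ∈ Finset.range ℓ, e v = 1

/-- Elements mapping the Peirce component `v` to `v + d`. -/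
structure IsShift (e : ℕ → B) (d : ℕ) (X : B) : Prop where
  mul_idem (v : ℕ) : X * e v = e (v + d) * X
  idem_mul {v : ℕ} (h : v < d) : e v * X = 0

variable (k) in
/-- The idempotent `∑ e_{v+s} ⊗ e_v` of the enveloping algebra. -/
def envIdem (e : ℕ → B) (ℓ s : ℕ) : B ⊗[k] Bᵐᵒᵖ :=
  ∑ v ∈ Finset.range ℓ, envLeft k (e (v + s)) * envRight k (e v)

variable {e : ℕ → B} {ℓ : ℕ}

theorem envIdem_mul_self (he : IsPeirce e ℓ) (s : ℕ) :
    envIdem k e ℓ s * envIdem k e ℓ s = envIdem k e ℓ s := by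
  rw [envIdem, Finset.sum_mul]
  refine Finset.sum_congr rfl fun v hv => ?_
  rw [Finset.mul_sum, Finset.sum_eq_single v]
  · rw [mul_assoc, ← mul_assoc (envRight k _), ← env_commute, mul_assoc, ← mul_assoc,
      ← envLeft_mul, ← envRight_mul, he.mul_eq, he.mul_eq, if_pos rfl, if_pos rfl]
  · intro w _ hw
    rw [mul_assoc, ← mul_assoc (envRight k _), ← env_commute, mul_assoc, ← mul_assoc,
      ← envLeft_mul, ← envRight_mul, he.mul_eq, he.mul_eq, if_neg hw, map_zero, mul_zero]
  · intro h
    exact absurd hv h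

/-- Elements `z` of the enveloping algebra intertwining two of the idempotents `envIdem`. -/
def Intertwines (e : ℕ → B) (ℓ d s : ℕ) (z : B ⊗[k] Bᵐᵒᵖ) : Prop :=
  envIdem k e ℓ d * z = z * envIdem k e ℓ s

namespace Intertwines

variable {d s t : ℕ} {z w : B ⊗[k] Bᵐᵒᵖ}

theorem add (hz : Intertwines e ℓ d s z) (hw : Intertwines e ℓ d s w) :
    Intertwines e ℓ d s (z + w) := by
  rw [Intertwines, mul_add, add_mul, hz, hw]

theorem sub (hz : Intertwines e ℓ d s z) (hw : Intertwines e ℓ d s w) :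
    Intertwines e ℓ d s (z - w) := by
  rw [Intertwines, mul_sub, sub_mul, hz, hw]

theorem smul (c : k) (hz : Intertwines e ℓ d s z) : Intertwines e ℓ d s (c • z) := by
  rw [Intertwines, mul_smul_comm, smul_mul_assoc, hz]

theorem mul (hz : Intertwines e ℓ d s z) (hw : Intertwines e ℓ s t w) :
    Intertwines e ℓ d t (z * w) := by
  rw [Intertwines, ← mul_assoc, hz, mul_assoc, hw, mul_assoc]

theorem left {X : B} {c : ℕ} (hX : IsShift e c X) (h : d = s + c) :
    Intertwines e ℓ d s (envLeft k X) := by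
  subst h
  rw [Intertwines, envIdem, envIdem, Finset.sum_mul, Finset.mul_sum]
  refine Finset.sum_congr rfl fun v _ => ?_
  rw [mul_assoc, ← env_commute, ← mul_assoc, ← mul_assoc, ← envLeft_mul, ← envLeft_mul,
    hX.mul_idem, add_assoc]

theorem right (he : IsPeirce e ℓ) {X : B} {c : ℕ} (hX : IsShift e c X) (h : d = s + c) :
    Intertwines e ℓ d s (envRight k X) := by
  subst h
  rw [Intertwines, envIdem, envIdem, Finset.sum_mul, Finset.mul_sum]
  let F : ℕ → B ⊗[k] Bᵐᵒᵖ := fun w =>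
    envRight k X * (envLeft k (e (w + s)) * envRight k (e w))
  have hF : ∀ w, F w = envLeft k (e (w + s)) * envRight k (e w * X) := fun w => by
    simp only [F]
    rw [← mul_assoc, ← env_commute, mul_assoc, ← envRight_mul]
  -- Moving X past e_v replaces e_v by e_{v+c}, so the summation index moves by c. The c terms lost
  -- at the bottom vanish because e_w X = 0 for w < c, and the c terms gained at the top because e_w
  -- = 0 for w ≥ ℓ.
  have h1 : ∑ w ∈ Finset.range (c + ℓ), F w = ∑ v ∈ Finset.range ℓ, F (c + v) := by
    rw [Finset.sum_range_add, Finset.sum_eq_zero, zero_add]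
    intro w hw
    rw [hF, hX.idem_mul (Finset.mem_range.1 hw), map_zero, mul_zero]
  have h2 : ∑ w ∈ Finset.range (c + ℓ), F w = ∑ v ∈ Finset.range ℓ, F v := by
    rw [add_comm, Finset.sum_range_add, add_eq_left]
    refine Finset.sum_eq_zero fun w _ => ?_
    rw [hF, he.eq_zero (Nat.le_add_right ℓ w), zero_mul, map_zero, mul_zero]
  change _ = ∑ v ∈ Finset.range ℓ, F v
  rw [← h2, h1]
  refine Finset.sum_congr rfl fun v _ => ?_
  rw [hF, mul_assoc, ← envRight_mul, hX.mul_idem, add_comm c v, add_assoc, add_comm s c]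

end Intertwines

end Peirce

/-! ### The bimodule complex of the down-up relations -/

section Fox

variable {k E : Type u} [CommRing k] [Ring E] [Algebra k E] (α β : k) (lX lY rX rY : E)

/-- The coefficient of `dx` in the derivative of `x²y - β yx² - α xyx`, in terms of left and
right multiplications by `x` and `y`. -/
def foxXXYx : E :=
  rY * rX + lX * rY - β • (lY * rX + lY * lX) - α • (rX * rY + lX * lY)

/-- The coefficient of `dy` in the derivative of `x²y - β yx² - α xyx`. -/
def foxXXYy : E := lX * lX - β • (rX * rX) - α • (lX * rX)

/-- The coefficient of `dx` in the derivative of `xy² - β y²x - α yxy`. -/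
def foxXYYx : E := rY * rY - β • (lY * lY) - α • (lY * rY)

/-- The coefficient of `dy` in the derivative of `xy² - β y²x - α yxy`. -/
def foxXYYy : E :=
  lX * rY + lX * lY - β • (rX * rY + lY * rX) - α • (rY * rX + lY * lX)

variable {α β lX lY rX rY}

/-- Fundamental identity of Fox calculus: the partial derivatives multiplied by the differences l -
r telescope to the relation in left multiplications minus the relation in right multiplications, and
both vanish. Products of right multiplications occur in reversed order. This makes the composite of
the two differentials zero on the generator of the relation x²y. -/
theorem fox_xxy_eq_zero (hxx : rX * lX = lX * rX)
    (hxy : rX * lY = lY * rX) (hyx : rY * lX = lX * rY)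
    (hl : lX * lX * lY = β • (lY * lX * lX) + α • (lX * lY * lX))
    (hr : rY * rX * rX = β • (rX * rX * rY) + α • (rX * rY * rX)) :
    foxXXYx α β lX lY rX rY * (lX - rX) + foxXXYy α β lX rX * (lY - rY) = 0 := by
  have hxx' : ∀ z, rX * (lX * z) = lX * (rX * z) := fun z => by
    rw [← mul_assoc, hxx, mul_assoc]
  have hxy' : ∀ z, rX * (lY * z) = lY * (rX * z) := fun z => by
    rw [← mul_assoc, hxy, mul_assoc]
  have hyx' : ∀ z, rY * (lX * z) = lX * (rY * z) := fun z => by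
    rw [← mul_assoc, hyx, mul_assoc]
  simp only [mul_assoc] at hl hr
  simp only [foxXXYx, foxXXYy, mul_sub, sub_mul, add_mul, smul_mul_assoc, mul_assoc,
    hxx, hxy, hyx, hxx', hyx', hxy', smul_add, hl, hr]
  abel

theorem fox_xyy_eq_zero (hyy : rY * lY = lY * rY)
    (hxy : rX * lY = lY * rX) (hyx : rY * lX = lX * rY)
    (hl : lX * lY * lY = β • (lY * lY * lX) + α • (lY * lX * lY))
    (hr : rY * rY * rX = β • (rX * rY * rY) + α • (rY * rX * rY)) :
    foxXYYx α β lY rY * (lX - rX) + foxXYYy α β lX lY rX rY * (lY - rY) = 0 := by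
  have hyy' : ∀ z, rY * (lY * z) = lY * (rY * z) := fun z => by
    rw [← mul_assoc, hyy, mul_assoc]
  have hxy' : ∀ z, rX * (lY * z) = lY * (rX * z) := fun z => by
    rw [← mul_assoc, hxy, mul_assoc]
  have hyx' : ∀ z, rY * (lX * z) = lX * (rY * z) := fun z => by
    rw [← mul_assoc, hyx, mul_assoc]
  simp only [mul_assoc] at hl hr
  simp only [foxXYYx, foxXYYy, mul_sub, sub_mul, add_mul, smul_mul_assoc, mul_assoc,
    hyy, hxy, hyx, hyx', hxy', hyy', smul_add, hl, hr]
  abel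

end Fox

/-! ### Derivations of the down-up algebra -/

section Derivation

open MulOpposite

variable {k : Type u} [CommRing k] {B : Type u} [Ring B] [Algebra k B]

/-- Derivations of the down-up algebra, along a homomorphism `φ` to `B` and with values in a
`B`-bimodule, exist for all values on the generators that satisfy the derived relations. -/
theorem DownUp.exists_derivation {α β : k} (φ : DownUp α β →ₐ[k] B) {C : Type u} [AddCommGroup C]
    [Module (B ⊗[k] Bᵐᵒᵖ) C] [Module k C] [IsScalarTower k (B ⊗[k] Bᵐᵒᵖ) C] (dx dy : C)
    (h₁ : foxXXYx α β (envLeft k (φ (gen α β 0))) (envLeft k (φ (gen α β 1)))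
        (envRight k (φ (gen α β 0))) (envRight k (φ (gen α β 1))) • dx +
      foxXXYy α β (envLeft k (φ (gen α β 0))) (envRight k (φ (gen α β 0))) • dy = 0)
    (h₂ : foxXYYx α β (envLeft k (φ (gen α β 1))) (envRight k (φ (gen α β 1))) • dx +
      foxXYYy α β (envLeft k (φ (gen α β 0))) (envLeft k (φ (gen α β 1)))
        (envRight k (φ (gen α β 0))) (envRight k (φ (gen α β 1))) • dy = 0) :
    ∃ δ : DownUp α β →ₗ[k] C, δ (gen α β 0) = dx ∧ δ (gen α β 1) = dy ∧
      ∀ a b, δ (a * b) = envLeft k (φ a) • δ b + envRight k (φ b) • δ a := by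
  let : Module B C := Module.compHom C
    (Algebra.TensorProduct.includeLeftRingHom : B →+* B ⊗[k] Bᵐᵒᵖ)
  let : Module Bᵐᵒᵖ C := Module.compHom C
    (Algebra.TensorProduct.includeRight : Bᵐᵒᵖ →ₐ[k] B ⊗[k] Bᵐᵒᵖ).toRingHom
  have hl : ∀ (b : B) (c : C), b • c = envLeft k b • c := fun _ _ => rfl
  have hr : ∀ (b : B) (c : C), op b • c = envRight k b • c := fun _ _ => rfl
  have : SMulCommClass B Bᵐᵒᵖ C := ⟨fun a b c => by
    obtain ⟨b, rfl⟩ := op_surjective b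
    rw [hl, hr, hl, hr, smul_smul, smul_smul, env_commute]⟩
  have : IsScalarTower k B C := ⟨fun r b c => by rw [hl, hl, map_smul, smul_assoc]⟩
  have : IsScalarTower k Bᵐᵒᵖ C := ⟨fun r b c => by
    obtain ⟨b, rfl⟩ := op_surjective b
    rw [← op_smul, hr, hr, map_smul, smul_assoc]⟩
  have hswap : ∀ (b c : B) (z : C),
      envLeft k b • envRight k c • z = envRight k c • envLeft k b • z := fun b c z => by
    rw [smul_smul, smul_smul, env_commute]
  have e₁ := φ.congr_arg (gen_xxy α β)
  have e₂ := φ.congr_arg (gen_xyy α β)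
  simp only [map_mul, map_add, map_smul] at e₁ e₂
  -- Derivations along φ are the lifts of φ to the square-zero extension of B by C. The universal
  -- property reduces such a lift to the two relations, whose second components are exactly the two
  -- hypotheses in Fox derivatives.
  let ψ : DownUp α β →ₐ[k] TrivSqZeroExt B C := lift α β
    (TrivSqZeroExt.inl (φ (gen α β 0)) + TrivSqZeroExt.inr dx)
    (TrivSqZeroExt.inl (φ (gen α β 1)) + TrivSqZeroExt.inr dy)
    (by
      refine TrivSqZeroExt.ext (by simpa using e₁) ?_
      rw [← sub_eq_zero, ← h₁]
      simp [foxXXYx, foxXXYy, hl, hr, add_smul, sub_smul, mul_smul, envLeft_mul,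
        hswap]
      abel)
    (by
      refine TrivSqZeroExt.ext (by simpa using e₂) ?_
      rw [← sub_eq_zero, ← h₂]
      simp [foxXYYx, foxXYYy, hl, hr, add_smul, sub_smul, mul_smul, envLeft_mul,
        hswap]
      abel)
  have hfst : ∀ a, (ψ a).fst = φ a := by
    intro a
    induction a using DownUp.induction with
    | hs c => rw [AlgHom.commutes, AlgHom.commutes]; rfl
    | hx => simp [ψ]
    | hy => simp [ψ]
    | hadd a b ha hb => rw [map_add, map_add, TrivSqZeroExt.fst_add, ha, hb]
    | hmul a b ha hb => rw [map_mul, map_mul, TrivSqZeroExt.fst_mul, ha, hb]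
  refine ⟨(TrivSqZeroExt.sndHom B C).restrictScalars k ∘ₗ ψ.toLinearMap, by simp [ψ], by simp [ψ],
    fun a b => ?_⟩
  simp [hfst, hl, hr]

end Derivation

/-! ### Exactness of the bimodule complex -/

section Exactness

open MulOpposite

variable {k : Type u} [CommRing k] {B : Type u} [Ring B] [Algebra k B]

variable (k B) in
/-- The multiplication map of the enveloping algebra. -/
def envMul : B ⊗[k] Bᵐᵒᵖ →ₗ[k] B :=
  LinearMap.mul' k B ∘ₗ TensorProduct.map LinearMap.id (opLinearEquiv k).symm.toLinearMap

@[simp]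
theorem envMul_tmul (b : B) (c : Bᵐᵒᵖ) : envMul k B (b ⊗ₜ c) = b * unop c := rfl

variable {e : ℕ → B} {ℓ n m : ℕ} {X Y : B}

/-- On f_0 = ∑ e_w ⊗ e_w left and right multiplication by e_v agree, so idempotents contribute no
differentials and arrows alone generate the kernel of multiplication. -/
theorem env_sub_mul_envIdem (he : IsPeirce e ℓ) (v : ℕ) :
    (envLeft k (e v) - envRight k (e v)) * envIdem k e ℓ 0 = 0 := by
  have h : ∀ w, envLeft k (e v) * (envLeft k (e (w + 0)) * envRight k (e w)) =
      envRight k (e v) * (envLeft k (e (w + 0)) * envRight k (e w)) := by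
    intro w
    rw [add_zero, ← mul_assoc, ← envLeft_mul, ← mul_assoc, ← env_commute, mul_assoc,
      ← envRight_mul, he.mul_eq, he.mul_eq]
    by_cases h : v = w
    · subst h; simp
    · rw [if_neg h, if_neg (Ne.symm h), map_zero, map_zero, zero_mul, mul_zero]
  rw [sub_mul, sub_eq_zero, envIdem, Finset.mul_sum, Finset.mul_sum]
  exact Finset.sum_congr rfl fun w _ => h w

/-- Exactness of the bimodule complex at the term in degree zero. -/
theorem env_exact_zero (he : IsPeirce e ℓ) (hX : IsShift e n X) (hY : IsShift e m Y)
    (hgen : ∀ S : Subalgebra k B, X ∈ S → Y ∈ S → (∀ v, e v ∈ S) → S = ⊤)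
    (t : B ⊗[k] Bᵐᵒᵖ) (ht : t * envIdem k e ℓ 0 = t) (h0 : envMul k B t = 0) :
    ∃ a b : B ⊗[k] Bᵐᵒᵖ, t = a * envIdem k e ℓ n * (envLeft k X - envRight k X) +
      b * envIdem k e ℓ m * (envLeft k Y - envRight k Y) := by
  let J : Submodule (B ⊗[k] Bᵐᵒᵖ) (B ⊗[k] Bᵐᵒᵖ) := Submodule.span _
    {envIdem k e ℓ n * (envLeft k X - envRight k X), envIdem k e ℓ m * (envLeft k Y - envRight k Y)}
  have hJl : ∀ a b, b ∈ J → a * b ∈ J := fun a b hb => J.smul_mem a hb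
  have hwX : Intertwines e ℓ n 0 (envLeft k X - envRight k X) :=
    (Intertwines.left hX (zero_add n).symm).sub (Intertwines.right he hX (zero_add n).symm)
  have hwY : Intertwines e ℓ m 0 (envLeft k Y - envRight k Y) :=
    (Intertwines.left hY (zero_add m).symm).sub (Intertwines.right he hY (zero_add m).symm)
  -- The elements whose universal differential lies in J form a subalgebra by the Leibniz rule. It
  -- contains arrows and idempotents, hence everything.
  let S : Subalgebra k B :=
    { carrier := {b | (envLeft k b - envRight k b) * envIdem k e ℓ 0 ∈ J}
      mul_mem' := by
        intro b c hb hc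
        have : (envLeft k (b * c) - envRight k (b * c)) * envIdem k e ℓ 0 =
            envLeft k b * ((envLeft k c - envRight k c) * envIdem k e ℓ 0) +
            envRight k c * ((envLeft k b - envRight k b) * envIdem k e ℓ 0) := by
          rw [envLeft_mul, envRight_mul, ← mul_assoc, ← mul_assoc, ← add_mul, mul_sub, mul_sub,
            env_commute b c, sub_add_sub_cancel]
        rw [Set.mem_ofPred_eq, this]
        exact J.add_mem (hJl _ _ hc) (hJl _ _ hb)
      add_mem' := by
        intro b c hb hc
        have : (envLeft k (b + c) - envRight k (b + c)) * envIdem k e ℓ 0 =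
            (envLeft k b - envRight k b) * envIdem k e ℓ 0 +
            (envLeft k c - envRight k c) * envIdem k e ℓ 0 := by
          rw [← add_mul, map_add, map_add, add_sub_add_comm]
        rw [Set.mem_ofPred_eq, this]
        exact J.add_mem hb hc
      algebraMap_mem' := by
        intro r
        rw [Set.mem_ofPred_eq, Algebra.algebraMap_eq_smul_one, map_smul, map_smul, envLeft_one,
          envRight_one, sub_self, zero_mul]
        exact J.zero_mem }
  have hS : S = ⊤ := by
    apply hgen
    · change _ * _ ∈ J
      rw [← hwX]
      exact Submodule.subset_span (Or.inl rfl)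
    · change _ * _ ∈ J
      rw [← hwY]
      exact Submodule.subset_span (Or.inr rfl)
    · intro v
      change _ * _ ∈ J
      rw [env_sub_mul_envIdem he]
      exact J.zero_mem
  have key : ∀ b, (envLeft k b - envRight k b) * envIdem k e ℓ 0 ∈ J := fun b => by
    have : b ∈ S := hS ▸ Algebra.mem_top
    exact this
  -- Modulo J the left tensor factor can be moved to the right, so s f_0 depends only on the product
  -- of s; applied to t, whose product is zero, this puts t in J.
  have hmod : ∀ s : B ⊗[k] Bᵐᵒᵖ,
      s * envIdem k e ℓ 0 - envRight k (envMul k B s) * envIdem k e ℓ 0 ∈ J := by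
    intro s
    induction s using TensorProduct.induction_on with
    | zero => simp
    | tmul b c =>
      obtain ⟨c, rfl⟩ := op_surjective c
      have := hJl (envRight k c) _ (key b)
      rwa [← mul_assoc, mul_sub, envRight_mul_envLeft, ← envRight_mul, sub_mul] at this
    | add s s' h h' =>
      have := J.add_mem h h'
      rwa [← add_sub_add_comm, ← add_mul, ← add_mul, ← map_add, ← map_add] at this
  have hmem := hmod t
  rw [h0, map_zero, zero_mul, sub_zero, ht] at hmem
  obtain ⟨a, b, h⟩ := Submodule.mem_span_pair.1 hmem
  exact ⟨a, b, by rw [← h, smul_eq_mul, smul_eq_mul, mul_assoc, mul_assoc]⟩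

/-- A map on `B` inducing a map on the enveloping algebra that is compatible with right
multiplication by `X ⊗ 1 - 1 ⊗ X`, for every `X` with a Leibniz rule. -/
theorem exists_env_lift {C : Type u} [AddCommGroup C] [Module (B ⊗[k] Bᵐᵒᵖ) C] [Module k C]
    [IsScalarTower k (B ⊗[k] Bᵐᵒᵖ) C] (D : B →ₗ[k] C) :
    ∃ F : B ⊗[k] Bᵐᵒᵖ →ₗ[k] C, ∀ (X : B) (dx : C),
      (∀ b, D (b * X) = envLeft k b • dx + envRight k X • D b) →
      ∀ z, F (z * (envLeft k X - envRight k X)) = z • dx := by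
  -- F sends b ⊗ c to D(b)c, so F((b ⊗ c)(X ⊗ 1 - 1 ⊗ X)) = (D(bX) - D(b)X)c, which by the Leibniz
  -- rule is b·dx·c.
  let F : B ⊗[k] Bᵐᵒᵖ →ₗ[k] C := TensorProduct.lift
    (LinearMap.mk₂ k (fun b c => envRight k (unop c) • D b)
      (fun b b' c => by rw [map_add, smul_add])
      (fun r b c => by
        rw [map_smul, ← algebraMap_smul (B ⊗[k] Bᵐᵒᵖ) r, smul_smul, ← Algebra.commutes, mul_smul,
          algebraMap_smul])
      (fun b c c' => by rw [unop_add, map_add, add_smul])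
      (fun r b c => by rw [unop_smul, map_smul, smul_assoc]))
  have hF : ∀ b c, F (b ⊗ₜ c) = envRight k (unop c) • D b := fun _ _ => rfl
  refine ⟨F, fun X dx hX z => ?_⟩
  induction z using TensorProduct.induction_on with
  | zero =>
    rw [zero_mul, map_zero]
    exact (zero_smul (B ⊗[k] Bᵐᵒᵖ) dx).symm
  | add a b ha hb => rw [add_mul, map_add, ha, hb, add_smul]
  | tmul b c =>
    rw [mul_sub, map_sub, tmul_mul_envLeft, tmul_mul_envRight, hF, hF, hX, unop_op,
      envRight_mul, smul_add, mul_smul, add_sub_cancel_right, smul_smul, envRight_mul_envLeft,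
      op_unop]

/-- Exactness of the bimodule complex at the term in degree one, given that derivations exist. -/
theorem env_exact_one {f₁ f₂ g₁ g₂ z₁₁ z₁₂ z₂₁ z₂₂ : B ⊗[k] Bᵐᵒᵖ}
    (h₁₁ : g₁ * z₁₁ = z₁₁ * f₁) (h₁₂ : g₁ * z₁₂ = z₁₂ * f₂)
    (h₂₁ : g₂ * z₂₁ = z₂₁ * f₁) (h₂₂ : g₂ * z₂₂ = z₂₂ * f₂)
    (hf₁ : f₁ * f₁ = f₁) (hf₂ : f₂ * f₂ = f₂)
    (hder : ∀ (C : Type u) [AddCommGroup C] [Module (B ⊗[k] Bᵐᵒᵖ) C] [Module k C]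
      [IsScalarTower k (B ⊗[k] Bᵐᵒᵖ) C] (dx dy : C), f₁ • dx = dx → f₂ • dy = dy →
      z₁₁ • dx + z₁₂ • dy = 0 → z₂₁ • dx + z₂₂ • dy = 0 → ∃ D : B →ₗ[k] C,
        (∀ b, D (b * X) = envLeft k b • dx + envRight k X • D b) ∧
        ∀ b, D (b * Y) = envLeft k b • dy + envRight k Y • D b)
    (s t : B ⊗[k] Bᵐᵒᵖ) (hs : s * f₁ = s) (ht : t * f₂ = t)
    (h : s * (envLeft k X - envRight k X) + t * (envLeft k Y - envRight k Y) = 0) :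
    ∃ a b : B ⊗[k] Bᵐᵒᵖ, s = a * g₁ * z₁₁ + b * g₂ * z₂₁ ∧ t = a * g₁ * z₁₂ + b * g₂ * z₂₂ := by
  -- W is the image of the second differential. In the quotient by W the classes of the two
  -- generators satisfy the derived relations by construction, so a derivation D takes these values;
  -- the map F built from D turns h into the vanishing of the class of (s, t) in the quotient.
  let W : Submodule (B ⊗[k] Bᵐᵒᵖ) ((B ⊗[k] Bᵐᵒᵖ) × (B ⊗[k] Bᵐᵒᵖ)) :=
    Submodule.span _ {(g₁ * z₁₁, g₁ * z₁₂), (g₂ * z₂₁, g₂ * z₂₂)}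
  let dx : (_ × _) ⧸ W := W.mkQ (f₁, 0)
  let dy : (_ × _) ⧸ W := W.mkQ (0, f₂)
  have hdx : ∀ z, z • dx = W.mkQ (z * f₁, 0) := fun z => by
    rw [← map_smul, Prod.smul_mk, smul_zero, smul_eq_mul]
  have hdy : ∀ z, z • dy = W.mkQ (0, z * f₂) := fun z => by
    rw [← map_smul, Prod.smul_mk, smul_zero, smul_eq_mul]
  have hsum : ∀ z w, z • dx + w • dy = W.mkQ (z * f₁, w * f₂) := fun z w => by
    rw [hdx, hdy, ← map_add, Prod.mk_add_mk, add_zero, zero_add]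
  obtain ⟨D, hDX, hDY⟩ := hder _ dx dy (by rw [hdx, hf₁]) (by rw [hdy, hf₂])
    (by
      rw [hsum, ← h₁₁, ← h₁₂]
      exact (Submodule.Quotient.mk_eq_zero W).2 (Submodule.subset_span (Or.inl rfl)))
    (by
      rw [hsum, ← h₂₁, ← h₂₂]
      exact (Submodule.Quotient.mk_eq_zero W).2 (Submodule.subset_span (Or.inr rfl)))
  obtain ⟨F, hF⟩ := exists_env_lift D
  have h0 := congrArg F h
  rw [map_add, hF X dx hDX, hF Y dy hDY, map_zero, hsum, hs, ht] at h0
  obtain ⟨a, b, hab⟩ := Submodule.mem_span_pair.1 ((Submodule.Quotient.mk_eq_zero W).1 h0)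
  refine ⟨a, b, ?_, ?_⟩
  · simpa [mul_assoc] using (congrArg Prod.fst hab).symm
  · simpa [mul_assoc] using (congrArg Prod.snd hab).symm

end Exactness

/-! ### Extending derivations to matrix algebras -/

section MatrixDerivation

variable {k A B C : Type u} [CommRing k] [Ring A] [Algebra k A] [Ring B] [Algebra k B]
  [AddCommGroup C] [Module (B ⊗[k] Bᵐᵒᵖ) C] [Module k C] [IsScalarTower k (B ⊗[k] Bᵐᵒᵖ) C]

/-- Extension of a derivation `δ : A → C` to a ring `B` of matrices over `A` containing the
diagonal idempotents, along a compatible homomorphism `φ : A → B`. -/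
theorem exists_matrix_derivation {ℓ : ℕ} (e : ℕ → B) (he : ∑ v : Fin ℓ, e v = 1)
    (c : Fin ℓ → Fin ℓ → B →ₗ[k] A)
    (hmul : ∀ b b' i j, c i j (b * b') = ∑ r, c i r b * c r j b') (φ : A →ₐ[k] B)
    (hφ : ∀ b (i j : Fin ℓ), e i * φ (c i j b) = e i * b * e j)
    (hφ' : ∀ b (i j : Fin ℓ), φ (c i j b) * e j = e i * b * e j)
    (δ : A →ₗ[k] C) (hδ : ∀ a b, δ (a * b) = envLeft k (φ a) • δ b + envRight k (φ b) • δ a) :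
    ∃ D : B →ₗ[k] C,
      (∀ b, D b = ∑ i : Fin ℓ, ∑ j : Fin ℓ, (envLeft k (e i) * envRight k (e j)) • δ (c i j b)) ∧
      ∀ b b', D (b * b') = envLeft k b • D b' + envRight k b' • D b := by
  let E (i j : ℕ) := envLeft k (e i) * envRight k (e j)
  let D : B →ₗ[k] C :=
    { toFun b := ∑ i : Fin ℓ, ∑ j : Fin ℓ, E i j • δ (c i j b)
      map_add' b c := by
        simp only [map_add, smul_add, Finset.sum_add_distrib]
      map_smul' r b := by
        simp only [map_smul, Finset.smul_sum, RingHom.id_apply]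
        refine Finset.sum_congr rfl fun i _ => Finset.sum_congr rfl fun j _ => ?_
        rw [← algebraMap_smul (B ⊗[k] Bᵐᵒᵖ) r, smul_smul, ← Algebra.commutes, mul_smul,
          algebraMap_smul] }
  have hD : ∀ b, D b = ∑ i : Fin ℓ, ∑ j : Fin ℓ, E i j • δ (c i j b) := fun _ => rfl
  refine ⟨D, hD, fun b b' => ?_⟩
  -- The Leibniz rule for δ is applied to each product of entries. The outer idempotents convert φ
  -- of an entry back into a Peirce component of b or b', and summing these components over the free
  -- outer index leaves b e_r or e_r b'.
  have e1 : ∀ i j : Fin ℓ, E i j • δ (c i j (b * b')) =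
      ∑ r : Fin ℓ, ((envLeft k (e i * b * e r) * envRight k (e j)) • δ (c r j b') +
        (envLeft k (e i) * envRight k (e r * b' * e j)) • δ (c i r b)) := by
    intro i j
    rw [hmul, map_sum, Finset.smul_sum]
    refine Finset.sum_congr rfl fun r _ => ?_
    rw [hδ, smul_add, smul_smul, smul_smul, ← hφ, ← hφ', mul_assoc, mul_assoc, ← env_commute,
      ← mul_assoc, ← envLeft_mul, ← envRight_mul]
  have e2 : ∀ r : Fin ℓ, ∑ i : Fin ℓ, e i * b * e r = b * e r := fun r => by
    simp only [mul_assoc]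
    rw [← Finset.sum_mul, he, one_mul]
  have e3 : ∀ r : Fin ℓ, ∑ j : Fin ℓ, e r * b' * e j = e r * b' := fun r => by
    rw [← Finset.mul_sum, he, mul_one]
  simp only [hD, e1, Finset.sum_add_distrib]
  congr 1
  · rw [Finset.sum_congr rfl fun i _ => Finset.sum_comm, Finset.sum_comm, Finset.smul_sum]
    refine Finset.sum_congr rfl fun r _ => ?_
    rw [Finset.sum_comm, Finset.smul_sum]
    refine Finset.sum_congr rfl fun j _ => ?_
    rw [← Finset.sum_smul, ← Finset.sum_mul, ← map_sum, e2, envLeft_mul, smul_smul, mul_assoc]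
  · rw [Finset.smul_sum]
    refine Finset.sum_congr rfl fun i _ => ?_
    rw [Finset.sum_comm, Finset.smul_sum]
    refine Finset.sum_congr rfl fun r _ => ?_
    rw [← Finset.sum_smul, ← Finset.mul_sum, ← map_sum, e3, envRight_mul, smul_smul,
      ← mul_assoc, env_commute, mul_assoc]

end MatrixDerivation

/-! ### The Beilinson algebra of the down-up algebra -/

namespace DownUp

open beilinsonAlgebra

section Structure

variable {k : Type u} [CommRing k] (α β : k) (n m ℓ : ℕ)

/-- The element of the Beilinson algebra given by all arrows `x`. -/
def arrowX : beilinsonAlgebra (component α β n m) ℓ :=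
  band _ ℓ n fun _ => ⟨gen α β 0, gen_zero_mem α β n m⟩

/-- The element of the Beilinson algebra given by all arrows `y`. -/
def arrowY : beilinsonAlgebra (component α β n m) ℓ :=
  band _ ℓ m fun _ => ⟨gen α β 1, gen_one_mem α β n m⟩

theorem arrow_xxy : arrowX α β n m ℓ * arrowX α β n m ℓ * arrowY α β n m ℓ =
    β • (arrowY α β n m ℓ * arrowX α β n m ℓ * arrowX α β n m ℓ) +
    α • (arrowX α β n m ℓ * arrowY α β n m ℓ * arrowX α β n m ℓ) := by
  ext i j
  simp only [arrowX, arrowY, coe_add_apply, coe_smul_apply, band_mul_band_mul_band_apply]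
  rw [show m + n + n = n + n + m by ring, show n + m + n = n + n + m by ring]
  split_ifs
  · exact gen_xxy α β
  · simp

theorem arrow_xyy : arrowX α β n m ℓ * arrowY α β n m ℓ * arrowY α β n m ℓ =
    β • (arrowY α β n m ℓ * arrowY α β n m ℓ * arrowX α β n m ℓ) +
    α • (arrowY α β n m ℓ * arrowX α β n m ℓ * arrowY α β n m ℓ) := by
  ext i j
  simp only [arrowX, arrowY, coe_add_apply, coe_smul_apply, band_mul_band_mul_band_apply]
  rw [show m + m + n = n + m + m by ring, show m + n + m = n + m + m by ring]
  split_ifs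
  · exact gen_xyy α β
  · simp

/-- The homomorphism from the down-up algebra to the Beilinson algebra that sends each
homogeneous element to the constant band. -/
def toBeilinson : DownUp α β →ₐ[k] beilinsonAlgebra (component α β n m) ℓ :=
  lift α β (arrowX α β n m ℓ) (arrowY α β n m ℓ) (arrow_xxy α β n m ℓ) (arrow_xyy α β n m ℓ)

@[simp]
theorem toBeilinson_gen_zero : toBeilinson α β n m ℓ (gen α β 0) = arrowX α β n m ℓ :=
  lift_gen_zero _ _

@[simp]
theorem toBeilinson_gen_one : toBeilinson α β n m ℓ (gen α β 1) = arrowY α β n m ℓ :=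
  lift_gen_one _ _

variable {α β n m ℓ}

theorem toBeilinson_monomial_apply (w : List (Fin 2)) (i j : Fin ℓ) :
    (toBeilinson α β n m ℓ (monomial α β w)).1 i j =
      if (i : ℕ) = j + weight n m w then monomial α β w else 0 := by
  induction w generalizing i j with
  | nil =>
    rw [show monomial α β [] = 1 by simp [monomial], map_one]
    change (1 : Matrix (Fin ℓ) (Fin ℓ) (DownUp α β)) i j = _
    rw [Matrix.one_apply]
    simp [weight, Fin.ext_iff]
  | cons c w ih =>
    have hm : monomial α β (c :: w) = gen α β c * monomial α β w := by simp [monomial]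
    have hw : weight n m (c :: w) = ![n, m] c + weight n m w := by simp [weight]
    rw [hm, hw, map_mul]
    obtain rfl | rfl : c = 0 ∨ c = 1 := by fin_cases c <;> simp
    · rw [toBeilinson_gen_zero, arrowX, band_mul_apply, show ![n, m] 0 = n from rfl]
      simp only [ih]
      split_ifs <;> first | rfl | omega | simp
    · rw [toBeilinson_gen_one, arrowY, band_mul_apply, show ![n, m] 1 = m from rfl]
      simp only [ih]
      split_ifs <;> first | rfl | omega | simp

theorem toBeilinson_apply {d : ℕ} {a : DownUp α β} (ha : a ∈ component α β n m d) (i j : Fin ℓ) :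
    (toBeilinson α β n m ℓ a).1 i j = if (i : ℕ) = j + d then a else 0 := by
  refine Submodule.span_induction ?_ ?_ ?_ ?_ ha
  · rintro _ ⟨w, rfl, rfl⟩
    exact toBeilinson_monomial_apply w i j
  · rw [map_zero, ite_self, coe_zero_apply]
  · intro a b _ _ h1 h2
    rw [map_add, coe_add_apply, h1, h2]
    split_ifs <;> simp
  · intro c a _ h1
    rw [map_smul, coe_smul_apply, h1]
    split_ifs <;> simp

/-- The entry b_{ij} is homogeneous of degree i - j, so its constant band meets row i only in column
j; cutting down to row i leaves a single Peirce component. -/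
theorem idem_mul_toBeilinson_entry (b : beilinsonAlgebra (component α β n m) ℓ) (i j : Fin ℓ) :
    idem _ ℓ i * toBeilinson α β n m ℓ (b.1 i j) = idem _ ℓ i * b * idem _ ℓ j := by
  ext r s
  rw [mul_idem_apply, idem_mul_apply, idem_mul_apply]
  rcases le_or_gt j i with h | h
  · have h' : (j : ℕ) ≤ i := h
    rw [toBeilinson_apply ((b.2 i j).1 h)]
    by_cases hr : (r : ℕ) = i
    · obtain rfl := Fin.ext hr
      by_cases hs : (s : ℕ) = j
      · obtain rfl := Fin.ext hs
        rw [if_pos rfl, if_pos rfl, if_pos rfl, if_pos (by omega)]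
      · rw [if_pos rfl, if_neg (by omega), if_neg hs]
    · rw [if_neg hr, if_neg hr, ite_self]
  · rw [(b.2 i j).2 h, map_zero, coe_zero_apply, ite_self]
    split_ifs with h1 h2
    · rw [Fin.ext h1, Fin.ext h2, (b.2 i j).2 h]
    · rfl
    · rfl

theorem toBeilinson_entry_mul_idem (b : beilinsonAlgebra (component α β n m) ℓ) (i j : Fin ℓ) :
    toBeilinson α β n m ℓ (b.1 i j) * idem _ ℓ j = idem _ ℓ i * b * idem _ ℓ j := by
  ext r s
  rw [mul_idem_apply, mul_idem_apply, idem_mul_apply]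
  rcases le_or_gt j i with h | h
  · have h' : (j : ℕ) ≤ i := h
    rw [toBeilinson_apply ((b.2 i j).1 h)]
    by_cases hs : (s : ℕ) = j
    · obtain rfl := Fin.ext hs
      by_cases hr : (r : ℕ) = i
      · obtain rfl := Fin.ext hr
        rw [if_pos rfl, if_pos rfl, if_pos rfl, if_pos (by omega)]
      · rw [if_pos rfl, if_neg (by omega), if_pos rfl, if_neg hr]
    · rw [if_neg hs, if_neg hs]
  · rw [(b.2 i j).2 h, map_zero, coe_zero_apply, ite_self]
    split_ifs with h1 h2
    · rw [Fin.ext h1, Fin.ext h2, (b.2 i j).2 h]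
    · rfl
    · rfl

theorem sum_idem_fin : ∑ v : Fin ℓ, idem (component α β n m) ℓ v = 1 := by
  rw [← sum_idem, Finset.sum_range]

/-- S contains the image of A, since that image is generated by the arrows; each Peirce component
e_i b e_j is then e_i times an element of this image. -/
theorem subalgebra_eq_top (S : Subalgebra k (beilinsonAlgebra (component α β n m) ℓ))
    (hX : arrowX α β n m ℓ ∈ S) (hY : arrowY α β n m ℓ ∈ S)
    (he : ∀ v, idem (component α β n m) ℓ v ∈ S) : S = ⊤ := by
  have hφ : ∀ a, toBeilinson α β n m ℓ a ∈ S := by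
    intro a
    induction a using DownUp.induction with
    | hs c => rw [AlgHom.commutes]; exact S.algebraMap_mem c
    | hx => simpa using hX
    | hy => simpa using hY
    | hadd a b ha hb => rw [map_add]; exact S.add_mem ha hb
    | hmul a b ha hb => rw [map_mul]; exact S.mul_mem ha hb
  rw [eq_top_iff]
  rintro b -
  rw [← one_mul b, ← mul_one (1 * b), ← sum_idem_fin, Finset.sum_mul, Finset.sum_mul]
  refine S.sum_mem fun i _ => ?_
  rw [Finset.mul_sum]
  refine S.sum_mem fun j _ => ?_
  rw [← idem_mul_toBeilinson_entry]
  exact S.mul_mem (he _) (hφ _)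

end Structure

/-! ### Arrows, idempotents and derivations of an algebra isomorphic to the Beilinson algebra -/

section Transfer

variable {k : Type u} [CommRing k] {α β : k} {n m ℓ : ℕ} {B : Type u} [Ring B] [Algebra k B]
  (ι : B ≃ₐ[k] beilinsonAlgebra (component α β n m) ℓ)

/-- The diagonal idempotents of an algebra isomorphic to the Beilinson algebra. -/
def modelIdem (v : ℕ) : B := ι.symm (idem _ ℓ v)

/-- The arrows `x` of an algebra isomorphic to the Beilinson algebra. -/
def modelX : B := ι.symm (arrowX α β n m ℓ)

/-- The arrows `y` of an algebra isomorphic to the Beilinson algebra. -/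
def modelY : B := ι.symm (arrowY α β n m ℓ)

theorem isPeirce_modelIdem : IsPeirce (modelIdem ι) ℓ where
  mul_eq v w := by
    rw [modelIdem, modelIdem, ← map_mul, idem_mul_idem]
    split_ifs
    · rfl
    · exact map_zero _
  eq_zero h := by rw [modelIdem, idem_of_le h, map_zero]
  sum_eq := by
    rw [← map_one ι.symm, ← sum_idem, map_sum]
    rfl

theorem isShift_symm_band (d : ℕ) (a : ℕ → component α β n m d) :
    IsShift (modelIdem ι) d (ι.symm (band _ ℓ d a)) where
  mul_idem v := by
    rw [modelIdem, modelIdem, ← map_mul, ← map_mul, band_mul_idem]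
  idem_mul h := by
    rw [modelIdem, ← map_mul, idem_mul_band_of_lt d a h, map_zero]

theorem isShift_modelX : IsShift (modelIdem ι) n (modelX ι) := isShift_symm_band ι n _

theorem isShift_modelY : IsShift (modelIdem ι) m (modelY ι) := isShift_symm_band ι m _

theorem model_xxy : modelX ι * modelX ι * modelY ι =
    β • (modelY ι * modelX ι * modelX ι) + α • (modelX ι * modelY ι * modelX ι) := by
  simp only [modelX, modelY, ← map_mul, ← map_smul, ← map_add, arrow_xxy]

theorem model_xyy : modelX ι * modelY ι * modelY ι =
    β • (modelY ι * modelY ι * modelX ι) + α • (modelY ι * modelX ι * modelY ι) := by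
  simp only [modelX, modelY, ← map_mul, ← map_smul, ← map_add, arrow_xyy]

theorem model_subalgebra_eq_top (S : Subalgebra k B) (hX : modelX ι ∈ S) (hY : modelY ι ∈ S)
    (he : ∀ v, modelIdem ι v ∈ S) : S = ⊤ := by
  have := subalgebra_eq_top (S.comap ι.symm.toAlgHom) hX hY he
  rw [eq_top_iff]
  rintro b -
  have hb : ι b ∈ S.comap ι.symm.toAlgHom := this ▸ Algebra.mem_top
  have : ι.symm (ι b) ∈ S := hb
  rwa [ι.symm_apply_apply] at this

/-- Derivations of the Beilinson algebra over the diagonal subalgebra exist for all values on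
arrows that satisfy the derived relations. -/
theorem exists_model_derivation (C : Type u) [AddCommGroup C]
    [Module (B ⊗[k] Bᵐᵒᵖ) C] [Module k C] [IsScalarTower k (B ⊗[k] Bᵐᵒᵖ) C] (dx dy : C)
    (hx : envIdem k (modelIdem ι) ℓ n • dx = dx) (hy : envIdem k (modelIdem ι) ℓ m • dy = dy)
    (h₁ : foxXXYx α β (envLeft k (modelX ι)) (envLeft k (modelY ι))
        (envRight k (modelX ι)) (envRight k (modelY ι)) • dx +
      foxXXYy α β (envLeft k (modelX ι)) (envRight k (modelX ι)) • dy = 0)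
    (h₂ : foxXYYx α β (envLeft k (modelY ι)) (envRight k (modelY ι)) • dx +
      foxXYYy α β (envLeft k (modelX ι)) (envLeft k (modelY ι))
        (envRight k (modelX ι)) (envRight k (modelY ι)) • dy = 0) :
    ∃ D : B →ₗ[k] C,
      (∀ b, D (b * modelX ι) = envLeft k b • dx + envRight k (modelX ι) • D b) ∧
      ∀ b, D (b * modelY ι) = envLeft k b • dy + envRight k (modelY ι) • D b := by
  let φ : DownUp α β →ₐ[k] B := ι.symm.toAlgHom.comp (toBeilinson α β n m ℓ)
  have hφ : ∀ a, φ a = ι.symm (toBeilinson α β n m ℓ a) := fun _ => rfl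
  have hφ0 : φ (gen α β 0) = modelX ι := by rw [hφ, toBeilinson_gen_zero]; rfl
  have hφ1 : φ (gen α β 1) = modelY ι := by rw [hφ, toBeilinson_gen_one]; rfl
  obtain ⟨δ, hδx, hδy, hδ⟩ := DownUp.exists_derivation φ dx dy
    (by rwa [hφ0, hφ1]) (by rwa [hφ0, hφ1])
  let c (i j : Fin ℓ) : B →ₗ[k] DownUp α β :=
    { toFun b := (ι b).1 i j
      map_add' b b' := by rw [map_add, coe_add_apply]
      map_smul' r b := by rw [map_smul, coe_smul_apply]; rfl }
  have hc : ∀ i j b, c i j b = (ι b).1 i j := fun _ _ _ => rfl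
  have he := isPeirce_modelIdem ι
  obtain ⟨D, hD, leibniz⟩ := exists_matrix_derivation (modelIdem ι)
    (by rw [← he.sum_eq, Finset.sum_range]) c
    (fun b b' i j => by simp only [hc, map_mul, coe_mul_apply]) φ
    (fun b i j => by
      rw [hφ, hc, modelIdem, ← map_mul, idem_mul_toBeilinson_entry, map_mul, map_mul,
        ι.symm_apply_apply]
      rfl)
    (fun b i j => by
      rw [hφ, hc, modelIdem, modelIdem, ← map_mul, toBeilinson_entry_mul_idem, map_mul, map_mul,
        ι.symm_apply_apply]) δ hδ
  -- On a constant band the double sum defining D collapses to ∑_j e_{j+d}·da·e_j, which is f_d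
  -- acting on da. The hypothesis that f_d fixes da is what recovers the prescribed value.
  have hband : ∀ (d : ℕ) (a : component α β n m d) (da : C), δ a = da →
      envIdem k (modelIdem ι) ℓ d • da = da → D (ι.symm (band _ ℓ d fun _ => a)) = da := by
    intro d a da h1 h2
    rw [hD, Finset.sum_comm]
    conv_rhs => rw [← h2, envIdem, Finset.sum_smul, Finset.sum_range]
    refine Finset.sum_congr rfl fun j _ => ?_
    simp only [hc, ι.apply_symm_apply, band_apply]
    by_cases hj : (j : ℕ) + d < ℓ
    · rw [Finset.sum_eq_single ⟨j + d, hj⟩]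
      · rw [if_pos rfl, h1]
      · intro i _ hi
        rw [if_neg, map_zero, smul_zero]
        exact fun h => hi (Fin.ext h)
      · simp
    · rw [he.eq_zero (not_lt.1 hj), map_zero, zero_mul]
      refine Eq.trans ?_ (zero_smul (B ⊗[k] Bᵐᵒᵖ) da).symm
      refine Finset.sum_eq_zero fun i _ => ?_
      rw [if_neg (by omega), map_zero, smul_zero]
  exact ⟨D, fun b => by rw [leibniz, modelX, arrowX, hband n _ dx hδx hx],
    fun b => by rw [leibniz, modelY, arrowY, hband m _ dy hδy hy]⟩

end Transfer

end DownUp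

/-! ### Injectivity of the last differential -/

namespace DownUp

section Detection

open beilinsonAlgebra MulOpposite

variable {k : Type u} [CommRing k] {α β : k} {n m ℓ : ℕ} {B : Type u} [Ring B] [Algebra k B]
  (ι : B ≃ₐ[k] beilinsonAlgebra (component α β n m) ℓ) (ε : DownUp α β →ₐ[k] k)

/-- The value of a character on the entry `(i, j)`, which is zero for indices out of range. -/
def entryChar (i j : ℕ) : B →ₗ[k] k :=
  if h : i < ℓ ∧ j < ℓ then
    { toFun b := ε ((ι b).1 ⟨i, h.1⟩ ⟨j, h.2⟩)
      map_add' b b' := by rw [map_add, coe_add_apply, map_add]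
      map_smul' r b := by rw [map_smul, coe_smul_apply, map_smul, RingHom.id_apply] }
  else 0

theorem entryChar_apply {i j : ℕ} (hi : i < ℓ) (hj : j < ℓ) (b : B) :
    entryChar ι ε i j b = ε ((ι b).1 ⟨i, hi⟩ ⟨j, hj⟩) := by
  rw [entryChar, dif_pos ⟨hi, hj⟩]
  rfl

theorem entryChar_eq_zero {i j : ℕ} (h : ¬ (i < ℓ ∧ j < ℓ)) : entryChar ι ε i j = 0 := by
  rw [entryChar, dif_neg h]

theorem entryChar_mul_symm_band (d : ℕ) (a : component α β n m d) (i j : ℕ) (b : B) :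
    entryChar ι ε i j (b * ι.symm (band _ ℓ d fun _ => a)) = ε a * entryChar ι ε i (j + d) b := by
  by_cases h : i < ℓ ∧ j < ℓ
  · rw [entryChar_apply ι ε h.1 h.2, map_mul, ι.apply_symm_apply, mul_band_apply]
    split_ifs with h'
    · rw [entryChar_apply ι ε h.1 h', map_mul, mul_comm]
    · rw [entryChar_eq_zero ι ε (fun h => h' h.2), map_zero, LinearMap.zero_apply, mul_zero]
  · rw [entryChar_eq_zero ι ε h, entryChar_eq_zero ι ε (fun h' => h ⟨h'.1, by omega⟩),
      LinearMap.zero_apply, LinearMap.zero_apply, mul_zero]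

theorem entryChar_symm_band_mul (d : ℕ) (a : component α β n m d) {i : ℕ} (hi : i < ℓ) (j : ℕ)
    (b : B) : entryChar ι ε i j (ι.symm (band _ ℓ d fun _ => a) * b) =
      if d ≤ i then ε a * entryChar ι ε (i - d) j b else 0 := by
  by_cases hj : j < ℓ
  · rw [entryChar_apply ι ε hi hj, map_mul, ι.apply_symm_apply, band_mul_apply]
    split_ifs with h'
    · rw [entryChar_apply ι ε (by omega) hj, map_mul]
    · rw [map_zero]
  · rw [entryChar_eq_zero ι ε (fun h => hj h.2), entryChar_eq_zero ι ε (fun h => hj h.2),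
      LinearMap.zero_apply, LinearMap.zero_apply, mul_zero, ite_self]

/-- The functional on the enveloping algebra which takes `b ⊗ c` to the product of the values of
a character on the entries `b i p` and `c q j`. -/
def envChar (i p q j : ℕ) : B ⊗[k] Bᵐᵒᵖ →ₗ[k] k :=
  LinearMap.mul' k k ∘ₗ TensorProduct.map (entryChar ι ε i p)
    (entryChar ι ε q j ∘ₗ (opLinearEquiv k).symm.toLinearMap)

theorem envChar_tmul (i p q j : ℕ) (b : B) (c : Bᵐᵒᵖ) :
    envChar ι ε i p q j (b ⊗ₜ c) = entryChar ι ε i p b * entryChar ι ε q j (unop c) := rfl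

theorem envChar_eq_zero {q : ℕ} (hq : ℓ ≤ q) (i p j : ℕ) (t : B ⊗[k] Bᵐᵒᵖ) :
    envChar ι ε i p q j t = 0 := by
  induction t using TensorProduct.induction_on with
  | zero => exact map_zero _
  | tmul b c =>
    rw [envChar_tmul, entryChar_eq_zero ι ε (fun h => (not_lt.2 hq) h.1), LinearMap.zero_apply,
      mul_zero]
  | add s t hs ht => rw [map_add, hs, ht, add_zero]

theorem envChar_mul_envLeft (d : ℕ) (a : component α β n m d) (i p q j : ℕ) (t : B ⊗[k] Bᵐᵒᵖ) :
    envChar ι ε i p q j (t * envLeft k (ι.symm (band _ ℓ d fun _ => a))) =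
      ε a * envChar ι ε i (p + d) q j t := by
  induction t using TensorProduct.induction_on with
  | zero => rw [zero_mul, map_zero, map_zero, mul_zero]
  | tmul b c => rw [tmul_mul_envLeft, envChar_tmul, envChar_tmul, entryChar_mul_symm_band, mul_assoc]
  | add s t hs ht => rw [add_mul, map_add, map_add, hs, ht, mul_add]

theorem envChar_mul_envRight (d : ℕ) (a : component α β n m d) (i p : ℕ) {q : ℕ} (hq : q < ℓ)
    (j : ℕ) (t : B ⊗[k] Bᵐᵒᵖ) :
    envChar ι ε i p q j (t * envRight k (ι.symm (band _ ℓ d fun _ => a))) =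
      if d ≤ q then ε a * envChar ι ε i p (q - d) j t else 0 := by
  induction t using TensorProduct.induction_on with
  | zero => rw [zero_mul, map_zero, map_zero, mul_zero, ite_self]
  | tmul b c =>
    rw [tmul_mul_envRight, envChar_tmul, envChar_tmul, unop_op, entryChar_symm_band_mul _ _ _ _ hq]
    split_ifs
    · rw [mul_left_comm]
    · rw [mul_zero]
  | add s t hs ht =>
    rw [add_mul, map_add, map_add, hs, ht]
    split_ifs
    · rw [mul_add]
    · rw [add_zero]

/-- The Peirce component e_i B e_j is a copy of A_{i-j}, or zero if i < j. The bound i < j + w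
places it in the range where ε detects components of dimension at most one. -/
theorem exists_idem_mul_mul_idem {w : ℕ}
    (hw : ∀ d < w, ∃ u ∈ component α β n m d, ∀ a ∈ component α β n m d, a = ε a • u)
    (i j : ℕ) (h : i < ℓ → i < j + w) :
    ∃ g : B, ∀ b, modelIdem ι i * b * modelIdem ι j = entryChar ι ε i j b • g := by
  have he := isPeirce_modelIdem ι
  by_cases h1 : i < ℓ ∧ j < ℓ
  · obtain ⟨hi, hj⟩ := h1
    have key : ∀ b, ι (modelIdem ι i * b * modelIdem ι j) = idem _ ℓ i * ι b * idem _ ℓ j := by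
      intro b
      rw [map_mul, map_mul, modelIdem, modelIdem, ι.apply_symm_apply, ι.apply_symm_apply]
    by_cases h2 : j ≤ i
    · obtain ⟨u, hu, hu'⟩ := hw (i - j) (by have := h hi; omega)
      have hmem : ∀ b, (ι b).1 ⟨i, hi⟩ ⟨j, hj⟩ ∈ component α β n m (i - j) := fun b =>
        ((ι b).2 ⟨i, hi⟩ ⟨j, hj⟩).1 (Fin.le_def.2 h2)
      refine ⟨ι.symm (band _ ℓ (i - j) (Pi.single j ⟨u, hu⟩)), fun b => ι.injective ?_⟩
      rw [key, map_smul, ι.apply_symm_apply]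
      ext r s
      rw [mul_idem_apply, idem_mul_apply, coe_smul_apply, band_apply, entryChar_apply ι ε hi hj]
      by_cases hs : (s : ℕ) = j
      · obtain rfl : s = ⟨j, hj⟩ := Fin.ext hs
        by_cases hr : (r : ℕ) = i
        · obtain rfl : r = ⟨i, hi⟩ := Fin.ext hr
          rw [if_pos rfl, if_pos rfl, if_pos (by simp; omega), Pi.single_eq_same]
          exact hu' _ (hmem b)
        · rw [if_pos rfl, if_neg hr, if_neg (by simp; omega), smul_zero]
      · rw [if_neg hs, Pi.single_eq_of_ne hs]
        simp
    · refine ⟨0, fun b => ι.injective ?_⟩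
      rw [key, smul_zero, map_zero]
      ext r s
      rw [mul_idem_apply, idem_mul_apply, coe_zero_apply]
      split_ifs with hs hr
      · exact ((ι b).2 r s).2 (Fin.lt_def.2 (by omega))
      · rfl
      · rfl
  · refine ⟨0, fun b => ?_⟩
    rw [smul_zero]
    by_cases hi : i < ℓ
    · rw [he.eq_zero (v := j) (by omega), mul_zero]
    · rw [he.eq_zero (v := i) (by omega), zero_mul, zero_mul]

/-- An element of E f_s has components in e_i B e_{v+s} ⊗ e_v B e_j with i < ℓ and v + s < ℓ. As ℓ ≤
s + w, both degrees i - (v+s) and v - j are below w, so each such piece is at most a line on which ε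
⊗ ε is faithful. -/
theorem eq_zero_of_envChar_eq_zero {w s : ℕ} (hs : ℓ ≤ s + w)
    (hw : ∀ d < w, ∃ u ∈ component α β n m d, ∀ a ∈ component α β n m d, a = ε a • u)
    {t : B ⊗[k] Bᵐᵒᵖ} (ht : t * envIdem k (modelIdem ι) ℓ s = t)
    (h : ∀ i v j, envChar ι ε i (v + s) v j t = 0) : t = 0 := by
  have he := isPeirce_modelIdem ι
  rw [← ht, envIdem, Finset.mul_sum]
  refine Finset.sum_eq_zero fun v _ => ?_
  by_cases hv : v + s < ℓ
  · have h1 : ∀ i, ∃ g : B, ∀ b, modelIdem ι i * b * modelIdem ι (v + s) =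
        entryChar ι ε i (v + s) b • g := fun i => exists_idem_mul_mul_idem ι ε hw _ _ (by omega)
    have h2 : ∀ j, ∃ g : B, ∀ b, modelIdem ι v * b * modelIdem ι j =
        entryChar ι ε v j b • g := fun j => exists_idem_mul_mul_idem ι ε hw _ _ (by omega)
    choose g hg using h1
    choose g' hg' using h2
    have key : ∀ t : B ⊗[k] Bᵐᵒᵖ,
        t * (envLeft k (modelIdem ι (v + s)) * envRight k (modelIdem ι v)) =
        ∑ i ∈ Finset.range ℓ, ∑ j ∈ Finset.range ℓ,
          envChar ι ε i (v + s) v j t • (g i ⊗ₜ[k] op (g' j)) := by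
      intro t
      induction t using TensorProduct.induction_on with
      | zero => simp
      | tmul b c =>
        rw [← mul_assoc, tmul_mul_envLeft, tmul_mul_envRight]
        have e1 : b * modelIdem ι (v + s) =
            ∑ i ∈ Finset.range ℓ, entryChar ι ε i (v + s) b • g i := by
          rw [← one_mul (b * _), ← he.sum_eq, Finset.sum_mul]
          exact Finset.sum_congr rfl fun i _ => by rw [← mul_assoc, hg]
        have e2 : op (modelIdem ι v * unop c) =
            ∑ j ∈ Finset.range ℓ, entryChar ι ε v j (unop c) • op (g' j) := by
          rw [← mul_one (modelIdem ι v * _), ← he.sum_eq, Finset.mul_sum, Finset.op_sum]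
          exact Finset.sum_congr rfl fun j _ => by rw [hg', op_smul]
        rw [e1, e2, TensorProduct.sum_tmul]
        refine Finset.sum_congr rfl fun i _ => ?_
        rw [TensorProduct.tmul_sum]
        refine Finset.sum_congr rfl fun j _ => ?_
        rw [TensorProduct.smul_tmul_smul, envChar_tmul]
      | add s t hs ht =>
        rw [add_mul, hs, ht, ← Finset.sum_add_distrib]
        refine Finset.sum_congr rfl fun i _ => ?_
        rw [← Finset.sum_add_distrib]
        refine Finset.sum_congr rfl fun j _ => ?_
        rw [map_add, add_smul]
    rw [key]
    refine Finset.sum_eq_zero fun i _ => Finset.sum_eq_zero fun j _ => ?_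
    rw [h, zero_smul]
  · rw [he.eq_zero (not_lt.1 hv), map_zero, zero_mul, mul_zero]

end Detection

/-! ### Triangularity of the second differential -/

section Injectivity

variable {k : Type u} [Field k] {α β : k} {n m ℓ : ℕ} {B : Type u} [Ring B] [Algebra k B]
  (ι : B ≃ₐ[k] beilinsonAlgebra (component α β n m) ℓ)

theorem env_injective (hβ : β ≠ 0) (hn : 0 < n) (hnm : n < m) (hℓ : ℓ ≤ 2 * (n + m))
    {s t : B ⊗[k] Bᵐᵒᵖ}
    (hs : s * envIdem k (modelIdem ι) ℓ (2 * n + m) = s)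
    (ht : t * envIdem k (modelIdem ι) ℓ (n + 2 * m) = t)
    (h₁ : s * foxXXYx α β (envLeft k (modelX ι)) (envLeft k (modelY ι))
        (envRight k (modelX ι)) (envRight k (modelY ι)) +
      t * foxXYYx α β (envLeft k (modelY ι)) (envRight k (modelY ι)) = 0)
    (h₂ : s * foxXXYy α β (envLeft k (modelX ι)) (envRight k (modelX ι)) +
      t * foxXYYy α β (envLeft k (modelX ι)) (envLeft k (modelY ι))
        (envRight k (modelX ι)) (envRight k (modelY ι)) = 0) : s = 0 ∧ t = 0 := by
  have lX : ∀ ε i p q j (t : B ⊗[k] Bᵐᵒᵖ), envChar ι ε i p q j (t * envLeft k (modelX ι)) =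
      ε (gen α β 0) * envChar ι ε i (p + n) q j t :=
    fun ε i p q j t => envChar_mul_envLeft ι ε n ⟨_, gen_zero_mem α β n m⟩ i p q j t
  have lY : ∀ ε i p q j (t : B ⊗[k] Bᵐᵒᵖ), envChar ι ε i p q j (t * envLeft k (modelY ι)) =
      ε (gen α β 1) * envChar ι ε i (p + m) q j t :=
    fun ε i p q j t => envChar_mul_envLeft ι ε m ⟨_, gen_one_mem α β n m⟩ i p q j t
  have rX : ∀ ε i p q j (t : B ⊗[k] Bᵐᵒᵖ), q < ℓ → envChar ι ε i p q j (t * envRight k (modelX ι)) =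
      if n ≤ q then ε (gen α β 0) * envChar ι ε i p (q - n) j t else 0 :=
    fun ε i p q j t hq => envChar_mul_envRight ι ε n ⟨_, gen_zero_mem α β n m⟩ i p hq j t
  have rY : ∀ ε i p q j (t : B ⊗[k] Bᵐᵒᵖ), q < ℓ → envChar ι ε i p q j (t * envRight k (modelY ι)) =
      if m ≤ q then ε (gen α β 1) * envChar ι ε i p (q - m) j t else 0 :=
    fun ε i p q j t hq => envChar_mul_envRight ι ε m ⟨_, gen_one_mem α β n m⟩ i p hq j t
  have hs0 : s = 0 := by
    -- For s the degrees are below m, where only powers of x live. The character with y ↦ 0 removes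
    -- the contribution of t from the second equation and leaves s(lX² - β rX² - α lX rX) = 0. At
    -- index v the term lX² is the component of s at v, while the other two involve v - 2n and v -
    -- n: strong induction on v.
    refine eq_zero_of_envChar_eq_zero ι (charX α β) (w := m) (by omega)
      (fun d hd => exists_charX_smul α β hn hd) hs fun i v j => ?_
    induction v using Nat.strong_induction_on with
    | _ v ih =>
    by_cases hv : v < ℓ
    · have hz := congrArg (envChar ι (charX α β) i (v + m) v j) h₂
      simp only [foxXXYy, foxXYYy, mul_add, mul_sub, mul_smul_comm, ← mul_assoc, map_add, map_sub,
        map_smul, lX, lY, rX, rY, hv, tsub_lt_of_lt hv, charX_zero, charX_one, zero_mul, mul_zero,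
        one_mul, ite_self, smul_zero, sub_zero, add_zero, map_zero] at hz
      have e1 : v + m + n + n = v + (2 * n + m) := by ring
      rw [e1] at hz
      have z1 : n ≤ v → envChar ι (charX α β) i (v + m + n) (v - n) j s = 0 := fun h => by
        have := ih (v - n) (by omega)
        rwa [show v - n + (2 * n + m) = v + m + n by omega] at this
      have z2 : n ≤ v → n ≤ v - n → envChar ι (charX α β) i (v + m) (v - n - n) j s = 0 :=
        fun h h' => by
          have := ih (v - n - n) (by omega)
          rwa [show v - n - n + (2 * n + m) = v + m by omega] at this
      split_ifs at hz with h1 h2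
      · simpa [z1 h1, z2 h1 h2] using hz
      · simpa [z1 h1] using hz
      · simpa using hz
    · exact envChar_eq_zero _ _ (not_lt.1 hv) _ _ _ _
  refine ⟨hs0, ?_⟩
  rw [hs0, zero_mul, zero_add] at h₁
  -- For t the degrees are below n, where only the scalars survive. The equation left is t(rY² - β
  -- lY² - α lY rY) = 0, whose leading term at index v now carries the coefficient -β, so β ≠ 0 is
  -- needed; the other terms involve v - m and v - 2m.
  refine eq_zero_of_envChar_eq_zero ι (charY α β) (w := n) (by omega)
    (fun d hd => exists_char_smul α β _ hnm hd) ht fun i v j => ?_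
  induction v using Nat.strong_induction_on with
  | _ v ih =>
  by_cases hv : v < ℓ
  · have hz := congrArg (envChar ι (charY α β) i (v + n) v j) h₁
    simp only [foxXYYx, mul_sub, mul_smul_comm, ← mul_assoc, map_sub,
      map_smul, lY, rY, hv, tsub_lt_of_lt hv, charY_one, one_mul, map_zero] at hz
    have e1 : v + n + m + m = v + (n + 2 * m) := by ring
    rw [e1] at hz
    have z1 : m ≤ v → envChar ι (charY α β) i (v + n + m) (v - m) j t = 0 := fun h => by
      have := ih (v - m) (by omega)
      rwa [show v - m + (n + 2 * m) = v + n + m by omega] at this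
    have z2 : m ≤ v → m ≤ v - m → envChar ι (charY α β) i (v + n) (v - m - m) j t = 0 :=
      fun h h' => by
        have := ih (v - m - m) (by omega)
        rwa [show v - m - m + (n + 2 * m) = v + n by omega] at this
    split_ifs at hz with h1 h2
    · simpa [z1 h1, z2 h1 h2, hβ] using hz
    · simpa [z1 h1, hβ] using hz
    · simpa [hβ] using hz
  · exact envChar_eq_zero _ _ (not_lt.1 hv) _ _ _ _

end Injectivity

end DownUp

/-! ### Homomorphisms from the terms of the resolution -/

section Bimodule

open MulOpposite
open scoped ModuleCat

variable (k : Type u) [Field k] (B : Type u) [Ring B] [Algebra k B]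

theorem hochschildBimodule_tmul_smul (b c x : B) :
    ((b ⊗ₜ[k] op c : B ⊗[k] Bᵐᵒᵖ) • (show hochschildBimodule k B from x)) =
      (show hochschildBimodule k B from b * (x * c)) := by
  let _ : Module (B ⊗[k] Bᵐᵒᵖ) B := instModuleTensorProductMop k B
  exact TensorProduct.Algebra.smul_def b (op c) x

/-- The underlying vector space of the bimodule `B`. -/
def hochschildBimoduleEquiv : hochschildBimodule k B ≃ₗ[k] B where
  toFun x := x
  invFun x := x
  left_inv _ := rfl
  right_inv _ := rfl
  map_add' _ _ := rfl
  map_smul' c x := by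
    rw [← algebraMap_smul (B ⊗[k] Bᵐᵒᵖ) c x, Algebra.TensorProduct.algebraMap_apply]
    refine (hochschildBimodule_tmul_smul k B (algebraMap k B c) 1 x).trans ?_
    change algebraMap k B c * ((show B from x) * 1) = c • (show B from x)
    rw [mul_one, Algebra.smul_def]

variable {B}

theorem hochschildBimoduleEquiv_envLeft (b : B) (x : hochschildBimodule k B) :
    hochschildBimoduleEquiv k B (envLeft k b • x) = b * hochschildBimoduleEquiv k B x := by
  refine (hochschildBimodule_tmul_smul k B b 1 x).trans ?_
  change b * ((show B from x) * 1) = b * (show B from x)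
  rw [mul_one]

theorem hochschildBimoduleEquiv_envRight (b : B) (x : hochschildBimodule k B) :
    hochschildBimoduleEquiv k B (envRight k b • x) = hochschildBimoduleEquiv k B x * b := by
  refine (hochschildBimodule_tmul_smul k B 1 b x).trans ?_
  change 1 * ((show B from x) * b) = (show B from x) * b
  rw [one_mul]

/-- Identifies the augmentation t ↦ t • 1 of the resolution with the multiplication map, so that its
kernel is the one treated by `env_exact_zero`. -/
theorem hochschildBimoduleEquiv_smul (t : B ⊗[k] Bᵐᵒᵖ) :
    hochschildBimoduleEquiv k B (t • (hochschildBimoduleEquiv k B).symm 1) = envMul k B t := by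
  induction t using TensorProduct.induction_on with
  | zero =>
    rw [map_zero]
    exact (congrArg _ (zero_smul (B ⊗[k] Bᵐᵒᵖ) _)).trans
      (map_zero (hochschildBimoduleEquiv k B))
  | tmul b c =>
    refine (hochschildBimodule_tmul_smul k B b (unop c) 1).trans ?_
    rw [envMul_tmul, one_mul]
  | add s t hs ht => rw [add_smul, map_add, map_add, hs, ht]

theorem hochschildBimoduleEquiv_envIdem (e : ℕ → B) (ℓ s : ℕ) (x : hochschildBimodule k B) :
    hochschildBimoduleEquiv k B (envIdem k e ℓ s • x) =
      ∑ v ∈ Finset.range ℓ, e (v + s) * hochschildBimoduleEquiv k B x * e v := by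
  rw [envIdem, Finset.sum_smul, map_sum]
  refine Finset.sum_congr rfl fun v _ => ?_
  rw [mul_smul, hochschildBimoduleEquiv_envLeft, hochschildBimoduleEquiv_envRight, mul_assoc]

theorem mem_fixedSubspace_envIdem (e : ℕ → B) (ℓ s : ℕ) (x : hochschildBimodule k B) :
    x ∈ fixedSubspace k (hochschildBimodule k B) (envIdem k e ℓ s) ↔
      ∑ v ∈ Finset.range ℓ, e (v + s) * hochschildBimoduleEquiv k B x * e v =
        hochschildBimoduleEquiv k B x := by
  rw [← hochschildBimoduleEquiv_envIdem, (hochschildBimoduleEquiv k B).injective.eq_iff]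
  rfl

end Bimodule

namespace DownUp

open beilinsonAlgebra

/-! ### Elements of B fixed by the Peirce idempotents -/

section Fixed

open scoped ModuleCat

variable {k : Type u} [Field k] {α β : k} {n m ℓ : ℕ} {B : Type u} [Ring B] [Algebra k B]
  (ι : B ≃ₐ[k] beilinsonAlgebra (component α β n m) ℓ)

theorem sum_idem_symm_band (s : ℕ) (a : ℕ → component α β n m s) :
    ∑ v ∈ Finset.range ℓ, modelIdem ι (v + s) * ι.symm (band _ ℓ s a) * modelIdem ι v =
      ι.symm (band _ ℓ s a) := by
  have he := isPeirce_modelIdem ι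
  conv_rhs => rw [← mul_one (ι.symm _), ← he.sum_eq, Finset.mul_sum]
  refine Finset.sum_congr rfl fun v _ => ?_
  rw [← (isShift_symm_band ι s a).mul_idem, mul_assoc, he.mul_eq, if_pos rfl]

theorem symm_band_mem_fixedSubspace (s : ℕ) (a : ℕ → component α β n m s) :
    (hochschildBimoduleEquiv k B).symm (ι.symm (band _ ℓ s a)) ∈
      fixedSubspace k (hochschildBimodule k B) (envIdem k (modelIdem ι) ℓ s) := by
  rw [mem_fixedSubspace_envIdem, LinearEquiv.apply_symm_apply, sum_idem_symm_band]

theorem apply_eq_zero_of_sum_idem {s : ℕ} {b : B}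
    (hb : ∑ v ∈ Finset.range ℓ, modelIdem ι (v + s) * b * modelIdem ι v = b) {i j : Fin ℓ}
    (h : (i : ℕ) ≠ j + s) : (ι b).1 i j = 0 := by
  rw [← hb, map_sum, coe_sum_apply]
  refine Finset.sum_eq_zero fun v _ => ?_
  rw [map_mul, map_mul, modelIdem, modelIdem, ι.apply_symm_apply, ι.apply_symm_apply,
    mul_idem_apply, idem_mul_apply]
  split_ifs with h1 h2
  · omega
  · rfl
  · rfl

theorem apply_mem_component (b : B) {s v : ℕ} (h : v + s < ℓ) :
    (ι b).1 ⟨v + s, h⟩ ⟨v, by omega⟩ ∈ component α β n m s := by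
  have := ((ι b).2 ⟨v + s, h⟩ ⟨v, by omega⟩).1 (Fin.le_def.2 (Nat.le_add_right v s))
  rwa [Nat.add_sub_cancel_left] at this

theorem eq_symm_band_of_sum_idem {s : ℕ} {b : B}
    (hb : ∑ v ∈ Finset.range ℓ, modelIdem ι (v + s) * b * modelIdem ι v = b)
    (a : ℕ → component α β n m s)
    (ha : ∀ v (h : v + s < ℓ), (ι b).1 ⟨v + s, h⟩ ⟨v, by omega⟩ = a v) :
    b = ι.symm (band _ ℓ s a) := by
  apply ι.injective
  rw [ι.apply_symm_apply]
  ext i j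
  rw [band_apply]
  split_ifs with h
  · obtain ⟨i, hi⟩ := i
    dsimp only at h
    subst h
    exact ha j hi
  · exact apply_eq_zero_of_sum_idem ι hb h

/-- The elements of `B` fixed by `∑ e_{v+s} ⊗ e_v` are sequences in the component of degree `s`. -/
def fixedSubspaceEquiv (s : ℕ) :
    fixedSubspace k (hochschildBimodule k B) (envIdem k (modelIdem ι) ℓ s) ≃ₗ[k]
      (Fin (ℓ - s) → component α β n m s) where
  toFun x v := ⟨(ι (hochschildBimoduleEquiv k B x.1)).1 ⟨v + s, by omega⟩ ⟨v, by omega⟩,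
    apply_mem_component ι _ _⟩
  invFun a := ⟨(hochschildBimoduleEquiv k B).symm
    (ι.symm (band _ ℓ s fun v => if h : v < ℓ - s then a ⟨v, h⟩ else 0)),
    symm_band_mem_fixedSubspace ι s _⟩
  map_add' x y := by
    ext v
    dsimp only
    rw [Submodule.coe_add, map_add, map_add, coe_add_apply]
    rfl
  map_smul' c x := by
    ext v
    dsimp only
    rw [Submodule.coe_smul, map_smul, map_smul, coe_smul_apply]
    rfl
  left_inv x := by
    apply Subtype.ext
    rw [LinearEquiv.symm_apply_eq]
    refine (eq_symm_band_of_sum_idem ι ((mem_fixedSubspace_envIdem k _ _ _ _).1 x.2) _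
      fun v h => ?_).symm
    rw [dif_pos (by omega)]
  right_inv a := by
    ext v
    dsimp only
    rw [LinearEquiv.apply_symm_apply, ι.apply_symm_apply, band_apply, if_pos rfl, dif_pos v.2]

theorem finite_fixedSubspace (s : ℕ) [Module.Finite k (component α β n m s)] : Module.Finite k
    (fixedSubspace k (hochschildBimodule k B) (envIdem k (modelIdem ι) ℓ s)) :=
  Module.Finite.equiv (fixedSubspaceEquiv ι s).symm

theorem finrank_fixedSubspace (s : ℕ) [Module.Finite k (component α β n m s)] : Module.finrank k
    (fixedSubspace k (hochschildBimodule k B) (envIdem k (modelIdem ι) ℓ s)) =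
      (ℓ - s) * Module.finrank k (component α β n m s) := by
  have : Module.Free k (component α β n m s) := 
    Module.Free.of_divisionRing k (show Submodule k (DownUp α β) from component α β n m s)
  rw [(fixedSubspaceEquiv ι s).finrank_eq, Module.finrank_pi_fintype, Finset.sum_const,
    Finset.card_univ, Fintype.card_fin, smul_eq_mul]

/-- If a character detects the component of degree `s`, spanned by `u`, then the fixed elements
of degree `s` are scalar sequences. -/
theorem eq_symm_band_entryChar (ε : DownUp α β →ₐ[k] k) {s : ℕ} (u : component α β n m s)
    (hu : ∀ a ∈ component α β n m s, a = ε a • (u : DownUp α β))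
    (x : fixedSubspace k (hochschildBimodule k B) (envIdem k (modelIdem ι) ℓ s)) :
    hochschildBimoduleEquiv k B x.1 = ι.symm (band _ ℓ s fun v =>
      entryChar ι ε (v + s) v (hochschildBimoduleEquiv k B x.1) • u) := by
  refine eq_symm_band_of_sum_idem ι ((mem_fixedSubspace_envIdem k _ _ _ _).1 x.2) _ fun v h => ?_
  rw [entryChar_apply ι ε h (by omega)]
  exact hu _ (apply_mem_component ι _ h)

end Fixed

end DownUp

/-! ### Derivatives of the relations on the Beilinson algebra -/

section FoxSMul

variable {k E M : Type u} [CommRing k] [Ring E] [Algebra k E] [AddCommGroup M] [Module E M]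
  [Module k M] [IsScalarTower k E M] (α β : k) (lX lY rX rY : E) (p q : M)

theorem fox_xxy_smul : foxXXYx α β lX lY rX rY • p + foxXXYy α β lX rX • q =
    (rY • rX • p + lX • rY • p + lX • lX • q) -
      β • (rX • rX • q + lY • rX • p + lY • lX • p) -
      α • (rX • rY • p + lX • rX • q + lX • lY • p) := by
  simp only [foxXXYx, foxXXYy, add_smul, sub_smul, smul_assoc, mul_smul, smul_add]
  abel

theorem fox_xyy_smul : foxXYYx α β lY rY • p + foxXYYy α β lX lY rX rY • q =
    (rY • rY • p + lX • rY • q + lX • lY • q) -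
      β • (rX • rY • q + lY • rX • q + lY • lY • p) -
      α • (rY • rX • q + lY • rY • p + lY • lX • q) := by
  simp only [foxXYYx, foxXYYy, add_smul, sub_smul, smul_assoc, mul_smul, smul_add]
  abel

end FoxSMul

namespace DownUp

open beilinsonAlgebra

section Derivative

variable {k : Type u} [CommRing k] (α β : k) (n m ℓ : ℕ) (a b : ℕ → k)

/-- The element of the Beilinson algebra given by multiples of the arrows `x`. -/
def bandX : beilinsonAlgebra (component α β n m) ℓ :=
  band _ ℓ n fun v => a v • ⟨gen α β 0, gen_zero_mem α β n m⟩

/-- The element of the Beilinson algebra given by multiples of the arrows `y`. -/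
def bandY : beilinsonAlgebra (component α β n m) ℓ :=
  band _ ℓ m fun v => b v • ⟨gen α β 1, gen_one_mem α β n m⟩

/-- The Leibniz expansion of the relation is rewritten in the independent words yx² and xyx by
eliminating x²y. In the coefficient of xyx the two occurrences of a (j + m + n) cancel. -/
theorem xxy_derivative_apply (i j : Fin ℓ) :
    ((bandX α β n m ℓ a * arrowX α β n m ℓ * arrowY α β n m ℓ +
        arrowX α β n m ℓ * bandX α β n m ℓ a * arrowY α β n m ℓ +
        arrowX α β n m ℓ * arrowX α β n m ℓ * bandY α β n m ℓ b) -
      β • (bandY α β n m ℓ b * arrowX α β n m ℓ * arrowX α β n m ℓ +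
        arrowY α β n m ℓ * bandX α β n m ℓ a * arrowX α β n m ℓ +
        arrowY α β n m ℓ * arrowX α β n m ℓ * bandX α β n m ℓ a) -
      α • (bandX α β n m ℓ a * arrowY α β n m ℓ * arrowX α β n m ℓ +
        arrowX α β n m ℓ * bandY α β n m ℓ b * arrowX α β n m ℓ +
        arrowX α β n m ℓ * arrowY α β n m ℓ * bandX α β n m ℓ a)).1 i j =
    if (i : ℕ) = j + (2 * n + m) then
      (β * (a (j + m + n) + a (j + m) + b j - b (j + n + n) - a (j + n) - a j)) •
        (gen α β 1 * gen α β 0 * gen α β 0) +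
      (α * (a (j + m) + b j - b (j + n) - a j)) • (gen α β 0 * gen α β 1 * gen α β 0)
    else 0 := by
  have hsub : ∀ c d : beilinsonAlgebra (component α β n m) ℓ,
    (c - d).1 i j = c.1 i j - d.1 i j := fun _ _ => rfl
  simp only [bandX, bandY, arrowX, arrowY, hsub, coe_add_apply, coe_smul_apply,
    band_mul_band_mul_band_apply]
  rw [show m + n + n = 2 * n + m by ring, show n + m + n = 2 * n + m by ring,
    show n + n + m = 2 * n + m by ring]
  split_ifs with h
  · simp only [Submodule.coe_smul, smul_mul_assoc, mul_smul_comm, gen_xxy]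
    rw [show (j : ℕ) + m + n = j + n + m by ring]
    module
  · simp

theorem xyy_derivative_apply (i j : Fin ℓ) :
    ((bandX α β n m ℓ a * arrowY α β n m ℓ * arrowY α β n m ℓ +
        arrowX α β n m ℓ * bandY α β n m ℓ b * arrowY α β n m ℓ +
        arrowX α β n m ℓ * arrowY α β n m ℓ * bandY α β n m ℓ b) -
      β • (bandY α β n m ℓ b * arrowY α β n m ℓ * arrowX α β n m ℓ +
        arrowY α β n m ℓ * bandY α β n m ℓ b * arrowX α β n m ℓ +
        arrowY α β n m ℓ * arrowY α β n m ℓ * bandX α β n m ℓ a) -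
      α • (bandY α β n m ℓ b * arrowX α β n m ℓ * arrowY α β n m ℓ +
        arrowY α β n m ℓ * bandX α β n m ℓ a * arrowY α β n m ℓ +
        arrowY α β n m ℓ * arrowX α β n m ℓ * bandY α β n m ℓ b)).1 i j =
    if (i : ℕ) = j + (n + 2 * m) then
      (β * (a (j + m + m) + b (j + m) + b j - b (j + n + m) - b (j + n) - a j)) •
        (gen α β 1 * gen α β 1 * gen α β 0) +
      (α * (a (j + m + m) + b (j + m) - b (j + m + n) - a (j + m))) •
        (gen α β 1 * gen α β 0 * gen α β 1)
    else 0 := by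
  have hsub : ∀ c d : beilinsonAlgebra (component α β n m) ℓ,
    (c - d).1 i j = c.1 i j - d.1 i j := fun _ _ => rfl
  simp only [bandX, bandY, arrowX, arrowY, hsub, coe_add_apply, coe_smul_apply,
    band_mul_band_mul_band_apply]
  rw [show m + n + m = n + 2 * m by ring, show n + m + m = n + 2 * m by ring,
    show m + m + n = n + 2 * m by ring]
  split_ifs with h
  · simp only [Submodule.coe_smul, smul_mul_assoc, mul_smul_comm, gen_xyy]
    rw [show (j : ℕ) + m + n = j + n + m by ring]
    module
  · simp

end Derivative

end DownUp

/-! ### Translations of a finite cyclic group -/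

section Cyclic

variable {k : Type*} [CommRing k]

/-- As n is a unit modulo N, one takes for t a representative of i n⁻¹. -/
theorem Nat.Coprime.exists_mul_mod_eq {n N : ℕ} (h : n.Coprime N) {i : ℕ} (hi : i < N) :
    ∃ t, (t * n) % N = i := by
  have : NeZero N := ⟨by omega⟩
  let t : ZMod N := i * ↑(ZMod.unitOfCoprime n h)⁻¹
  have key := (ZMod.natCast_eq_natCast_iff' (t.val * n) i N).1 (by
    rw [Nat.cast_mul, ZMod.natCast_zmod_val, mul_assoc, ← ZMod.coe_unitOfCoprime n h,
      Units.inv_mul, mul_one])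
  rw [Nat.mod_eq_of_lt hi] at key
  exact ⟨_, key⟩

theorem apply_mul_mod {n N : ℕ} {f : ℕ → k} {g : k} (hN : 0 < N)
    (hf : ∀ i < N, f ((i + n) % N) = g * f i) (t : ℕ) : f ((t * n) % N) = g ^ t * f 0 := by
  induction t with
  | zero => simp
  | succ t ih =>
    rw [Nat.succ_mul, ← Nat.mod_add_mod, hf _ (Nat.mod_lt _ hN), ih]
    ring

theorem exists_sub_add_eq {m : ℕ} (hm : 0 < m) (c : ℕ → k) :
    ∃ a : ℕ → k, ∀ i, a i - a (i + m) = c i := by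
  -- Partial sums along each residue class modulo m, starting from 0 for j < m; passing from i to i
  -- + m adds the single term -c i.
  refine ⟨fun j => -∑ t ∈ Finset.range (j / m), c (t * m + j % m), fun i => ?_⟩
  dsimp only
  rw [Nat.add_mod_right, Nat.add_div_right _ hm, Finset.sum_range_succ, mul_comm (i / m),
    Nat.div_add_mod]
  ring

end Cyclic

/-! ### Sign-changing functions on a cyclic group -/

section Alternating

variable {k : Type*} [Field k]

/-- Functions on `ℤ/N` which change sign under translation by `n` and are killed by `α`. -/
def alternatingSubspace (α : k) (n N : ℕ) : Submodule k (Fin N → k) where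
  carrier := {c | ∀ i : Fin N,
    c ⟨(i + n) % N, Nat.mod_lt _ i.pos⟩ = -c i ∧ α * c i = 0}
  add_mem' {c d} hc hd i := by
    simp only [Pi.add_apply, (hc i).1, (hd i).1, mul_add, (hc i).2, (hd i).2]
    exact ⟨by ring, by ring⟩
  zero_mem' i := by simp
  smul_mem' r c hc i := by
    simp only [Pi.smul_apply, smul_eq_mul, (hc i).1, mul_left_comm α r, (hc i).2]
    exact ⟨by ring, by ring⟩

theorem apply_of_mem_alternatingSubspace {α : k} {n N : ℕ} (hN : 0 < N) {c : Fin N → k}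
    (hc : c ∈ alternatingSubspace α n N) (t : ℕ) :
    c ⟨(t * n) % N, Nat.mod_lt _ hN⟩ = (-1) ^ t * c ⟨0, hN⟩ := by
  have := apply_mul_mod (f := fun i => c ⟨i % N, Nat.mod_lt _ hN⟩) (n := n) (g := -1) hN
    (fun i hi => by
      have := (hc ⟨i, hi⟩).1
      simp only [Nat.mod_mod, Nat.mod_eq_of_lt hi, neg_one_mul]
      exact this) t
  simpa only [Nat.mod_mod, Nat.zero_mod] using this

/-- If α ≠ 0 then c = 0 at once. If N is odd, N translations by n return to the start with sign
(-1)^N = -1, so c vanishes at 0, hence on the orbit of 0, which is everything. -/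
theorem finrank_alternatingSubspace_of_not [CharZero k] {α : k} {n N : ℕ} (h : n.Coprime N)
    (h' : ¬ (Even N ∧ α = 0)) : Module.finrank k (alternatingSubspace α n N) = 0 := by
  rw [show alternatingSubspace α n N = ⊥ from ?_, finrank_bot]
  rw [eq_bot_iff]
  intro c hc
  rw [Submodule.mem_bot]
  ext i
  by_cases hα : α = 0
  · have hN : 0 < N := i.pos
    have h0 := apply_of_mem_alternatingSubspace hN hc N
    have hodd : Odd N := by
      rw [← Nat.not_even_iff_odd]
      exact fun he => h' ⟨he, hα⟩
    simp only [Nat.mul_mod_right, Nat.mul_mod_right, hodd.neg_one_pow, neg_one_mul,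
      Nat.mul_mod_right, Nat.mul_mod_right] at h0
    rw [self_eq_neg] at h0
    obtain ⟨t, ht⟩ := h.exists_mul_mod_eq i.2
    have := apply_of_mem_alternatingSubspace hN hc t
    simp only [ht, h0, mul_zero] at this
    exact this
  · exact (mul_eq_zero.1 (hc i).2).resolve_left hα

/-- For N even, n is odd, so (-1)^i is well defined modulo N and changes sign under translation by
n. Any other solution is determined by its value at 0. -/
theorem finrank_alternatingSubspace {n N : ℕ} (hN : 0 < N) (h : n.Coprime N) (hE : Even N) :
    Module.finrank k (alternatingSubspace (0 : k) n N) = 1 := by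
  have hn : Odd n := by
    rw [← Nat.not_even_iff_odd]
    intro he
    have := Nat.dvd_gcd he.two_dvd hE.two_dvd
    rw [h.gcd_eq_one] at this
    omega
  have hv : (fun i : Fin N => (-1 : k) ^ (i : ℕ)) ∈ alternatingSubspace (0 : k) n N := by
    refine fun i => ⟨?_, zero_mul _⟩
    dsimp only
    have e : (i + n) % N + N * ((i + n) / N) = i + n := Nat.mod_add_div _ _
    have := congrArg (fun r => (-1 : k) ^ r) e
    simp only [pow_add, (hE.mul_right _).neg_one_pow, mul_one, hn.neg_one_pow] at this
    rw [this, mul_neg_one]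
  refine (finrank_eq_one_iff_of_nonzero' (⟨_, hv⟩ : alternatingSubspace (0 : k) n N) ?_).2 ?_
  · intro h0
    have := congrFun (congrArg Subtype.val h0) ⟨0, hN⟩
    simp at this
  · rintro ⟨c, hc⟩
    refine ⟨c ⟨0, hN⟩, Subtype.ext (funext fun i => ?_)⟩
    obtain ⟨t, ht⟩ := h.exists_mul_mod_eq i.2
    have h1 := apply_of_mem_alternatingSubspace hN hc t
    have h2 := apply_of_mem_alternatingSubspace hN hv t
    simp only [ht] at h1 h2
    change c ⟨0, hN⟩ * (-1 : k) ^ (i : ℕ) = c i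
    change c i = _ at h1
    rw [h1, h2, pow_zero]
    ring

/-- Modulo n + m, translation by n sends v < m to v + n and v + m with v < n back to v. The
relations x²y therefore give the steps that do not wrap around, and the relations xy² those that do.
-/
theorem mem_alternatingSubspace_iff {α β : k} (hβ : β ≠ 0) {n m : ℕ} (c : ℕ → k) :
    (fun i : Fin (n + m) => c i) ∈ alternatingSubspace α n (n + m) ↔
      (∀ v < m, β * (c v + c (v + n)) = 0 ∧ α * c v = 0) ∧
      ∀ v < n, β * (c v + c (v + m)) = 0 ∧ α * c (v + m) = 0 := by
  constructor
  · intro h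
    refine ⟨fun v hv => ?_, fun v hv => ?_⟩
    · obtain ⟨h1, h2⟩ := h ⟨v, by omega⟩
      dsimp only at h1 h2
      rw [Nat.mod_eq_of_lt (by omega)] at h1
      exact ⟨by rw [h1, add_neg_cancel, mul_zero], h2⟩
    · obtain ⟨h1, h2⟩ := h ⟨v + m, by omega⟩
      dsimp only at h1 h2
      rw [show v + m + n = v + (n + m) by ring, Nat.add_mod_right,
        Nat.mod_eq_of_lt (by omega)] at h1
      exact ⟨by rw [h1, neg_add_cancel, mul_zero], h2⟩
  · rintro ⟨h1, h2⟩ ⟨i, hi⟩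
    dsimp only
    by_cases him : i < m
    · obtain ⟨h3, h4⟩ := h1 i him
      rw [Nat.mod_eq_of_lt (by omega)]
      exact ⟨eq_neg_of_add_eq_zero_right ((mul_eq_zero.1 h3).resolve_left hβ), h4⟩
    · obtain ⟨h3, h4⟩ := h2 (i - m) (by omega)
      rw [Nat.sub_add_cancel (not_lt.1 him)] at h3 h4
      rw [show i + n = i - m + (n + m) by omega, Nat.add_mod_right, Nat.mod_eq_of_lt (by omega)]
      exact ⟨eq_neg_of_add_eq_zero_left ((mul_eq_zero.1 h3).resolve_left hβ), h4⟩

theorem finrank_comap_add_finrank {V U : Type*} [AddCommGroup V] [Module k V] [AddCommGroup U]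
    [Module k U] [Module.Finite k V] {f : V →ₗ[k] U} (hf : Function.Surjective f)
    (W : Submodule k U) :
    Module.finrank k (W.comap f) + Module.finrank k U = Module.finrank k V + Module.finrank k W := by
  have : Module.Finite k U := Module.Finite.of_surjective f hf
  have h1 := LinearMap.finrank_range_add_finrank_ker (W.mkQ ∘ₗ f)
  have hs : Function.Surjective (W.mkQ ∘ₗ f) := by
    rw [LinearMap.coe_comp]
    exact W.mkQ_surjective.comp hf
  rw [LinearMap.range_eq_top.2 hs, finrank_top, LinearMap.ker_comp,
    Submodule.ker_mkQ] at h1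
  have h2 := W.finrank_quotient_add_finrank
  omega

end Alternating

/-! ### Kernels of the differentials on homomorphisms -/

namespace DownUp

open beilinsonAlgebra

section Kernels

open scoped ModuleCat

variable {k : Type u} [Field k] {α β : k} {n m ℓ : ℕ} {B : Type u} [Ring B] [Algebra k B]
  (ι : B ≃ₐ[k] beilinsonAlgebra (component α β n m) ℓ)

theorem band_unitZero : band (component α β n m) ℓ 0 (fun _ => unitZero _) = 1 := by
  ext i j
  have h : (1 : beilinsonAlgebra (component α β n m) ℓ).1 i j = if i = j then 1 else 0 := rfl
  rw [band_apply, h, add_zero]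
  simp only [Fin.ext_iff]
  rfl

theorem entryChar_add_of_comm (ε : DownUp α β →ₐ[k] k) {d : ℕ} {a : component α β n m d}
    (ha : ε a = 1) {b : B}
    (h : ι.symm (band _ ℓ d fun _ => a) * b = b * ι.symm (band _ ℓ d fun _ => a)) {j : ℕ}
    (hj : j + d < ℓ) : entryChar ι ε (j + d) (j + d) b = entryChar ι ε j j b := by
  have h1 := congrArg (entryChar ι ε (j + d) j) h
  rwa [entryChar_symm_band_mul ι ε d a hj, entryChar_mul_symm_band, if_pos (Nat.le_add_left d j),
    Nat.add_sub_cancel, ha, one_mul, one_mul, eq_comm] at h1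

theorem sub_smul_eq_zero_iff_smul_eq {E M : Type*} [Ring E] [AddCommGroup M] [Module E M]
    (a b : E) (x : M) : (a - b) • x = 0 ↔ a • x = b • x := by
  rw [sub_smul, sub_eq_zero]

/-- Connectedness of the quiver. For j < n + m, translation by n modulo n + m is realised by a step
+n or a step -m and is a single cycle; larger j are lowered by n. -/
theorem eq_apply_zero_of_add {c : ℕ → k} (h : n.Coprime m) (hn : 0 < n)
    (hc : ∀ j, j + n < 2 * (n + m) → c (j + n) = c j)
    (hc' : ∀ j, j + m < 2 * (n + m) → c (j + m) = c j) {j : ℕ} (hj : j < 2 * (n + m)) :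
    c j = c 0 := by
  induction j using Nat.strong_induction_on with
  | _ j ih =>
  by_cases hjN : j < n + m
  · obtain ⟨t, ht⟩ := (Nat.coprime_self_add_right.2 h).exists_mul_mod_eq hjN
    have := apply_mul_mod (f := c) (n := n) (N := n + m) (g := 1) (by omega) (fun i hi => by
      rw [one_mul]
      by_cases him : i < m
      · rw [Nat.mod_eq_of_lt (by omega), hc i (by omega)]
      · have h1 := hc' (i - m) (by omega)
        rw [Nat.sub_add_cancel (not_lt.1 him)] at h1
        rw [show i + n = i - m + (n + m) by omega, Nat.add_mod_right, Nat.mod_eq_of_lt (by omega),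
          h1]) t
    rwa [ht, one_pow, one_mul] at this
  · have h1 := hc (j - n) (by omega)
    rw [Nat.sub_add_cancel (by omega)] at h1
    rw [h1, ih (j - n) (by omega) (by omega)]

/-- The kernel consists of the diagonal elements commuting with all arrows. Their entries are
scalars, equal at the two ends of every arrow, hence constant. -/
theorem finrank_fixedKernel (hn : 0 < n) (hm : 0 < m) (h : n.Coprime m) (hℓ : ℓ = 2 * (n + m)) :
    Module.finrank k (fixedKernel k (hochschildBimodule k B) (envIdem k (modelIdem ι) ℓ 0)
      (envLeft k (modelX ι) - envRight k (modelX ι))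
      (envLeft k (modelY ι) - envRight k (modelY ι))) = 1 := by
  let σ := hochschildBimoduleEquiv k B
  have h1 : (1 : B) = ι.symm (band _ ℓ 0 fun _ => unitZero _) := by rw [band_unitZero, map_one]
  have hmem : σ.symm 1 ∈ fixedSubspace k (hochschildBimodule k B) (envIdem k (modelIdem ι) ℓ 0) := by
    rw [h1]
    exact symm_band_mem_fixedSubspace ι 0 _
  have hker : ∀ (b : B) (x : hochschildBimodule k B),
      (envLeft k b - envRight k b) • x = 0 ↔ b * σ x = σ x * b := by
    intro b x
    rw [sub_smul_eq_zero_iff_smul_eq, ← σ.injective.eq_iff, hochschildBimoduleEquiv_envLeft,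
      hochschildBimoduleEquiv_envRight]
  have hmem' : (⟨σ.symm 1, hmem⟩ : fixedSubspace k _ _) ∈ fixedKernel k (hochschildBimodule k B)
      (envIdem k (modelIdem ι) ℓ 0) (envLeft k (modelX ι) - envRight k (modelX ι))
      (envLeft k (modelY ι) - envRight k (modelY ι)) := by
    refine ⟨(hker _ _).2 ?_, (hker _ _).2 ?_⟩
    · rw [σ.apply_symm_apply, one_mul, mul_one]
    · rw [σ.apply_symm_apply, one_mul, mul_one]
  have hχ : ∀ v < ℓ, entryChar ι (charX α β) v v 1 = 1 := fun v hv => by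
    rw [entryChar_apply ι _ hv hv, map_one]
    have : (1 : beilinsonAlgebra (component α β n m) ℓ).1 ⟨v, hv⟩ ⟨v, hv⟩ = 1 :=
      Matrix.one_apply_eq _
    rw [this, map_one]
  refine (finrank_eq_one_iff_of_nonzero' ⟨_, hmem'⟩ ?_).2 ?_
  · intro h0
    have h2 : σ (σ.symm 1) = σ 0 := congrArg (fun x => σ x.1.1) h0
    rw [σ.apply_symm_apply, map_zero] at h2
    have h3 := hχ 0 (by omega)
    rw [h2, map_zero] at h3
    exact zero_ne_one h3
  · rintro ⟨x, hX, hY⟩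
    rw [hker] at hX hY
    let c : ℕ → k := fun v => entryChar ι (charX α β) v v (σ x.1)
    let c' : ℕ → k := fun v => entryChar ι (charY α β) v v (σ x.1)
    have hx := eq_symm_band_entryChar ι (charX α β) (unitZero _)
      (fun a ha => eq_smul_one α β hn hm (charX α β) a ha) x
    have hx' := eq_symm_band_entryChar ι (charY α β) (unitZero _)
      (fun a ha => eq_smul_one α β hn hm (charY α β) a ha) x
    -- The character nonzero on x gives invariance under +n and the one nonzero on y gives
    -- invariance under +m; on scalar entries they agree, so the two conditions concern one
    -- sequence.
    have hcc : ∀ v < ℓ, c' v = c v := by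
      intro v hv
      have h4 := congrArg (entryChar ι (charX α β) v v) hx'
      rw [entryChar_apply ι _ hv hv (ι.symm _), ι.apply_symm_apply, band_apply,
        if_pos (Nat.add_zero v).symm, Submodule.coe_smul, map_smul] at h4
      have : charX α β (unitZero (component α β n m) : DownUp α β) = 1 := map_one _
      rw [this, smul_eq_mul, mul_one] at h4
      exact h4.symm
    have hconst : ∀ v < ℓ, c v = c 0 := by
      intro v hv
      refine eq_apply_zero_of_add h hn (fun j hj => ?_) (fun j hj => ?_) (hℓ ▸ hv)
      · exact entryChar_add_of_comm ι (charX α β) (charX_zero _ _) hX (hℓ ▸ hj)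
      · rw [← hcc _ (by omega), ← hcc _ (by omega)]
        exact entryChar_add_of_comm ι (charY α β) (charY_one _ _) hY (hℓ ▸ hj)
    refine ⟨c 0, Subtype.ext (Subtype.ext (σ.injective ?_))⟩
    change σ (c 0 • σ.symm 1) = σ x.1
    rw [map_smul, σ.apply_symm_apply, hx]
    apply ι.injective
    rw [map_smul, map_one, ι.apply_symm_apply, ← band_unitZero]
    ext i j
    rw [coe_smul_apply, band_apply, band_apply]
    split_ifs
    · rw [Submodule.coe_smul, ← hconst j j.2]
      rfl
    · rw [smul_zero]

theorem eq_zero_iff_of_apply_eq {D : beilinsonAlgebra (component α β n m) ℓ}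
    {d : ℕ} {p q : ℕ → k} {M M' : DownUp α β}
    (hM : ∀ p q : k, p • M + q • M' = 0 → p = 0 ∧ q = 0)
    (hD : ∀ i j : Fin ℓ, D.1 i j = if (i : ℕ) = j + d then p j • M + q j • M' else 0) :
    D = 0 ↔ ∀ v, v + d < ℓ → p v = 0 ∧ q v = 0 := by
  constructor
  · rintro rfl v hv
    have := hD ⟨v + d, hv⟩ ⟨v, by omega⟩
    rw [if_pos rfl] at this
    exact hM _ _ this.symm
  · intro h
    ext i j
    rw [hD]
    split_ifs with hij
    · obtain ⟨hp, hq⟩ := h j (by omega)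
      rw [hp, hq, zero_smul, zero_smul, add_zero]
      rfl
    · rfl

/-- Up to sign the coefficients of yx² and xyx are β(c_v + c_{v+n}) and α c_v, where c_v measures
how far a and b are from agreeing on the paths xy and yx starting at v. -/
theorem xxy_derivative_eq_zero_iff (a b c : ℕ → k)
    (hc : ∀ v, c v = a v - a (v + m) + (b (v + n) - b v)) :
    (bandX α β n m ℓ a * arrowX α β n m ℓ * arrowY α β n m ℓ +
        arrowX α β n m ℓ * bandX α β n m ℓ a * arrowY α β n m ℓ +
        arrowX α β n m ℓ * arrowX α β n m ℓ * bandY α β n m ℓ b) -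
      β • (bandY α β n m ℓ b * arrowX α β n m ℓ * arrowX α β n m ℓ +
        arrowY α β n m ℓ * bandX α β n m ℓ a * arrowX α β n m ℓ +
        arrowY α β n m ℓ * arrowX α β n m ℓ * bandX α β n m ℓ a) -
      α • (bandX α β n m ℓ a * arrowY α β n m ℓ * arrowX α β n m ℓ +
        arrowX α β n m ℓ * bandY α β n m ℓ b * arrowX α β n m ℓ +
        arrowX α β n m ℓ * arrowY α β n m ℓ * bandX α β n m ℓ a) = 0 ↔
    ∀ v, v + (2 * n + m) < ℓ → β * (c v + c (v + n)) = 0 ∧ α * c v = 0 := by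
  refine (eq_zero_iff_of_apply_eq (d := 2 * n + m)
    (p := fun v => β * (a (v + m + n) + a (v + m) + b v - b (v + n + n) - a (v + n) - a v))
    (q := fun v => α * (a (v + m) + b v - b (v + n) - a v))
    (fun _ _ => eq_zero_of_smul_yxx_add_smul_xyx α β)
    (xxy_derivative_apply α β n m ℓ a b)).trans
    (forall_congr' fun v => imp_congr Iff.rfl ?_)
  rw [← neg_eq_zero (a := β * _), ← neg_eq_zero (a := α * _), hc, hc,
    show v + m + n = v + n + m by ring]
  refine and_congr (Eq.congr_left ?_) (Eq.congr_left ?_) <;> ring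

theorem xyy_derivative_eq_zero_iff (a b c : ℕ → k)
    (hc : ∀ v, c v = a v - a (v + m) + (b (v + n) - b v)) :
    (bandX α β n m ℓ a * arrowY α β n m ℓ * arrowY α β n m ℓ +
        arrowX α β n m ℓ * bandY α β n m ℓ b * arrowY α β n m ℓ +
        arrowX α β n m ℓ * arrowY α β n m ℓ * bandY α β n m ℓ b) -
      β • (bandY α β n m ℓ b * arrowY α β n m ℓ * arrowX α β n m ℓ +
        arrowY α β n m ℓ * bandY α β n m ℓ b * arrowX α β n m ℓ +
        arrowY α β n m ℓ * arrowY α β n m ℓ * bandX α β n m ℓ a) -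
      α • (bandY α β n m ℓ b * arrowX α β n m ℓ * arrowY α β n m ℓ +
        arrowY α β n m ℓ * bandX α β n m ℓ a * arrowY α β n m ℓ +
        arrowY α β n m ℓ * arrowX α β n m ℓ * bandY α β n m ℓ b) = 0 ↔
    ∀ v, v + (n + 2 * m) < ℓ → β * (c v + c (v + m)) = 0 ∧ α * c (v + m) = 0 := by
  refine (eq_zero_iff_of_apply_eq (d := n + 2 * m)
    (p := fun v => β * (a (v + m + m) + b (v + m) + b v - b (v + n + m) - b (v + n) - a v))
    (q := fun v => α * (a (v + m + m) + b (v + m) - b (v + m + n) - a (v + m)))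
    (fun _ _ => eq_zero_of_smul_yyx_add_smul_yxy α β)
    (xyy_derivative_apply α β n m ℓ a b)).trans
    (forall_congr' fun v => imp_congr Iff.rfl ?_)
  rw [← neg_eq_zero (a := β * _), ← neg_eq_zero (a := α * _), hc, hc,
    show v + m + n = v + n + m by ring]
  refine and_congr (Eq.congr_left ?_) (Eq.congr_left ?_) <;> ring

theorem finrank_component_eq_one (ε : DownUp α β →ₐ[k] k) {d : ℕ} {u : DownUp α β}
    (hu : u ∈ component α β n m d) (hε : ε u = 1)
    (h : ∀ a ∈ component α β n m d, a = ε a • u) :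
    Module.finrank k (component α β n m d) = 1 := by
  have h0 : u ≠ 0 := by
    rintro rfl
    rw [map_zero] at hε
    exact zero_ne_one hε
  have : component α β n m d = Submodule.span k {u} := by
    apply le_antisymm
    · intro a ha
      exact Submodule.mem_span_singleton.2 ⟨_, (h a ha).symm⟩
    · rwa [Submodule.span_singleton_le_iff_mem]
  rw [this, finrank_span_singleton h0]

theorem finite_of_finrank_submodule_pos {V : Type*} [AddCommGroup V] [Module k V]
    {S : Submodule k V} (h : 0 < Module.finrank k S) : Module.Finite k S :=
  Module.finite_of_finrank_pos h

theorem apply_fox_xxy_smul (p q : hochschildBimodule k B) :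
    ι (hochschildBimoduleEquiv k B
      (foxXXYx α β (envLeft k (modelX ι)) (envLeft k (modelY ι))
        (envRight k (modelX ι)) (envRight k (modelY ι)) • p +
      foxXXYy α β (envLeft k (modelX ι)) (envRight k (modelX ι)) • q)) =
    (ι (hochschildBimoduleEquiv k B p) * arrowX α β n m ℓ * arrowY α β n m ℓ +
        arrowX α β n m ℓ * ι (hochschildBimoduleEquiv k B p) * arrowY α β n m ℓ +
        arrowX α β n m ℓ * arrowX α β n m ℓ * ι (hochschildBimoduleEquiv k B q)) -
      β • (ι (hochschildBimoduleEquiv k B q) * arrowX α β n m ℓ * arrowX α β n m ℓ +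
        arrowY α β n m ℓ * ι (hochschildBimoduleEquiv k B p) * arrowX α β n m ℓ +
        arrowY α β n m ℓ * arrowX α β n m ℓ * ι (hochschildBimoduleEquiv k B p)) -
      α • (ι (hochschildBimoduleEquiv k B p) * arrowY α β n m ℓ * arrowX α β n m ℓ +
        arrowX α β n m ℓ * ι (hochschildBimoduleEquiv k B q) * arrowX α β n m ℓ +
        arrowX α β n m ℓ * arrowY α β n m ℓ * ι (hochschildBimoduleEquiv k B p)) := by
  rw [fox_xxy_smul]
  simp only [map_add, map_sub, map_smul, hochschildBimoduleEquiv_envLeft,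
      hochschildBimoduleEquiv_envRight, map_mul, modelX, modelY, ι.apply_symm_apply, mul_assoc]

theorem apply_fox_xyy_smul (p q : hochschildBimodule k B) :
    ι (hochschildBimoduleEquiv k B
      (foxXYYx α β (envLeft k (modelY ι)) (envRight k (modelY ι)) • p +
      foxXYYy α β (envLeft k (modelX ι)) (envLeft k (modelY ι))
        (envRight k (modelX ι)) (envRight k (modelY ι)) • q)) =
    (ι (hochschildBimoduleEquiv k B p) * arrowY α β n m ℓ * arrowY α β n m ℓ +
        arrowX α β n m ℓ * ι (hochschildBimoduleEquiv k B q) * arrowY α β n m ℓ +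
        arrowX α β n m ℓ * arrowY α β n m ℓ * ι (hochschildBimoduleEquiv k B q)) -
      β • (ι (hochschildBimoduleEquiv k B q) * arrowY α β n m ℓ * arrowX α β n m ℓ +
        arrowY α β n m ℓ * ι (hochschildBimoduleEquiv k B q) * arrowX α β n m ℓ +
        arrowY α β n m ℓ * arrowY α β n m ℓ * ι (hochschildBimoduleEquiv k B p)) -
      α • (ι (hochschildBimoduleEquiv k B q) * arrowX α β n m ℓ * arrowY α β n m ℓ +
        arrowY α β n m ℓ * ι (hochschildBimoduleEquiv k B p) * arrowY α β n m ℓ +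
        arrowY α β n m ℓ * arrowX α β n m ℓ * ι (hochschildBimoduleEquiv k B q)) := by
  rw [fox_xyy_smul]
  simp only [map_add, map_sub, map_smul, hochschildBimoduleEquiv_envLeft,
      hochschildBimoduleEquiv_envRight, map_mul, modelX, modelY, ι.apply_symm_apply, mul_assoc]

/-- The kernel is the preimage of `alternatingSubspace` under the surjection Λ : (a, b) ↦ c onto
k^{n+m}. As a has ℓ - n entries and b has ℓ - m, the fibres of Λ have dimension 3(n+m) - (n+m). -/
theorem finrank_fixedPairKernel (hβ : β ≠ 0) (hn : 1 < n) (hnm : n < m) (h : n.Coprime m)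
    (hℓ : ℓ = 2 * (n + m)) :
    Module.finrank k (fixedPairKernel k (hochschildBimodule k B) (envIdem k (modelIdem ι) ℓ n)
      (envIdem k (modelIdem ι) ℓ m)
      (foxXXYx α β (envLeft k (modelX ι)) (envLeft k (modelY ι))
        (envRight k (modelX ι)) (envRight k (modelY ι)))
      (foxXXYy α β (envLeft k (modelX ι)) (envRight k (modelX ι)))
      (foxXYYx α β (envLeft k (modelY ι)) (envRight k (modelY ι)))
      (foxXYYy α β (envLeft k (modelX ι)) (envLeft k (modelY ι))
        (envRight k (modelX ι)) (envRight k (modelY ι)))) =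
      2 * (n + m) + Module.finrank k (alternatingSubspace α n (n + m)) := by
  let N := hochschildBimodule k B
  let σ : N ≃ₗ[k] B := hochschildBimoduleEquiv k B
  let F₁ := fixedSubspace k N (envIdem k (modelIdem ι) ℓ n)
  let F₂ := fixedSubspace k N (envIdem k (modelIdem ι) ℓ m)
  have r₁ : Module.finrank k (component α β n m n) = 1 := finrank_component_eq_one (charX α β)
    (gen_zero_mem _ _ _ _) (charX_zero _ _) (eq_smul_gen_zero α β (by omega) hnm)
  have r₂ : Module.finrank k (component α β n m m) = 1 := finrank_component_eq_one (charY α β)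
    (gen_one_mem _ _ _ _) (charY_one _ _) (eq_smul_gen_one α β hn hnm h)
  have : Module.Finite k (component α β n m n) := 
    finite_of_finrank_submodule_pos (by omega)
  have : Module.Finite k (component α β n m m) := 
    finite_of_finrank_submodule_pos (by omega)
  have i₁ : Module.Finite k F₁ := finite_fixedSubspace ι n
  have i₂ : Module.Finite k F₂ := finite_fixedSubspace ι m
  have d₁ : Module.finrank k F₁ = ℓ - n := by rw [finrank_fixedSubspace, r₁, mul_one]
  have d₂ : Module.finrank k F₂ = ℓ - m := by rw [finrank_fixedSubspace, r₂, mul_one]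
  let a (v : ℕ) : F₁ →ₗ[k] k := entryChar ι (charX α β) (v + n) v ∘ₗ σ.toLinearMap ∘ₗ F₁.subtype
  let b (v : ℕ) : F₂ →ₗ[k] k := entryChar ι (charY α β) (v + m) v ∘ₗ σ.toLinearMap ∘ₗ F₂.subtype
  let c (v : ℕ) : F₁ × F₂ →ₗ[k] k := (a v - a (v + m)) ∘ₗ LinearMap.fst k F₁ F₂ +
    (b (v + n) - b v) ∘ₗ LinearMap.snd k F₁ F₂
  have hc : ∀ v p, c v p = a v p.1 - a (v + m) p.1 + (b (v + n) p.2 - b v p.2) :=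
    fun _ _ => rfl
  let Λ : F₁ × F₂ →ₗ[k] Fin (n + m) → k := LinearMap.pi fun i => c i
  have hsurj : Function.Surjective Λ := by
    -- The sequence a alone reaches every c, so b = 0. Both indices i and i + m stay in range
    -- because i + m + n < ℓ for i < n + m.
    intro z
    obtain ⟨a', ha'⟩ := exists_sub_add_eq (by omega : 0 < m)
      (fun v => if hv : v < n + m then z ⟨v, hv⟩ else 0)
    refine ⟨(⟨σ.symm (ι.symm (bandX α β n m ℓ a')), symm_band_mem_fixedSubspace ι n _⟩, 0), ?_⟩
    ext i
    have ha : ∀ v, v + n < ℓ → a v ⟨σ.symm (ι.symm (bandX α β n m ℓ a')),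
        symm_band_mem_fixedSubspace ι n _⟩ = a' v := by
      intro v hv
      change entryChar ι (charX α β) (v + n) v
        (σ (σ.symm (ι.symm (bandX α β n m ℓ a')))) = _
      rw [σ.apply_symm_apply, entryChar_apply ι _ hv (by omega), ι.apply_symm_apply, bandX,
        band_apply, if_pos rfl, Submodule.coe_smul, map_smul]
      change a' v * charX α β (gen α β 0) = a' v
      rw [charX_zero, mul_one]
    change c i _ = z i
    rw [hc, map_zero, map_zero, sub_zero, add_zero, ha _ (by omega), ha _ (by omega), ha',
      dif_pos i.2]
  have hp : ∀ p : F₁ × F₂, ι (hochschildBimoduleEquiv k B p.1.1) =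
        bandX α β n m ℓ (fun v => a v p.1) ∧
      ι (hochschildBimoduleEquiv k B p.2.1) = bandY α β n m ℓ fun v => b v p.2 := fun p => by
    rw [← ι.eq_symm_apply, ← ι.eq_symm_apply]
    exact ⟨eq_symm_band_entryChar ι (charX α β) ⟨_, gen_zero_mem α β n m⟩
      (eq_smul_gen_zero α β (by omega) hnm) p.1,
      eq_symm_band_entryChar ι (charY α β) ⟨_, gen_one_mem α β n m⟩
      (eq_smul_gen_one α β hn hnm h) p.2⟩
  have key := finrank_comap_add_finrank hsurj (alternatingSubspace α n (n + m))
  rw [Module.finrank_prod, d₁, d₂, Module.finrank_fin_fun] at key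
  rw [show fixedPairKernel k _ _ _ _ _ _ _ = (alternatingSubspace α n (n + m)).comap Λ from ?_]
  · refine Nat.add_right_cancel (m := n + m) (Eq.trans key ?_)
    omega
  ext p
  rw [Submodule.mem_comap]
  refine Iff.trans ?_ (mem_alternatingSubspace_iff hβ (fun v => c v p)).symm
  have hz : ∀ x : N, x = 0 ↔ ι (hochschildBimoduleEquiv k B x) = 0 := fun x => by
    rw [map_eq_zero_iff ι ι.injective]
    exact σ.map_eq_zero_iff.symm
  refine and_congr ?_ ?_
  · refine (hz _).trans ?_
    rw [apply_fox_xxy_smul, (hp p).1, (hp p).2,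
      xxy_derivative_eq_zero_iff _ _ (fun v => c v p) fun v => hc v p]
    exact forall_congr' fun v => imp_congr_left (by omega)
  · refine (hz _).trans ?_
    rw [apply_fox_xyy_smul, (hp p).1, (hp p).2,
      xyy_derivative_eq_zero_iff _ _ (fun v => c v p) fun v => hc v p]
    exact forall_congr' fun v => imp_congr_left (by omega)

end Kernels

end DownUp

/-! ### Hochschild cohomology of the Beilinson algebra -/

namespace DownUp

open beilinsonAlgebra

section Main

open CategoryTheory.Abelian
open scoped ModuleCat

variable {k : Type u} [Field k] {α β : k} {n m ℓ : ℕ} {B : Type u} [Ring B]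
  [Algebra k B]

theorem finrank_component_zero (hn : 0 < n) (hm : 0 < m) :
    Module.finrank k (component α β n m 0) = 1 :=
  finrank_component_eq_one (charX α β) SetLike.GradedOne.one_mem (map_one _)
    (eq_smul_one α β hn hm _)

theorem finrank_component_xyy (hn : 1 < n) (hnm : n < m) (h : n.Coprime m) :
    Module.finrank k (component α β n m (n + 2 * m)) = if n = 2 then 3 else 2 := by
  split_ifs with h2
  · subst h2
    exact finrank_component_xyy_of_eq_two α β hnm h
  · exact finrank_component_xyy_of_ne_two α β hn hnm h h2

theorem finrank_hochschildCohomology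
    (ι : B ≃ₐ[k] beilinsonAlgebra (component α β n m) ℓ) (hβ : β ≠ 0) (hn : 1 < n) (hnm : n < m) (h : n.Coprime m)
    (hℓ : ℓ = 2 * (n + m)) :
    (∀ r, Module.Finite k (HochschildCohomology k B r)) ∧
    Module.finrank k (HochschildCohomology k B 0) = 1 ∧
    Module.finrank k (HochschildCohomology k B 1) =
      1 + Module.finrank k (alternatingSubspace α n (n + m)) ∧
    Module.finrank k (HochschildCohomology k B 2) =
      (if n = 2 then n + m + 2 else n + m) +
        Module.finrank k (alternatingSubspace α n (n + m)) ∧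
    ∀ r, Module.finrank k (HochschildCohomology k B (r + 3)) = 0 := by
  have he := isPeirce_modelIdem ι
  have hX := isShift_modelX ι
  have hY := isShift_modelY ι
  have lX : ∀ {s d}, d = s + n → Intertwines (k := k) (modelIdem ι) ℓ d s (envLeft k (modelX ι)) :=
    fun h => .left hX h
  have lY : ∀ {s d}, d = s + m → Intertwines (k := k) (modelIdem ι) ℓ d s (envLeft k (modelY ι)) :=
    fun h => .left hY h
  have rX : ∀ {s d}, d = s + n → Intertwines (k := k) (modelIdem ι) ℓ d s (envRight k (modelX ι)) :=
    fun h => .right he hX h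
  have rY : ∀ {s d}, d = s + m → Intertwines (k := k) (modelIdem ι) ℓ d s (envRight k (modelY ι)) :=
    fun h => .right he hY h
  have hwX : Intertwines (modelIdem ι) ℓ n 0 (envLeft k (modelX ι) - envRight k (modelX ι)) :=
    (lX (by ring)).sub (rX (by ring))
  have hwY : Intertwines (modelIdem ι) ℓ m 0 (envLeft k (modelY ι) - envRight k (modelY ι)) :=
    (lY (by ring)).sub (rY (by ring))
  have h₁₁ : Intertwines (modelIdem ι) ℓ (2 * n + m) n
      (foxXXYx α β (envLeft k (modelX ι)) (envLeft k (modelY ι))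
        (envRight k (modelX ι)) (envRight k (modelY ι))) :=
    ((((rY (by ring)).mul (rX rfl)).add ((lX (by ring)).mul (rY rfl))).sub
      ((((lY (by ring)).mul (rX rfl)).add ((lY (by ring)).mul (lX rfl))).smul β)).sub
      ((((rX (by ring)).mul (rY rfl)).add ((lX (by ring)).mul (lY rfl))).smul α)
  have h₁₂ : Intertwines (modelIdem ι) ℓ (2 * n + m) m
      (foxXXYy α β (envLeft k (modelX ι)) (envRight k (modelX ι))) :=
    (((lX (by ring)).mul (lX rfl)).sub (((rX (by ring)).mul (rX rfl)).smul β)).sub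
      (((lX (by ring)).mul (rX rfl)).smul α)
  have h₂₁ : Intertwines (modelIdem ι) ℓ (n + 2 * m) n
      (foxXYYx α β (envLeft k (modelY ι)) (envRight k (modelY ι))) :=
    (((rY (by ring)).mul (rY rfl)).sub (((lY (by ring)).mul (lY rfl)).smul β)).sub
      (((lY (by ring)).mul (rY rfl)).smul α)
  have h₂₂ : Intertwines (modelIdem ι) ℓ (n + 2 * m) m
      (foxXYYy α β (envLeft k (modelX ι)) (envLeft k (modelY ι))
        (envRight k (modelX ι)) (envRight k (modelY ι))) :=
    ((((lX (by ring)).mul (rY rfl)).add ((lX (by ring)).mul (lY rfl))).sub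
      ((((rX (by ring)).mul (rY rfl)).add ((lY (by ring)).mul (rX rfl))).smul β)).sub
      ((((rY (by ring)).mul (rX rfl)).add ((lY (by ring)).mul (lX rfl))).smul α)
  have hxxy := model_xxy ι
  have hxyy := model_xyy ι
  have hzw₁ := fox_xxy_eq_zero (α := α) (β := β) (env_commute (k := k) (modelX ι) (modelX ι)).symm
    (env_commute (k := k) (modelY ι) (modelX ι)).symm
    (env_commute (k := k) (modelX ι) (modelY ι)).symm
    (by simp only [← envLeft_mul, ← map_smul, ← map_add, hxxy])
    (by simp only [← envRight_mul, ← map_smul, ← map_add, ← mul_assoc, hxxy])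
  have hzw₂ := fox_xyy_eq_zero (α := α) (β := β) (env_commute (k := k) (modelY ι) (modelY ι)).symm
    (env_commute (k := k) (modelY ι) (modelX ι)).symm
    (env_commute (k := k) (modelX ι) (modelY ι)).symm
    (by simp only [← envLeft_mul, ← map_smul, ← map_add, hxyy])
    (by simp only [← envRight_mul, ← map_smul, ← map_add, ← mul_assoc, hxyy])
  let σ := hochschildBimoduleEquiv k B
  have hm : ∀ b : B, (envLeft k b - envRight k b) • σ.symm 1 = 0 := by
    intro b
    rw [sub_smul_eq_zero_iff_smul_eq, ← σ.injective.eq_iff, hochschildBimoduleEquiv_envLeft,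
      hochschildBimoduleEquiv_envRight, σ.apply_symm_apply, one_mul, mul_one]
  have hm₀ : envIdem k (modelIdem ι) ℓ 0 • σ.symm 1 = σ.symm 1 := by
    rw [show (1 : B) = ι.symm (band _ ℓ 0 fun _ => unitZero _) by rw [band_unitZero, map_one]]
    exact symm_band_mem_fixedSubspace ι 0 _
  have c₀ := finrank_component_zero (α := α) (β := β) (by omega : 0 < n) (by omega : 0 < m)
  have c₁ : Module.finrank k (component α β n m n) = 1 := finrank_component_eq_one (charX α β)
    (gen_zero_mem _ _ _ _) (charX_zero _ _) (eq_smul_gen_zero α β (by omega) hnm)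
  have c₂ : Module.finrank k (component α β n m m) = 1 := finrank_component_eq_one (charY α β)
    (gen_one_mem _ _ _ _) (charY_one _ _) (eq_smul_gen_one α β hn hnm h)
  have c₃ := finrank_component_xxy α β hn hnm h
  have c₄ := finrank_component_xyy (α := α) (β := β) hn hnm h
  have : Module.Finite k (component α β n m 0) := finite_of_finrank_submodule_pos (by omega)
  have : Module.Finite k (component α β n m n) := finite_of_finrank_submodule_pos (by omega)
  have : Module.Finite k (component α β n m m) := finite_of_finrank_submodule_pos (by omega)
  have : Module.Finite k (component α β n m (2 * n + m)) :=
    finite_of_finrank_submodule_pos (by omega)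
  have : Module.Finite k (component α β n m (n + 2 * m)) :=
    finite_of_finrank_submodule_pos (by rw [c₄]; split_ifs <;> omega)
  have := finite_fixedSubspace ι 0
  have := finite_fixedSubspace ι n
  have := finite_fixedSubspace ι m
  have := finite_fixedSubspace ι (2 * n + m)
  have := finite_fixedSubspace ι (n + 2 * m)
  have main := finrank_ext_of_idempotents k (M := hochschildBimodule k B)
    (N := hochschildBimodule k B) (envIdem_mul_self he 0) (envIdem_mul_self he n)
    (envIdem_mul_self he m) (envIdem_mul_self he (2 * n + m)) (envIdem_mul_self he (n + 2 * m))
    hwX hwY h₁₁ h₁₂ h₂₁ h₂₂ hzw₁ hzw₂ (σ.symm 1) hm₀ (hm _) (hm _)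
    (fun x => ⟨envLeft k (σ x), σ.injective (by
      rw [hochschildBimoduleEquiv_envLeft, σ.apply_symm_apply, mul_one])⟩)
    (fun t ht h0 => env_exact_zero he hX hY (model_subalgebra_eq_top ι) t ht (by
      rw [← hochschildBimoduleEquiv_smul, h0, map_zero]))
    (fun s t hs ht h0 => env_exact_one h₁₁ h₁₂ h₂₁ h₂₂ (envIdem_mul_self he n)
      (envIdem_mul_self he m) (exists_model_derivation ι) s t hs ht h0)
    (fun s t hs ht => env_injective ι hβ (by omega) hnm hℓ.le hs ht)
  rw [finrank_fixedKernel ι (by omega) (by omega) h hℓ, finrank_fixedPairKernel ι hβ hn hnm h hℓ,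
    finrank_fixedSubspace, finrank_fixedSubspace, finrank_fixedSubspace, finrank_fixedSubspace,
    finrank_fixedSubspace, c₀, c₁, c₂, c₃, c₄] at main
  obtain ⟨hfin, h0, h1, h2, h3⟩ := main
  refine ⟨hfin, h0, ?_, ?_, h3⟩
  · refine Nat.add_right_cancel (m := (ℓ - 0) * 1) (h1.trans ?_)
    omega
  -- Relations of the two kinds start at m and n vertices, so the last term of the complex has
  -- dimension 2m + 2n, or 2m + 3n if n = 2. The image of the previous differential has dimension n
  -- + m, less that of `alternatingSubspace`.
  · refine Nat.add_right_cancel (m := (ℓ - n) * 1 + (ℓ - m) * 1) (h2.trans ?_)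
    have e1 : ℓ - (2 * n + m) = m := by omega
    have e2 : ℓ - (n + 2 * m) = n := by omega
    rw [e1, e2]
    split_ifs <;> omega


end Main

end DownUp

theorem Module.rank_eq_of_finrank_eq {k V : Type*} [Field k] [AddCommGroup V] [Module k V]
    [Module.Finite k V] {d e : ℕ} (h : Module.finrank k V = d) (hde : d = e) :
    Module.rank k V = e := by
  rw [← hde, ← h, Module.finrank_eq_rank]

end

theorem theorem3 {k : Type u} [Field k] [IsAlgClosed k] [CharZero k]
    (α β : k) (hβ : β ≠ 0) (n m : ℕ) (hn : 1 < n) (hnm : n ≤ m) (hgcd : Nat.gcd n m = 1) :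
    Module.rank k (HochschildCohomology k (DownUp.Beilinson α β n m) 0) = 1 ∧
    ((Even (n + m) ∧ α = 0 →
        Module.rank k (HochschildCohomology k (DownUp.Beilinson α β n m) 1) = 2) ∧
      (¬ (Even (n + m) ∧ α = 0) →
        Module.rank k (HochschildCohomology k (DownUp.Beilinson α β n m) 1) = 1)) ∧
    ((n = 2 → Even (n + m) ∧ α = 0 →
        Module.rank k (HochschildCohomology k (DownUp.Beilinson α β n m) 2) =
          ((m + 5 : ℕ) : Cardinal)) ∧
      (n = 2 → ¬ (Even (n + m) ∧ α = 0) →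
        Module.rank k (HochschildCohomology k (DownUp.Beilinson α β n m) 2) =
          ((m + 4 : ℕ) : Cardinal)) ∧
      (3 ≤ n → Even (n + m) ∧ α = 0 →
        Module.rank k (HochschildCohomology k (DownUp.Beilinson α β n m) 2) =
          ((n + m + 1 : ℕ) : Cardinal)) ∧
      (3 ≤ n → ¬ (Even (n + m) ∧ α = 0) →
        Module.rank k (HochschildCohomology k (DownUp.Beilinson α β n m) 2) =
          ((n + m : ℕ) : Cardinal))) ∧
    ∀ r : ℕ, 3 ≤ r →
      Module.rank k (HochschildCohomology k (DownUp.Beilinson α β n m) r) = 0 := by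
  have hnm' : n < m := by
    refine lt_of_le_of_ne hnm ?_
    rintro rfl
    rw [Nat.gcd_self] at hgcd
    omega
  obtain ⟨hfin, h0, h1, h2, h3⟩ := DownUp.finrank_hochschildCohomology (α := α)
    (B := DownUp.Beilinson α β n m) (AlgEquiv.refl (R := k) (A₁ := DownUp.Beilinson α β n m)) hβ hn hnm' hgcd rfl
  -- The cyclic group that governs the two cases is ℤ/(n+m), in which n must be a generator.
  have hcop : n.Coprime (n + m) := Nat.coprime_self_add_right.2 hgcd
  have hI : Even (n + m) ∧ α = 0 →
      Module.finrank k (alternatingSubspace α n (n + m)) = 1 := by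
    rintro ⟨he, rfl⟩
    exact finrank_alternatingSubspace (by omega) hcop he
  have hII : ¬ (Even (n + m) ∧ α = 0) →
      Module.finrank k (alternatingSubspace α n (n + m)) = 0 :=
    finrank_alternatingSubspace_of_not hcop
  have := hfin 0
  have := hfin 1
  have := hfin 2
  refine ⟨?_, ⟨fun h => ?_, fun h => ?_⟩, ⟨fun h h' => ?_, fun h h' => ?_, fun h h' => ?_,
    fun h h' => ?_⟩, fun r hr => ?_⟩
  · rw [← Module.finrank_eq_rank, h0, Nat.cast_one]
  · rw [← Module.finrank_eq_rank, h1, hI h]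
    norm_num
  · rw [← Module.finrank_eq_rank, h1, hII h]
    norm_num
  · refine Module.rank_eq_of_finrank_eq h2 ?_
    rw [if_pos h, hI h']
    omega
  · refine Module.rank_eq_of_finrank_eq h2 ?_
    rw [if_pos h, hII h']
    omega
  · refine Module.rank_eq_of_finrank_eq h2 ?_
    rw [if_neg (by omega), hI h']
  · refine Module.rank_eq_of_finrank_eq h2 ?_
    rw [if_neg (by omega), hII h', add_zero]
  · obtain ⟨r, rfl⟩ := Nat.exists_eq_add_of_le' hr
    have := hfin (r + 3)
    rw [← Module.finrank_eq_rank, h3, Nat.cast_zero]
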